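/- Graphs are finite, loopless, with $n\ge 1$ vertices; multiple internal edges are allowed, and there are $s\ge 0$ external edges, labelled $1,\dots,s$, each attached to one vertex. An isomorphism is a pair of bijections of the vertices and of the internal edges that preserves incidence and, for each label, the vertex carrying the external edge with that label; $\mathrm{Aut}(G)$ is the group of automorphisms of $G$. The cyclomatic number is the dimension over $\mathbb{F}_2$ of the cycle space. A graph is biconnected if it has at least two vertices, is connected, and remains connected after erasing any vertex; it is 2-edge-connected if it is connected and remains so after erasing any internal edge. A biconnected component is a maximal biconnected subgraph. Let $W^{n,k,s}_{\mathrm{biconn}}$ and $W^{n,k,s}_{2\text{-edge}}$ be the sets of biconnected and of 2-edge-connected graphs with vertices $v_1,\dots,v_n$, numbered internal edges, cyclomatic number $k$ and $s$ external edges. For a set $W$ of graphs closed under isomorphism, call a finite rational linear combination $\beta=\sum_{G\in W}\alpha_G G$ *exactly weighted on $W$* if all $\alpha_G\ge 0$ and, for every isomorphism class $\mathcal A\subseteq W$, $\sum_{G\in\mathcal A}\alpha_G=1/|\mathrm{Aut}(\mathcal A)|$ (so in particular every class in $W$ occurs). For a biconnected graph $G'$ without external edges and a graph $G$ with vertex $v_i$,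 let $r_i^{G'}(G)$ be the sum of all graphs obtained from $G$ by replacing $v_i$ by $G'$ and distributing, in all possible ways, the biconnected components of $G$ containing $v_i$ and the external edges at $v_i$ between the vertices of $G'$ (the first vertex of $G'$ keeps the name $v_i$, the other vertices and the edges of $G'$ are numbered after those of $G$). Extend $r_i^{G'}(G)$ linearly in $G$ and in $G'$. For all $n\ge2$, $k\ge1$, $t\ge0$ let $\beta^{n,k,t}_{\mathrm{biconn}}$ be any linear combination that is exactly weighted on $W^{n,k,t}_{\mathrm{biconn}}$ (such linear combinations exist). Define, for all $s\ge0$: $\beta^{1,0,s}_{2\text{-edge}}$ is the graph with one vertex and $s$ external edges; $\beta^{1,k,s}_{2\text{-edge}}=0$ for $k\ge1$; $\beta^{n,0,s}_{2\text{-edge}}=0$ for $n\ge2$; and for $n\ge2$, $k\ge1$ $$\beta^{n,k,s}_{2\text{-edge}}=\beta^{n,k,s}_{\mathrm{biconn}}+\frac1{k+n-1}\sum_{k'=1}^{k-1}\sum_{n'=2}^{n-1}\sum_{i=1}^{n-n'+1}(k'+n'-1)\,r_i^{\beta^{n',k',0}_{\mathrm{biconn}}}\bigl(\beta^{n-n'+1,k-k',s}_{2\text{-edge}}\bigr).$$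 Then for all $n\ge1$ and $k,s\ge0$, $\beta^{n,k,s}_{2\text{-edge}}$ is exactly weighted on $W^{n,k,s}_{2\text{-edge}}$. Moreover, let $C_n$ ($n\ge2$) be the cycle with $n$ vertices. Then $|\mathrm{Aut}(C_n)|=2n$, and $\frac1{2n}C_n$ is exactly weighted on $W^{n,1,0}_{\mathrm{biconn}}$. If, in the recursion for $s=0$, only these inputs are kept ($\frac1{2n}C_n$ in place of $\beta^{n,1,0}_{\mathrm{biconn}}$, and $0$ in place of $\beta^{n,k,0}_{\mathrm{biconn}}$ for $k\ge2$), the result satisfies, for $n\ge2$ and $k\ge1$, $$\beta^{n,k,0}_{2\text{-edge},C}=\delta_{k,1}\frac1{2n}C_n+\frac1{2(k+n-1)}\sum_{n'=2}^{n-1}\sum_{i=1}^{n-n'+1}r_i^{C_{n'}}\bigl(\beta^{n-n'+1,k-1,0}_{2\text{-edge},C}\bigr),$$ and for all $n\ge1$, $k\ge0$, $\beta^{n,k,0}_{2\text{-edge},C}$ is exactly weighted on the set of those graphs in $W^{n,k,0}_{2\text{-edge}}$ every biconnected component of which is a cycle. -/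

import Mathlib

open Finset

/-- A loopless graph with `n ≥ 1` vertices `0, …, n-1`, with `m` internal edges `0, …, m-1`
(multiple edges are allowed) and with `s` labelled external edges. The internal edge `a` joins the
two ends of the unordered pair `inc a`; the external edge with label `x` is attached to the vertex
`ext x`. As there are no loops, the two ends of an internal edge are told apart by the vertices they
are assigned to, so the ends of edges need no names of their own. -/
structure ExtGraph (s : ℕ) where
  n : ℕ
  m : ℕ
  pos : 0 < n
  inc : Fin m → Sym2 (Fin n)
  loopless : ∀ a, ¬ (inc a).IsDiag
  ext : Fin s → Fin n

namespace ExtGraph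

variable {s : ℕ}

/-! ### Isomorphisms -/

/-- An isomorphism of graphs: a bijection of the vertices and a bijection of the internal edges that
respect incidence; external edges are matched by their labels. -/
structure Iso (G H : ExtGraph s) where
  onV : Fin G.n ≃ Fin H.n
  onE : Fin G.m ≃ Fin H.m
  inc_map : ∀ a, H.inc (onE a) = (G.inc a).map onV
  ext_map : ∀ x, H.ext x = onV (G.ext x)

/-- The order of the automorphism group. -/
noncomputable def autOrder (G : ExtGraph s) : ℕ := Nat.card (Iso G G)

/-! ### Subgraphs, connectivity, biconnected components

A subgraph is given by a set `U` of vertices and a set `A` of internal edges with ends in `U`. -/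

/-- Every two vertices in `U` are joined by a path that uses vertices in `U` and edges in `A`. -/
def ConnOn (G : ExtGraph s) (U : Finset (Fin G.n)) (A : Finset (Fin G.m)) : Prop :=
  ∀ u ∈ U, ∀ v ∈ U,
    Relation.ReflTransGen (fun x y => x ∈ U ∧ y ∈ U ∧ ∃ a ∈ A, G.inc a = s(x, y)) u v

/-- The graph is connected. -/
def Connected (G : ExtGraph s) : Prop := G.ConnOn univ univ

/-- The graph is connected and remains so after erasing any internal edge. -/
def TwoEdgeConnected (G : ExtGraph s) : Prop :=
  G.Connected ∧ ∀ a, G.ConnOn univ (univ.erase a)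

/-- `(U, A)` is a subgraph with at least two vertices that is connected and remains so after erasing
any vertex together with the edges attached to it. -/
def BiconnOn (G : ExtGraph s) (U : Finset (Fin G.n)) (A : Finset (Fin G.m)) : Prop :=
  (∀ a ∈ A, ∀ v ∈ G.inc a, v ∈ U) ∧ 2 ≤ U.card ∧ G.ConnOn U A ∧ ∀ v ∈ U, G.ConnOn (U.erase v) A

/-- The graph is biconnected (and has at least two vertices). -/
def Biconnected (G : ExtGraph s) : Prop := G.BiconnOn univ univ

/-- `(U, A)` is a biconnected component: a maximal biconnected subgraph. -/
def IsBlock (G : ExtGraph s) (U : Finset (Fin G.n)) (A : Finset (Fin G.m)) : Prop :=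
  G.BiconnOn U A ∧
    ∀ U' A', G.BiconnOn U' A' → U ⊆ U' → A ⊆ A' → U' = U ∧ A' = A

/-- The biconnected components that contain the vertex `i`. -/
def BlocksAt (G : ExtGraph s) (i : Fin G.n) : Type :=
  {B : Finset (Fin G.n) × Finset (Fin G.m) // G.IsBlock B.1 B.2 ∧ i ∈ B.1}

noncomputable instance (G : ExtGraph s) (i : Fin G.n) : Fintype (G.BlocksAt i) := by
  classical
  unfold BlocksAt
  infer_instance

/-- `(U, A)` is a cycle: it is connected, and every vertex has degree two. -/
def IsCycleOn (G : ExtGraph s) (U : Finset (Fin G.n)) (A : Finset (Fin G.m)) : Prop :=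
  (∀ a ∈ A, ∀ v ∈ G.inc a, v ∈ U) ∧ U.Nonempty ∧ G.ConnOn U A ∧
    ∀ v ∈ U, (A.filter (fun a => v ∈ G.inc a)).card = 2

/-! ### The cyclomatic number and the classes of graphs -/

/-- The cycle space over `𝔽₂`: the sets of internal edges that meet every vertex an even number of
times. -/
def cycleSpace (G : ExtGraph s) : Submodule (ZMod 2) (Fin G.m → ZMod 2) :=
  LinearMap.ker (Matrix.mulVecLin
    (Matrix.of fun (v : Fin G.n) (a : Fin G.m) => if v ∈ G.inc a then (1 : ZMod 2) else 0))

/-- The cyclomatic number: the dimension of the cycle space. -/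
noncomputable def cyclomaticNumber (G : ExtGraph s) : ℕ := Module.finrank (ZMod 2) G.cycleSpace

/-- The biconnected graphs with `n` vertices, cyclomatic number `k` and `s` external edges. -/
def WBiconn (n k s : ℕ) : Set (ExtGraph s) :=
  {G | G.n = n ∧ G.cyclomaticNumber = k ∧ G.Biconnected}

/-- The 2-edge-connected graphs with `n` vertices, cyclomatic number `k` and `s` external edges. -/
def WTwoEdge (n k s : ℕ) : Set (ExtGraph s) :=
  {G | G.n = n ∧ G.cyclomaticNumber = k ∧ G.TwoEdgeConnected}

/-- The 2-edge-connected graphs without external edges, with `n` vertices and cyclomatic number `k`,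
every biconnected component of which is a cycle. -/
def WCycle (n k : ℕ) : Set (ExtGraph 0) :=
  {G | G ∈ WTwoEdge n k 0 ∧ ∀ U A, G.IsBlock U A → G.IsCycleOn U A}

/-- A rational linear combination of graphs in `W` with non-negative coefficients, such that the
coefficients of all graphs in the isomorphism class of any `G ∈ W` add up to `1 / |Aut G|`. -/
def IsAutWeighted (W : Set (ExtGraph s)) (β : ExtGraph s →₀ ℚ) : Prop :=
  (∀ G ∈ β.support, G ∈ W) ∧ (∀ G, 0 ≤ β G) ∧
    ∀ G ∈ W, (open Classical in ∑ H ∈ β.support with Nonempty (Iso G H), β H)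
      = 1 / (G.autOrder : ℚ)

/-! ### Gluing: the maps `r_i` -/

section Glue

variable (G : ExtGraph s) (G' : ExtGraph 0) (i : Fin G.n)

/-- The vertex `v` of `G`, seen as a vertex of the glued graph. -/
def oldV (v : Fin G.n) : Fin (G.n + G'.n - 1) :=
  ⟨v, by have := G'.pos; have := v.2; omega⟩

/-- The vertices of `G'`, renamed: the first one takes the place of the vertex `i` of `G`, the
others are numbered after the vertices of `G`. -/
def newV (l : Fin G'.n) : Fin (G.n + G'.n - 1) :=
  if h : l.val = 0 then oldV G G' i else ⟨G.n + l.val - 1, by have := l.2; omega⟩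

theorem newV_injective : Function.Injective (newV G G' i) := by
  intro l l' h
  have h1 := i.2
  unfold newV oldV at h
  split_ifs at h with h2 h3 h3
  all_goals simp only [Fin.mk.injEq] at h
  all_goals apply Fin.ext
  all_goals omega

theorem newV_ne_oldV (l : Fin G'.n) (v : Fin G.n) (hv : v ≠ i) :
    newV G G' i l ≠ oldV G G' v := by
  intro h
  have h1 := v.2
  have h2 : v.val ≠ i.val := fun h => hv (Fin.ext h)
  unfold newV oldV at h
  split_ifs at h with h3
  all_goals simp only [Fin.mk.injEq] at h
  all_goals omega

theorem oldV_injective : Function.Injective (oldV G G') := by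
  intro v w h
  simpa [oldV, Fin.ext_iff] using h

open Classical in
/-- The vertex of `G'` to which the biconnected component at `i` through the edge `a` is assigned by
`f`. (An edge attached to `i` lies in exactly one such component; the value at other edges plays no
role.) -/
noncomputable def blockTarget (f : G.BlocksAt i → Fin G'.n) (a : Fin G.m) : Fin G'.n :=
  if h : ∃ B : G.BlocksAt i, a ∈ B.1.2 then f h.choose else ⟨0, G'.pos⟩

/-- Replace the vertex `i` of `G` by the graph `G'`; every biconnected component `B` of `G` at `i`
is attached to the vertex `f B` of `G'` instead of `i`, and every external edge `x` at `i` to the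
vertex `g x` of `G'`. -/
noncomputable def glue (f : G.BlocksAt i → Fin G'.n) (g : {x // G.ext x = i} → Fin G'.n) :
    ExtGraph s where
  n := G.n + G'.n - 1
  m := G.m + G'.m
  pos := by have := G.pos; have := G'.pos; omega
  inc := Fin.addCases
    (fun a => (G.inc a).map fun v =>
      if v = i then newV G G' i (blockTarget G G' i f a) else oldV G G' v)
    (fun b => (G'.inc b).map (newV G G' i))
  loopless := by
    intro a
    refine Fin.addCases (fun a => ?_) (fun b => ?_) a
    · rw [Fin.addCases_left]
      have h := G.loopless a
      generalize G.inc a = z at h ⊢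
      induction z using Sym2.inductionOn with
      | _ u v =>
        simp only [Sym2.map_mk, Sym2.mk_isDiag_iff] at h ⊢
        split_ifs with h1 h2 h2
        · exact absurd (h1.trans h2.symm) h
        · exact newV_ne_oldV G G' i _ v h2
        · exact (newV_ne_oldV G G' i _ u h1).symm
        · exact fun h3 => h (oldV_injective G G' h3)
    · rw [Fin.addCases_right]
      have h := G'.loopless b
      generalize G'.inc b = z at h ⊢
      induction z using Sym2.inductionOn with
      | _ u v =>
        simp only [Sym2.map_mk, Sym2.mk_isDiag_iff] at h ⊢
        exact fun h3 => h (newV_injective G G' i h3)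
  ext := fun x => if h : G.ext x = i then newV G G' i (g ⟨x, h⟩) else oldV G G' (G.ext x)

end Glue

open Classical in
/-- `r_i^{G'}(G)` for graphs `G'` and `G`: the sum of the graphs obtained from `G` by replacing its
vertex `i` by `G'`, over all distributions of the biconnected components of `G` at `i` and of the
external edges of `G` at `i` between the vertices of `G'`. (It is zero when `G` has no vertex `i`.) -/
noncomputable def rGraph (i : ℕ) (G' : ExtGraph 0) (G : ExtGraph s) : ExtGraph s →₀ ℚ :=
  if h : i < G.n then
    ∑ f : G.BlocksAt ⟨i, h⟩ → Fin G'.n, ∑ g : {x // G.ext x = ⟨i, h⟩} → Fin G'.n,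
      Finsupp.single (glue G G' ⟨i, h⟩ f g) 1
  else 0

/-- The map `r_i^ϑ = ∑_{G'} ϑ_{G'} r_i^{G'}`, extended linearly to linear combinations of graphs. -/
noncomputable def r (i : ℕ) (ϑ : ExtGraph 0 →₀ ℚ) : (ExtGraph s →₀ ℚ) →ₗ[ℚ] (ExtGraph s →₀ ℚ) :=
  ϑ.sum fun G' c => c • Finsupp.linearCombination ℚ (rGraph i G')

/-! ### The recursion for 2-edge-connected graphs -/

/-- The graph with one vertex, no internal edge and `s` external edges. -/
def point (s : ℕ) : ExtGraph s where
  n := 1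
  m := 0
  pos := Nat.one_pos
  inc := Fin.elim0
  loopless := fun a => a.elim0
  ext := fun _ => 0

/-- The recursion for 2-edge-connected graphs, built from linear combinations `b t n k` of
biconnected graphs with `n` vertices, cyclomatic number `k` and `t` external edges. The lemma
`betaEdge_eq` restates the last clause, in which `j + 2` is the number of vertices `n'` of the
graph that is glued in. -/
noncomputable def betaEdge (b : (t : ℕ) → ℕ → ℕ → (ExtGraph t →₀ ℚ)) (s : ℕ) :
    ℕ → ℕ → (ExtGraph s →₀ ℚ)
  | 0, _ => 0
  | 1, 0 => Finsupp.single (point s) 1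
  | 1, _ + 1 => 0
  | _ + 2, 0 => 0
  | n + 2, k + 1 =>
    b s (n + 2) (k + 1) + (1 / ((k + 1 : ℚ) + (n + 2) - 1)) •
      ∑ k' ∈ Icc 1 k, ∑ j ∈ range n, ∑ i ∈ range (n - j + 1),
        ((k' : ℚ) + (j + 2) - 1) •
          r i (b 0 (j + 2) k') (betaEdge b s (n - j + 1) (k + 1 - k'))
  termination_by n _ => n
  decreasing_by omega

theorem betaEdge_eq (b : (t : ℕ) → ℕ → ℕ → (ExtGraph t →₀ ℚ)) (s n k : ℕ)
    (hn : 2 ≤ n) (hk : 1 ≤ k) :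
    betaEdge b s n k = b s n k + (1 / ((k : ℚ) + n - 1)) •
      ∑ k' ∈ Icc 1 (k - 1), ∑ n' ∈ Icc 2 (n - 1), ∑ i ∈ range (n - n' + 1),
        ((k' : ℚ) + n' - 1) • r i (b 0 n' k') (betaEdge b s (n - n' + 1) (k - k')) := by
  obtain ⟨n, rfl⟩ := Nat.exists_eq_add_of_le' hn
  obtain ⟨k, rfl⟩ := Nat.exists_eq_add_of_le' hk
  rw [betaEdge]
  have h : Icc 2 (n + 2 - 1) = (range n).image (· + 2) := by
    ext x
    simp only [mem_Icc, mem_image, mem_range]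
    exact ⟨fun h => ⟨x - 2, by omega, by omega⟩, by rintro ⟨y, hy, rfl⟩; omega⟩
  rw [h]
  simp only [Nat.add_sub_cancel]
  push_cast
  congr 2
  refine sum_congr rfl fun k' _ => ?_
  rw [sum_image (by intro x _ y _ h; simpa using h)]
  refine sum_congr rfl fun j _ => ?_
  rw [Nat.add_sub_add_right]
  push_cast
  rfl

/-! ### The specialization to graphs whose biconnected components are cycles -/

/-- The cycle `C_n` on `n ≥ 2` vertices, with edges `{a, a + 1 mod n}`. -/
def cycleGraph (n : ℕ) (hn : 2 ≤ n) : ExtGraph 0 where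
  n := n
  m := n
  pos := by omega
  inc := fun a => s(a, ⟨(a.val + 1) % n, Nat.mod_lt _ (by omega)⟩)
  loopless := by
    intro a h
    rw [Sym2.mk_isDiag_iff, Fin.ext_iff] at h
    have ha := a.2
    rcases Nat.lt_or_ge (a.val + 1) n with h1 | h1
    · simp only [Nat.mod_eq_of_lt h1] at h
      omega
    · have h2 : a.val + 1 = n := by omega
      simp only [h2, Nat.mod_self] at h
      omega
  ext := Fin.elim0

/-- `C_n` as an element of the free vector space on graphs (zero for `n < 2`). -/
noncomputable def cycleVec (n : ℕ) : ExtGraph 0 →₀ ℚ :=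
  if hn : 2 ≤ n then Finsupp.single (cycleGraph n hn) 1 else 0

/-- The biconnected input without external edges in which only cycles are kept: `(1 / (2n)) C_n` at
cyclomatic number one, and zero otherwise. -/
noncomputable def cycleFamily : (t : ℕ) → ℕ → ℕ → (ExtGraph t →₀ ℚ)
  | 0, n, 1 => (1 / (2 * n : ℚ)) • cycleVec n
  | _, _, _ => 0

/-- The specialized recursion for graphs whose biconnected components are cycles. The lemma
`betaCycle_eq` restates the last clause. -/
noncomputable def betaCycle : ℕ → ℕ → (ExtGraph 0 →₀ ℚ)
  | 0, _ => 0
  | 1, 0 => Finsupp.single (point 0) 1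
  | 1, _ + 1 => 0
  | _ + 2, 0 => 0
  | n + 2, k + 1 =>
    (if k + 1 = 1 then (1 / (2 * (n + 2) : ℚ)) • cycleVec (n + 2) else 0) +
      (1 / (2 * ((k + 1 : ℚ) + (n + 2) - 1))) •
        ∑ j ∈ range n, ∑ i ∈ range (n - j + 1),
          r i (cycleVec (j + 2)) (betaCycle (n - j + 1) k)
  termination_by n _ => n
  decreasing_by omega

theorem betaCycle_eq (n k : ℕ) (hn : 2 ≤ n) (hk : 1 ≤ k) :
    betaCycle n k = (if k = 1 then (1 / (2 * n : ℚ)) • cycleVec n else 0) +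
      (1 / (2 * ((k : ℚ) + n - 1))) •
        ∑ n' ∈ Icc 2 (n - 1), ∑ i ∈ range (n - n' + 1),
          r i (cycleVec n') (betaCycle (n - n' + 1) (k - 1)) := by
  obtain ⟨n, rfl⟩ := Nat.exists_eq_add_of_le' hn
  obtain ⟨k, rfl⟩ := Nat.exists_eq_add_of_le' hk
  rw [betaCycle]
  have h : Icc 2 (n + 2 - 1) = (range n).image (· + 2) := by
    ext x
    simp only [mem_Icc, mem_image, mem_range]
    exact ⟨fun h => ⟨x - 2, by omega, by omega⟩, by rintro ⟨y, hy, rfl⟩; omega⟩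
  rw [h, sum_image (by intro x _ y _ h; simpa using h)]
  push_cast
  simp only

end ExtGraph

/-! Weights are tested by counting isomorphisms. Every `H` isomorphic to `G` satisfies `|Iso(G, H)|
= |Aut G|`, so the class of `G` has total weight `1 / |Aut G|` exactly when the linear functional
`isoCount G` takes the value 1. The theorem thereby becomes a double count for one fixed graph `G`,
free of orbits and stabilizers.

Fix a connected `G`. An isomorphism from `G` to a summand of `r_i^{G'}(G'')`, with `i` running over
the vertices of `G''`, is the same thing as a `Contraction`: a way to shrink a copy of `G'` inside
`G` so that `G''` results (`sum_card_iso_glue`). If `G'` is biconnected, that copy is a block `B` of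
`G`, and the ways to shrink a given `B` differ by unique relabellings of the fibre and of the
quotient. Hence the number of contractions is `∑_B |Iso(B, G')| * |Iso(G/B, G'')|`
(`card_contraction`), and by bilinearity `∑_i isoCount G (r_i ϑ β) = ∑_B isoCount B ϑ * isoCount
(G/B) β` (`sum_isoCount_r`).

For a 2-edge-connected `G` with `n` vertices and cyclomatic number `k`, induction makes the product
on the right 1 if `B` has `n'` vertices and cyclomatic number `k'`, and 0 otherwise. The factor `k'
+ n' - 1` is then the number of edges of `B`. The blocks partition the edges, so the recursion sum
yields the number of edges of `G`, which is `k + n - 1` and cancels the prefactor. This is the case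
of a non-biconnected `G`, all of whose blocks lie in the range of summation. A biconnected `G` is
its own only block, is excluded by `n' ≤ n - 1`, and is counted once by the first term.

Blocks are handled through retractions: in a connected graph, a biconnected subgraph is a block
exactly when there is a retraction of the vertices onto it that is constant along every edge outside
it (`exists_retraction`, `isBlock_of_retraction`).

The induction is run for a property `P` that holds for `G` exactly when the corresponding properties
hold for the fibre and the quotient. A trivial `P` gives the first recursion; "every block is a
cycle" gives the specialized one. For the latter, a biconnected graph of cyclomatic number one has
all degrees two, and isomorphisms to it from `C_n` correspond to its `2n` flags
(`card_iso_cycleGraph`). -/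

namespace ExtGraph

variable {s : ℕ}

/-! ### Connectivity in terms of colourings -/

theorem ConnOn.color {G : ExtGraph s} {U : Finset (Fin G.n)} {A : Finset (Fin G.m)}
    (h : G.ConnOn U A) {α : Type*} (c : Fin G.n → α)
    (hc : ∀ a ∈ A, ∀ x ∈ U, ∀ y ∈ U, G.inc a = s(x, y) → c x = c y) :
    ∀ u ∈ U, ∀ v ∈ U, c u = c v := by
  intro u hu v hv
  have := h u hu v hv
  induction this with
  | refl => rfl
  | tail _ h2 ih =>
    obtain ⟨hx, hy, a, ha, hi⟩ := h2
    exact (ih hx).trans (hc a ha _ hx _ hy hi)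

/-- Test the colouring "reachable from `u`". Colourings pull back along maps and extend by
constants, which paths do not, so the connectivity arguments below are phrased with them. -/
theorem connOn_of_color {G : ExtGraph s} {U : Finset (Fin G.n)} {A : Finset (Fin G.m)}
    (h : ∀ c : Fin G.n → Prop,
      (∀ a ∈ A, ∀ x ∈ U, ∀ y ∈ U, G.inc a = s(x, y) → c x = c y) →
      ∀ u ∈ U, ∀ v ∈ U, c u = c v) : G.ConnOn U A := by
  intro u hu v hv
  have := h (fun w => Relation.ReflTransGen
    (fun x y => x ∈ U ∧ y ∈ U ∧ ∃ a ∈ A, G.inc a = s(x, y)) u w) (by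
      intro a ha x hx y hy hi
      refine propext ⟨fun h => h.tail ⟨hx, hy, a, ha, hi⟩, fun h => h.tail ⟨hy, hx, a, ha, ?_⟩⟩
      rw [hi, Sym2.eq_swap]) u hu v hv
  exact this.mp .refl

theorem ne_of_inc {G : ExtGraph s} {a : Fin G.m} {x y : Fin G.n} (h : G.inc a = s(x, y)) :
    x ≠ y := by
  have := G.loopless a
  rw [h] at this
  simpa using this

theorem exists_inc (G : ExtGraph s) (a : Fin G.m) : ∃ x y, G.inc a = s(x, y) := by
  generalize G.inc a = z
  induction z using Sym2.inductionOn with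
  | _ u v => exact ⟨u, v, rfl⟩

theorem BiconnOn.left_mem {G : ExtGraph s} {U : Finset (Fin G.n)} {A : Finset (Fin G.m)}
    (h : G.BiconnOn U A) {a : Fin G.m} (ha : a ∈ A) {x y : Fin G.n} (hi : G.inc a = s(x, y)) :
    x ∈ U := h.1 a ha x (by rw [hi]; exact Sym2.mem_mk_left x y)

theorem BiconnOn.right_mem {G : ExtGraph s} {U : Finset (Fin G.n)} {A : Finset (Fin G.m)}
    (h : G.BiconnOn U A) {a : Fin G.m} (ha : a ∈ A) {x y : Fin G.n} (hi : G.inc a = s(x, y)) :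
    y ∈ U := h.1 a ha y (by rw [hi]; exact Sym2.mem_mk_right x y)

theorem BiconnOn.exists_ne {G : ExtGraph s} {U : Finset (Fin G.n)} {A : Finset (Fin G.m)}
    (h : G.BiconnOn U A) (z : Fin G.n) : ∃ t ∈ U, t ≠ z :=
  Finset.exists_mem_ne h.2.1 z

/-- If `z` is not in `U`, nothing is erased and plain connectivity suffices; allowing every `z`
spares this case distinction later. -/
theorem BiconnOn.color_erase {G : ExtGraph s} {U : Finset (Fin G.n)} {A : Finset (Fin G.m)}
    (h : G.BiconnOn U A) (z : Fin G.n) {α : Type*} (c : Fin G.n → α)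
    (hc : ∀ a ∈ A, ∀ x ∈ U, ∀ y ∈ U, x ≠ z → y ≠ z → G.inc a = s(x, y) → c x = c y) :
    ∀ u ∈ U, ∀ v ∈ U, u ≠ z → v ≠ z → c u = c v := by
  intro u hu v hv huz hvz
  by_cases hz : z ∈ U
  · refine (h.2.2.2 z hz).color c ?_ u (mem_erase.2 ⟨huz, hu⟩) v (mem_erase.2 ⟨hvz, hv⟩)
    intro a ha x hx y hy
    rw [mem_erase] at hx hy
    exact hc a ha x hx.2 y hy.2 hx.1 hy.1
  · refine h.2.2.1.color c ?_ u hu v hv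
    intro a ha x hx y hy
    exact hc a ha x hx y hy (fun h => hz (h ▸ hx)) (fun h => hz (h ▸ hy))

/-- Every vertex of a biconnected subgraph is attached to an edge of it. -/
theorem BiconnOn.exists_edge {G : ExtGraph s} {U : Finset (Fin G.n)} {A : Finset (Fin G.m)}
    (h : G.BiconnOn U A) {v : Fin G.n} (hv : v ∈ U) : ∃ a ∈ A, ∃ x, G.inc a = s(v, x) := by
  by_contra! hn
  obtain ⟨t, ht, htv⟩ := h.exists_ne v
  have := h.2.2.1.color (fun w => w = v) (by
    intro a ha x hx y hy hi
    have h1 : x ≠ v := by rintro rfl; exact hn a ha _ hi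
    have h2 : y ≠ v := by rintro rfl; exact hn a ha _ (hi.trans Sym2.eq_swap)
    simp [h1, h2]) t ht v hv
  simp [htv] at this

/-! ### Biconnected components -/

/-- Whichever vertex `z` is erased, one of the two shared vertices survives and links the two
halves. -/
theorem BiconnOn.union {G : ExtGraph s} {U V : Finset (Fin G.n)} {A B : Finset (Fin G.m)}
    (h : G.BiconnOn U A) (h' : G.BiconnOn V B) {u v : Fin G.n} (huU : u ∈ U) (huV : u ∈ V)
    (hvU : v ∈ U) (hvV : v ∈ V) (huv : u ≠ v) : G.BiconnOn (U ∪ V) (A ∪ B) := by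
  have key : ∀ z : Fin G.n, ∀ c : Fin G.n → Prop,
      (∀ a ∈ A ∪ B, ∀ x ∈ U ∪ V, ∀ y ∈ U ∪ V, x ≠ z → y ≠ z → G.inc a = s(x, y) → c x = c y) →
      ∀ u ∈ U ∪ V, ∀ v ∈ U ∪ V, u ≠ z → v ≠ z → c u = c v := by
    intro z c hc
    obtain ⟨t, htU, htV, htz⟩ : ∃ t, t ∈ U ∧ t ∈ V ∧ t ≠ z := by
      by_cases hz : u = z
      · exact ⟨v, hvU, hvV, fun h => huv (hz.trans h.symm)⟩
      · exact ⟨u, huU, huV, hz⟩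
    have h1 : ∀ w ∈ U ∪ V, w ≠ z → c w = c t := by
      intro w hw hwz
      rcases mem_union.1 hw with hw | hw
      · exact h.color_erase z c (fun a ha x hx y hy => hc a (mem_union_left _ ha) x
          (mem_union_left _ hx) y (mem_union_left _ hy)) w hw t htU hwz htz
      · exact h'.color_erase z c (fun a ha x hx y hy => hc a (mem_union_right _ ha) x
          (mem_union_right _ hx) y (mem_union_right _ hy)) w hw t htV hwz htz
    intro x hx y hy hxz hyz
    rw [h1 x hx hxz, h1 y hy hyz]
  refine ⟨?_, h.2.1.trans (card_le_card subset_union_left), connOn_of_color fun c hc => ?_,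
    fun z _ => connOn_of_color fun c hc => ?_⟩
  · intro a ha w hw
    rcases mem_union.1 ha with ha | ha
    · exact mem_union_left _ (h.1 a ha w hw)
    · exact mem_union_right _ (h'.1 a ha w hw)
  · have h1 : ∀ w ∈ U ∪ V, c w = c u := by
      intro w hw
      rcases mem_union.1 hw with hw | hw
      · exact h.2.2.1.color c (fun a ha x hx y hy => hc a (mem_union_left _ ha) x
          (mem_union_left _ hx) y (mem_union_left _ hy)) w hw u huU
      · exact h'.2.2.1.color c (fun a ha x hx y hy => hc a (mem_union_right _ ha) x
          (mem_union_right _ hx) y (mem_union_right _ hy)) w hw u huV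
    intro x hx y hy
    rw [h1 x hx, h1 y hy]
  · intro x hx y hy
    rw [mem_erase] at hx hy
    refine key z c ?_ x hx.2 y hy.2 hx.1 hy.1
    intro a ha x hx y hy hxz hyz
    exact hc a ha x (mem_erase.2 ⟨hxz, hx⟩) y (mem_erase.2 ⟨hyz, hy⟩)

theorem IsBlock.eq_of_two_mem {G : ExtGraph s} {U V : Finset (Fin G.n)} {A B : Finset (Fin G.m)}
    (h : G.IsBlock U A) (h' : G.IsBlock V B) {u v : Fin G.n} (huU : u ∈ U) (huV : u ∈ V)
    (hvU : v ∈ U) (hvV : v ∈ V) (huv : u ≠ v) : U = V ∧ A = B := by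
  have hu := h.1.union h'.1 huU huV hvU hvV huv
  have h1 := h.2 _ _ hu subset_union_left subset_union_left
  have h2 := h'.2 _ _ hu subset_union_right subset_union_right
  exact ⟨h1.1.symm.trans h2.1, h1.2.symm.trans h2.2⟩

/-- Since there are no loops, a shared edge supplies two shared vertices. With `exists_isBlock_mem`,
the blocks partition the edges. -/
theorem IsBlock.eq_of_mem {G : ExtGraph s} {U V : Finset (Fin G.n)} {A B : Finset (Fin G.m)}
    (h : G.IsBlock U A) (h' : G.IsBlock V B) {a : Fin G.m} (ha : a ∈ A) (hb : a ∈ B) :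
    U = V ∧ A = B := by
  obtain ⟨x, y, hi⟩ := G.exists_inc a
  exact h.eq_of_two_mem h' (h.1.left_mem ha hi) (h'.1.left_mem hb hi) (h.1.right_mem ha hi)
    (h'.1.right_mem hb hi) (ne_of_inc hi)

theorem BiconnOn.exists_isBlock {G : ExtGraph s} {U : Finset (Fin G.n)} {A : Finset (Fin G.m)}
    (h : G.BiconnOn U A) : ∃ V B, G.IsBlock V B ∧ U ⊆ V ∧ A ⊆ B := by
  obtain ⟨⟨V, B⟩, hle, hmax⟩ := Finite.exists_le_maximal
    (p := fun P : Finset (Fin G.n) × Finset (Fin G.m) => G.BiconnOn P.1 P.2) (a := (U, A)) h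
  refine ⟨V, B, ⟨hmax.1, fun U' A' h' hU hA => ?_⟩, hle.1, hle.2⟩
  have := hmax.2 (y := (U', A')) h' ⟨hU, hA⟩
  exact ⟨this.1.antisymm hU, this.2.antisymm hA⟩

theorem biconnOn_edge {G : ExtGraph s} {a : Fin G.m} {x y : Fin G.n} (h : G.inc a = s(x, y)) :
    G.BiconnOn {x, y} {a} := by
  have hxy := ne_of_inc h
  refine ⟨?_, (card_pair hxy).ge, connOn_of_color fun c hc => ?_,
    fun z hz => connOn_of_color fun c _ => ?_⟩
  · intro b hb v hv
    rw [mem_singleton.1 hb, h] at hv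
    simpa using hv
  · have := hc a (by simp) x (by simp) y (by simp) h
    intro u hu v hv
    simp only [mem_insert, mem_singleton] at hu hv
    rcases hu with rfl | rfl <;> rcases hv with rfl | rfl <;> simp [this]
  · intro u hu v hv
    simp only [mem_erase, mem_insert, mem_singleton] at hu hv hz
    have : u = v := by grind
    rw [this]

theorem exists_isBlock_mem (G : ExtGraph s) (a : Fin G.m) : ∃ U A, G.IsBlock U A ∧ a ∈ A := by
  obtain ⟨x, y, h⟩ := G.exists_inc a
  obtain ⟨V, B, h1, -, h3⟩ := (biconnOn_edge h).exists_isBlock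
  exact ⟨V, B, h1, h3 (by simp)⟩

/-- A connected set of vertices, by edges outside a block, contains at most one vertex of it. -/
theorem IsBlock.eq_of_connOn_compl {G : ExtGraph s} {U : Finset (Fin G.n)} {A : Finset (Fin G.m)}
    (h : G.IsBlock U A) {u v : Fin G.n} (hu : u ∈ U) (hv : v ∈ U) (W : Finset (Fin G.n)) :
    G.ConnOn W Aᶜ → u ∈ W → v ∈ W → u = v := by
  classical
  induction W using Finset.strongInduction with
  | H W ih =>
  intro hW huW hvW
  by_contra huv
  -- Enlarge the block by `W` and all edges inside `W`. If `W` cannot be made smaller, the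
  -- enlargement is biconnected, against maximality.
  set A' : Finset (Fin G.m) := A ∪ univ.filter (fun a => a ∉ A ∧ ∀ w ∈ G.inc a, w ∈ W) with hA'
  have hWA' : ∀ a ∈ Aᶜ, ∀ x ∈ W, ∀ y ∈ W, G.inc a = s(x, y) → a ∈ A' := by
    intro a ha x hx y hy hi
    rw [hA', mem_union, mem_filter]
    refine Or.inr ⟨mem_univ _, by simpa using ha, fun w hw => ?_⟩
    rw [hi, Sym2.mem_iff] at hw
    rcases hw with rfl | rfl <;> assumption
  have hb : G.BiconnOn (U ∪ W) A' := by
    refine ⟨?_, h.1.2.1.trans (card_le_card subset_union_left), connOn_of_color fun c hc => ?_,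
      fun z _ => connOn_of_color fun c hc => ?_⟩
    · intro a ha w hw
      rcases mem_union.1 ha with ha | ha
      · exact mem_union_left _ (h.1.1 a ha w hw)
      · exact mem_union_right _ ((mem_filter.1 ha).2.2 w hw)
    · have h1 : ∀ w ∈ U ∪ W, c w = c u := by
        intro w hw
        rcases mem_union.1 hw with hw | hw
        · exact h.1.2.2.1.color c (fun a ha x hx y hy => hc a (mem_union_left _ ha) x
            (mem_union_left _ hx) y (mem_union_left _ hy)) w hw u hu
        · exact hW.color c (fun a ha x hx y hy hi => hc a (hWA' a ha x hx y hy hi) x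
            (mem_union_right _ hx) y (mem_union_right _ hy) hi) w hw u huW
      intro x hx y hy
      rw [h1 x hx, h1 y hy]
    · obtain ⟨t, ht, htz⟩ := h.1.exists_ne z
      have hUc : ∀ w ∈ U, w ≠ z → c w = c t := fun w hw hwz =>
        h.1.color_erase z c (fun a ha x hx y hy hxz hyz => hc a (mem_union_left _ ha) x
          (mem_erase.2 ⟨hxz, mem_union_left _ hx⟩) y
          (mem_erase.2 ⟨hyz, mem_union_left _ hy⟩)) w hw t ht hwz htz
      have hWc : ∀ w ∈ W, w ≠ z → c w = c t := by
        by_contra! hn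
        obtain ⟨w, hw, hwz, hwc⟩ := hn
        -- A part of `W` cut off from the block by erasing `z` can be discarded: what remains still
        -- contains `u` and `v` and is still connected, so the induction hypothesis applies.
        set W' := W.filter (fun x => x = z ∨ c x = c t) with hW'
        have hmem : ∀ x, x ∈ W → x ∈ U → x ∈ W' := fun x hx hxU => by
          rw [hW', mem_filter]
          exact ⟨hx, or_iff_not_imp_left.2 (hUc x hxU)⟩
        have hss : W' ⊂ W := by
          refine (filter_ssubset).2 ⟨w, hw, ?_⟩
          simp only [not_or]
          exact ⟨hwz, hwc⟩
        refine huv (ih W' hss (connOn_of_color fun d hd => ?_) (hmem u huW hu) (hmem v hvW hv))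
        have hsep : ∀ a ∈ Aᶜ, ∀ x ∈ W, ∀ y ∈ W, G.inc a = s(x, y) → x ∉ W' → y ∈ W' → y = z := by
          intro a ha x hx y hy hi hx' hy'
          by_contra hyz
          rw [hW', mem_filter, not_and, not_or] at hx'
          obtain ⟨hxz, hxc⟩ := hx' hx
          have hyc := (mem_filter.1 hy').2.resolve_left hyz
          exact hxc ((hc a (hWA' a ha x hx y hy hi) x (mem_erase.2 ⟨hxz, mem_union_right _ hx⟩) y
            (mem_erase.2 ⟨hyz, mem_union_right _ hy⟩) hi).trans hyc)
        -- The discarded part meets `W'` only through `z`, so it may be given the colour of `z`.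
        have hcol := hW.color (fun x => if x ∈ W' then d x else d z) (by
          intro a ha x hx y hy hi
          split_ifs with h1 h2 h2
          · exact hd a ha x h1 y h2 hi
          · rw [hsep a ha y hy x hx (hi.trans Sym2.eq_swap) h2 h1]
          · rw [hsep a ha x hx y hy hi h1 h2]
          · rfl)
        intro x hx y hy
        have := hcol x (mem_filter.1 hx).1 y (mem_filter.1 hy).1
        simpa only [hx, hy, if_true] using this
      have hall : ∀ w ∈ (U ∪ W).erase z, c w = c t := by
        intro w hw
        rw [mem_erase, mem_union] at hw
        rcases hw.2 with h2 | h2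
        · exact hUc w h2 hw.1
        · exact hWc w h2 hw.1
      intro x hx y hy
      rw [hall x hx, hall y hy]
  -- By maximality no edge outside `A` lies inside `W`; a connected `W` then cannot contain two
  -- vertices.
  have heq := (h.2 _ _ hb subset_union_left subset_union_left).2
  have := hW.color (fun x => x = u) (by
    intro a ha x hx y hy hi
    have := hWA' a ha x hx y hy hi
    rw [heq] at this
    exact absurd this (by simpa using ha)) u huW v hvW
  simp only [eq_iff_iff, true_iff] at this
  exact huv this.symm

/-- Send a vertex to the vertex of the block from which it is reached without using edges of the
block. Connectivity gives existence, `IsBlock.eq_of_connOn_compl` uniqueness. -/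
theorem IsBlock.exists_retraction {G : ExtGraph s} (hG : G.Connected) {U : Finset (Fin G.n)}
    {A : Finset (Fin G.m)} (h : G.IsBlock U A) :
    ∃ ρ : Fin G.n → Fin G.n, (∀ v, ρ v ∈ U) ∧ (∀ v ∈ U, ρ v = v) ∧
      ∀ a ∉ A, ∀ x y, G.inc a = s(x, y) → ρ x = ρ y := by
  classical
  set R : Fin G.n → Fin G.n → Prop :=
    Relation.ReflTransGen (fun x y => ∃ a ∉ A, G.inc a = s(x, y)) with hR
  have hsymm : ∀ x y, R x y → R y x := fun x y hxy => by
    induction hxy with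
    | refl => exact .refl
    | tail _ h2 ih =>
      obtain ⟨a, ha, hi⟩ := h2
      exact .head ⟨a, ha, hi.trans Sym2.eq_swap⟩ ih
  have hex : ∀ v, ∃ u ∈ U, R u v := by
    obtain ⟨u, hu⟩ := card_pos.1 (Nat.lt_of_lt_of_le Nat.two_pos h.1.2.1)
    intro v
    have := hG.color (fun v => ∃ u ∈ U, R u v) (by
      intro a _ x _ y _ hi
      by_cases ha : a ∈ A
      · exact propext ⟨fun _ => ⟨y, h.1.right_mem ha hi, .refl⟩,
          fun _ => ⟨x, h.1.left_mem ha hi, .refl⟩⟩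
      · refine propext ⟨?_, ?_⟩
        · rintro ⟨u, hu, huv⟩; exact ⟨u, hu, huv.tail ⟨a, ha, hi⟩⟩
        · rintro ⟨u, hu, huv⟩; exact ⟨u, hu, huv.tail ⟨a, ha, hi.trans Sym2.eq_swap⟩⟩)
      u (mem_univ _) v (mem_univ _)
    exact this.mp ⟨u, hu, .refl⟩
  have huniq : ∀ u ∈ U, ∀ v ∈ U, R u v → u = v := by
    intro u hu v hv huv
    refine h.eq_of_connOn_compl hu hv (univ.filter (R u)) (connOn_of_color fun c hc => ?_)
      (by simp [hR, Relation.ReflTransGen.refl]) (by simpa using huv)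
    have : ∀ w, R u w → c w = c u := by
      intro w hw
      induction hw with
      | refl => rfl
      | @tail b d h1 h2 ih =>
        obtain ⟨a, ha, hi⟩ := h2
        rw [← ih]
        exact (hc a (by simpa using ha) b (by simpa using h1) d
          (by simpa using h1.tail ⟨a, ha, hi⟩) hi).symm
    intro x hx y hy
    rw [this x (by simpa using hx), this y (by simpa using hy)]
  choose ρ h1 h2 using hex
  refine ⟨ρ, h1, fun v hv => huniq _ (h1 v) _ hv (h2 v), fun a ha x y hi => ?_⟩
  exact huniq _ (h1 x) _ (h1 y) (((h2 x).tail ⟨a, ha, hi⟩).trans (hsymm _ _ (h2 y)))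

/-- If a larger biconnected subgraph contained a vertex `w` outside `U`, erasing `ρ w` would
separate `w` from the rest of `U`: the colouring `ρ x = ρ w` shows this. -/
theorem BiconnOn.isBlock_of_retraction {G : ExtGraph s} {U : Finset (Fin G.n)}
    {A : Finset (Fin G.m)} (h : G.BiconnOn U A) (ρ : Fin G.n → Fin G.n) (h1 : ∀ v, ρ v ∈ U)
    (h2 : ∀ v ∈ U, ρ v = v) (h3 : ∀ a ∉ A, ∀ x y, G.inc a = s(x, y) → ρ x = ρ y) :
    G.IsBlock U A := by
  refine ⟨h, fun U' A' h' hU hA => ?_⟩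
  have hUU : U' ⊆ U := by
    intro w hw
    by_contra hwU
    obtain ⟨t, ht, htp⟩ := h.exists_ne (ρ w)
    have := h'.color_erase (ρ w) (fun x => ρ x = ρ w) (by
      intro a ha x hx y hy hxp hyp hi
      by_cases haA : a ∈ A
      · rw [h2 x (h.left_mem haA hi), h2 y (h.right_mem haA hi)]
        simp [hxp, hyp]
      · simp only [h3 a haA x y hi]) t (hU ht) w hw htp (fun h => hwU (h ▸ h1 w))
    simp only [h2 t ht, htp, eq_iff_iff, false_iff] at this
    exact this trivial
  refine ⟨hUU.antisymm hU, Subset.antisymm (fun a ha => ?_) hA⟩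
  by_contra haA
  obtain ⟨x, y, hi⟩ := G.exists_inc a
  have := h3 a haA x y hi
  rw [h2 x (hUU (h'.left_mem ha hi)), h2 y (hUU (h'.right_mem ha hi))] at this
  exact ne_of_inc hi this

/-! ### Transport of subgraphs along injective maps -/

section Transport

variable {t : ℕ} {G : ExtGraph s} {H : ExtGraph t} {h : Fin G.n → Fin H.n} {e : Fin G.m → Fin H.m}
  {U : Finset (Fin G.n)} {A : Finset (Fin G.m)}

theorem connOn_image (hh : Function.Injective h)
    (hinc : ∀ a ∈ A, H.inc (e a) = (G.inc a).map h) :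
    H.ConnOn (U.image h) (A.image e) ↔ G.ConnOn U A := by
  constructor
  · intro hc
    refine connOn_of_color fun c hcol u hu v hv => ?_
    have := hc.color (fun w => ∃ x ∈ U, h x = w ∧ c x) (by
      intro a ha x hx y hy hi
      obtain ⟨a, ha', rfl⟩ := mem_image.1 ha
      obtain ⟨x, hx', rfl⟩ := mem_image.1 hx
      obtain ⟨y, hy', rfl⟩ := mem_image.1 hy
      rw [hinc a ha', ← Sym2.map_mk] at hi
      have hxy := hcol a ha' x hx' y hy' (Sym2.map.injective hh hi)
      refine propext ⟨?_, ?_⟩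
      · rintro ⟨z, hz, hzx, hcz⟩
        rw [hh hzx, hxy] at hcz
        exact ⟨y, hy', rfl, hcz⟩
      · rintro ⟨z, hz, hzx, hcz⟩
        rw [hh hzx, ← hxy] at hcz
        exact ⟨x, hx', rfl, hcz⟩) (h u) (mem_image_of_mem _ hu) (h v) (mem_image_of_mem _ hv)
    have h2 : ∀ w ∈ U, (∃ x ∈ U, h x = h w ∧ c x) = c w := by
      intro w hw
      refine propext ⟨?_, fun hc => ⟨w, hw, rfl, hc⟩⟩
      rintro ⟨x, -, hx, hc⟩
      rwa [← hh hx]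
    rwa [h2 u hu, h2 v hv] at this
  · intro hc
    refine connOn_of_color fun c hcol u hu v hv => ?_
    obtain ⟨u, hu', rfl⟩ := mem_image.1 hu
    obtain ⟨v, hv', rfl⟩ := mem_image.1 hv
    refine hc.color (fun x => c (h x)) ?_ u hu' v hv'
    intro a ha x hx y hy hi
    exact hcol _ (mem_image_of_mem _ ha) _ (mem_image_of_mem _ hx) _ (mem_image_of_mem _ hy)
      (by rw [hinc a ha, hi, Sym2.map_mk])

theorem ends_image (hh : Function.Injective h)
    (hinc : ∀ a ∈ A, H.inc (e a) = (G.inc a).map h) :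
    (∀ a ∈ A.image e, ∀ v ∈ H.inc a, v ∈ U.image h) ↔ ∀ a ∈ A, ∀ v ∈ G.inc a, v ∈ U := by
  constructor
  · intro h1 a ha v hv
    have := h1 (e a) (mem_image_of_mem _ ha) (h v) (by
      rw [hinc a ha]; exact Sym2.mem_map.2 ⟨v, hv, rfl⟩)
    obtain ⟨w, hw, hwv⟩ := mem_image.1 this
    rwa [← hh hwv]
  · intro h1 a ha v hv
    obtain ⟨a, ha', rfl⟩ := mem_image.1 ha
    rw [hinc a ha', Sym2.mem_map] at hv
    obtain ⟨w, hw, rfl⟩ := hv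
    exact mem_image_of_mem _ (h1 a ha' w hw)

theorem biconnOn_image (hh : Function.Injective h)
    (hinc : ∀ a ∈ A, H.inc (e a) = (G.inc a).map h) :
    H.BiconnOn (U.image h) (A.image e) ↔ G.BiconnOn U A := by
  unfold BiconnOn
  rw [ends_image hh hinc, card_image_of_injective _ hh, connOn_image hh hinc]
  simp only [forall_mem_image, ← image_erase hh, connOn_image hh hinc]

theorem isCycleOn_image (hh : Function.Injective h) (he : Function.Injective e)
    (hinc : ∀ a ∈ A, H.inc (e a) = (G.inc a).map h) :
    H.IsCycleOn (U.image h) (A.image e) ↔ G.IsCycleOn U A := by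
  unfold IsCycleOn
  rw [ends_image hh hinc, image_nonempty, connOn_image hh hinc]
  simp only [forall_mem_image]
  have : ∀ v, ((A.image e).filter (fun a => h v ∈ H.inc a)).card
      = (A.filter (fun a => v ∈ G.inc a)).card := by
    intro v
    rw [← card_image_of_injective (A.filter fun a => v ∈ G.inc a) he]
    congr 1
    ext a
    simp only [mem_filter, mem_image]
    constructor
    · rintro ⟨⟨b, hb, rfl⟩, h1⟩
      rw [hinc b hb, Sym2.mem_map] at h1
      obtain ⟨w, hw, hwv⟩ := h1
      exact ⟨b, ⟨hb, hh hwv ▸ hw⟩, rfl⟩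
    · rintro ⟨b, ⟨hb, hv⟩, rfl⟩
      exact ⟨⟨b, hb, rfl⟩, by rw [hinc b hb]; exact Sym2.mem_map.2 ⟨v, hv, rfl⟩⟩
  simp only [this]

end Transport

/-! ### The cyclomatic number of a connected graph -/

theorem sum_ends {G : ExtGraph s} {a : Fin G.m} {x y : Fin G.n} (hi : G.inc a = s(x, y))
    {R : Type*} [AddCommMonoid R] (c : Fin G.n → R) :
    ∑ v, (if v ∈ G.inc a then c v else 0) = c x + c y := by
  rw [← sum_filter]
  have : univ.filter (fun v => v ∈ G.inc a) = {x, y} := by ext v; simp [hi]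
  rw [this, sum_pair (ne_of_inc hi)]

/-- The kernel of the transpose consists of the functions with `c x + c y = 0` on every edge. Over
`𝔽₂` this means `c x = c y`, so connectivity leaves only the constants. -/
theorem rank_incidence {G : ExtGraph s} {ι : Type*} [Fintype ι] [DecidableEq ι] (f : ι → Fin G.m)
    (h : G.ConnOn univ (univ.image f)) :
    (Matrix.of fun (v : Fin G.n) (a : ι) =>
      if v ∈ G.inc (f a) then (1 : ZMod 2) else 0).rank + 1 = G.n := by
  set M := Matrix.of fun (v : Fin G.n) (a : ι) => if v ∈ G.inc (f a) then (1 : ZMod 2) else 0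
  have hker : LinearMap.ker M.transpose.mulVecLin = Submodule.span (ZMod 2) {fun _ => 1} := by
    ext c
    rw [LinearMap.mem_ker, Matrix.mulVecLin_apply, Submodule.mem_span_singleton]
    have hM : ∀ (c : Fin G.n → ZMod 2) a x y, G.inc (f a) = s(x, y) →
        M.transpose.mulVec c a = c x + c y := by
      intro c a x y hi
      rw [← sum_ends hi]
      simp [M, Matrix.mulVec, dotProduct]
    constructor
    · intro hc
      refine ⟨c ⟨0, G.pos⟩, funext fun v => ?_⟩
      have := h.color c (by
        intro a ha x _ y _ hi
        obtain ⟨a, -, rfl⟩ := mem_image.1 ha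
        have := hM c a x y hi
        rw [hc] at this
        rw [eq_comm, Pi.zero_apply] at this
        exact CharTwo.add_eq_zero.1 this) ⟨0, G.pos⟩ (mem_univ _) v (mem_univ _)
      simpa using this
    · rintro ⟨r, rfl⟩
      funext a
      obtain ⟨x, y, hi⟩ := G.exists_inc (f a)
      rw [hM _ a x y hi]
      exact CharTwo.add_self_eq_zero _
  have h1 := LinearMap.finrank_range_add_finrank_ker M.transpose.mulVecLin
  have hne : (fun _ : Fin G.n => (1 : ZMod 2)) ≠ 0 := fun h => by
    have := congrFun h ⟨0, G.pos⟩
    simp at this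
  rw [hker, finrank_span_singleton hne] at h1
  rw [← Matrix.rank_transpose, Matrix.rank, h1]
  simp

theorem ConnOn.card_le {G : ExtGraph s} {A : Finset (Fin G.m)} (h : G.ConnOn univ A) :
    G.n ≤ A.card + 1 := by
  have := rank_incidence (G := G) (fun a : A => a.1) (by
    have : univ.image (fun a : A => a.1) = A := by ext; simp
    rwa [this])
  rw [← this]
  simpa using (Matrix.rank_le_card_width
    (Matrix.of fun (v : Fin G.n) (a : A) => if v ∈ G.inc a.1 then (1 : ZMod 2) else 0))

/-- Rank-nullity for the incidence matrix. This is why `k + n - 1` in the recursion counts edges. -/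
theorem Connected.cyclomaticNumber_add {G : ExtGraph s} (h : G.Connected) :
    G.cyclomaticNumber + G.n = G.m + 1 := by
  have h1 := rank_incidence (G := G) id (by simpa [Connected] using h)
  have h2 := LinearMap.finrank_range_add_finrank_ker (Matrix.mulVecLin
    (Matrix.of fun (v : Fin G.n) (a : Fin G.m) => if v ∈ G.inc a then (1 : ZMod 2) else 0))
  unfold cyclomaticNumber cycleSpace
  simp only [id] at h1
  rw [Matrix.rank] at h1
  simp only [Module.finrank_pi, Fintype.card_fin] at h2
  omega

/-! ### Biconnected and 2-edge-connected graphs -/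

theorem Biconnected.connected {G : ExtGraph s} (h : G.Biconnected) : G.Connected := h.2.2.1

theorem Biconnected.two_le {G : ExtGraph s} (h : G.Biconnected) : 2 ≤ G.n := by
  simpa using h.2.1

/-- Let `e` join `x` and `y`. A third vertex is joined to `y` without `x` and to `x` without `y`, in
both cases avoiding `e`. With only two vertices, the bound on the cyclomatic number supplies a
parallel edge. -/
theorem Biconnected.twoEdgeConnected {G : ExtGraph s} (h : G.Biconnected)
    (hk : 1 ≤ G.cyclomaticNumber) : G.TwoEdgeConnected := by
  refine ⟨h.connected, fun e => connOn_of_color fun c hc => ?_⟩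
  obtain ⟨x, y, hi⟩ := G.exists_inc e
  have hxy := ne_of_inc hi
  have hcard := h.connected.cyclomaticNumber_add
  have key : c x = c y := by
    by_contra hne
    have hw : ∀ w, w = x ∨ w = y := by
      intro w
      by_contra! hw
      have h1 := h.color_erase x c (by
        intro a _ u _ v _ hu hv ha
        refine hc a (mem_erase.2 ⟨?_, mem_univ _⟩) u (mem_univ _) v (mem_univ _) ha
        rintro rfl
        rw [hi, Sym2.eq_iff] at ha
        grind) w (mem_univ _) y (mem_univ _) hw.1 hxy.symm
      have h2 := h.color_erase y c (by
        intro a _ u _ v _ hu hv ha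
        refine hc a (mem_erase.2 ⟨?_, mem_univ _⟩) u (mem_univ _) v (mem_univ _) ha
        rintro rfl
        rw [hi, Sym2.eq_iff] at ha
        grind) w (mem_univ _) x (mem_univ _) hw.2 hxy
      exact hne (h2.symm.trans h1)
    have hn : G.n = 2 := by
      have : (univ : Finset (Fin G.n)) = {x, y} := by ext w; simpa using hw w
      have := congrArg card this
      rwa [card_pair hxy, card_univ, Fintype.card_fin] at this
    obtain ⟨a, ha⟩ : ∃ a, a ≠ e := by
      have : Nontrivial (Fin G.m) := Fin.nontrivial_iff_two_le.2 (by omega)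
      exact exists_ne e
    obtain ⟨u, v, hu⟩ := G.exists_inc a
    have huv := ne_of_inc hu
    have := hc a (mem_erase.2 ⟨ha, mem_univ _⟩) u (mem_univ _) v (mem_univ _) hu
    rcases hw u with rfl | rfl <;> rcases hw v with rfl | rfl
    · exact huv rfl
    · exact hne this
    · exact hne this.symm
    · exact huv rfl
  intro u hu v hv
  refine h.connected.color c ?_ u hu v hv
  intro a _ z _ w _ ha
  by_cases hae : a = e
  · subst hae
    rw [hi, Sym2.eq_iff] at ha
    rcases ha with ⟨rfl, rfl⟩ | ⟨rfl, rfl⟩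
    · exact key
    · exact key.symm
  · exact hc a (mem_erase.2 ⟨hae, mem_univ _⟩) z (mem_univ _) w (mem_univ _) ha

/-- The graph is still connected with one edge fewer, so it has at least `n` edges. -/
theorem TwoEdgeConnected.one_le_cyclomaticNumber {G : ExtGraph s} (h : G.TwoEdgeConnected)
    (hn : 2 ≤ G.n) : 1 ≤ G.cyclomaticNumber := by
  have h1 := h.1.cyclomaticNumber_add
  have h2 : 0 < G.m := by
    have := h.1.card_le
    rw [card_univ, Fintype.card_fin] at this
    omega
  have := (h.2 ⟨0, h2⟩).card_le
  rw [card_erase_of_mem (mem_univ _), card_univ, Fintype.card_fin] at this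
  omega

theorem m_eq_zero_of_n_eq_one {G : ExtGraph s} (hn : G.n = 1) : G.m = 0 := by
  by_contra hm
  obtain ⟨x, y, hi⟩ := G.exists_inc ⟨0, Nat.pos_of_ne_zero hm⟩
  exact ne_of_inc hi (Fin.ext (by omega))

theorem connected_of_n_eq_one {G : ExtGraph s} (hn : G.n = 1) : G.Connected := by
  intro u _ v _
  have : u = v := Fin.ext (by omega)
  rw [this]

/-! ### Isomorphisms -/

namespace Iso

variable {G H K : ExtGraph s}

theorem ext {φ ψ : Iso G H} (h1 : ∀ v, φ.onV v = ψ.onV v) (h2 : ∀ a, φ.onE a = ψ.onE a) :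
    φ = ψ := by
  obtain ⟨a, b, _, _⟩ := φ
  obtain ⟨c, d, _, _⟩ := ψ
  have h3 : a = c := Equiv.ext h1
  have h4 : b = d := Equiv.ext h2
  subst h3 h4
  rfl

/-- The identity. -/
def refl (G : ExtGraph s) : Iso G G where
  onV := .refl _
  onE := .refl _
  inc_map := fun a => by simp
  ext_map := fun _ => rfl

/-- The inverse of an isomorphism. -/
def symm (φ : Iso G H) : Iso H G where
  onV := φ.onV.symm
  onE := φ.onE.symm
  inc_map := fun a => by
    have := φ.inc_map (φ.onE.symm a)
    rw [Equiv.apply_symm_apply] at this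
    rw [this, Sym2.map_map]
    simp
  ext_map := fun x => by rw [φ.ext_map, Equiv.symm_apply_apply]

/-- The composition of isomorphisms. -/
def trans (φ : Iso G H) (ψ : Iso H K) : Iso G K where
  onV := φ.onV.trans ψ.onV
  onE := φ.onE.trans ψ.onE
  inc_map := fun a => by
    rw [Equiv.trans_apply, ψ.inc_map, φ.inc_map, Sym2.map_map]
    rfl
  ext_map := fun x => by rw [ψ.ext_map, φ.ext_map]; rfl

instance : Finite (Iso G H) :=
  Finite.of_injective (fun φ : Iso G H => (φ.onV, φ.onE)) fun φ ψ h => by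
    simp only [Prod.mk.injEq] at h
    exact Iso.ext (fun v => by rw [h.1]) (fun a => by rw [h.2])

theorem n_eq (φ : Iso G H) : G.n = H.n := by simpa using Fintype.card_congr φ.onV

theorem m_eq (φ : Iso G H) : G.m = H.m := by simpa using Fintype.card_congr φ.onE

theorem biconnOn (φ : Iso G H) {U : Finset (Fin G.n)} {A : Finset (Fin G.m)} :
    H.BiconnOn (U.image φ.onV) (A.image φ.onE) ↔ G.BiconnOn U A :=
  biconnOn_image φ.onV.injective fun a _ => φ.inc_map a

theorem connOn (φ : Iso G H) {U : Finset (Fin G.n)} {A : Finset (Fin G.m)} :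
    H.ConnOn (U.image φ.onV) (A.image φ.onE) ↔ G.ConnOn U A :=
  connOn_image φ.onV.injective fun a _ => φ.inc_map a

theorem connected (φ : Iso G H) (h : G.Connected) : H.Connected := by
  have := φ.connOn.2 h
  simpa [Connected, image_univ_equiv] using this

theorem biconnected (φ : Iso G H) (h : G.Biconnected) : H.Biconnected := by
  have := φ.biconnOn.2 h
  simpa [Biconnected, image_univ_equiv] using this

theorem twoEdgeConnected (φ : Iso G H) (h : G.TwoEdgeConnected) : H.TwoEdgeConnected := by
  refine ⟨φ.connected h.1, fun a => ?_⟩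
  have := φ.connOn.2 (h.2 (φ.onE.symm a))
  rw [image_erase φ.onE.injective] at this
  simpa [image_univ_equiv] using this

theorem cyclomaticNumber (φ : Iso G H) (h : G.Connected) :
    G.cyclomaticNumber = H.cyclomaticNumber := by
  have h1 := h.cyclomaticNumber_add
  have h2 := (φ.connected h).cyclomaticNumber_add
  have := φ.n_eq
  have := φ.m_eq
  omega

theorem isBlock (φ : Iso G H) {U : Finset (Fin G.n)} {A : Finset (Fin G.m)} (h : G.IsBlock U A) :
    H.IsBlock (U.image φ.onV) (A.image φ.onE) := by
  refine ⟨φ.biconnOn.2 h.1, fun U' A' h' hU hA => ?_⟩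
  have h1 := h.2 (U'.image φ.onV.symm) (A'.image φ.onE.symm) (φ.symm.biconnOn.2 h') (by
    intro u hu
    exact mem_image.2 ⟨φ.onV u, hU (mem_image_of_mem _ hu), by simp⟩) (by
    intro u hu
    exact mem_image.2 ⟨φ.onE u, hA (mem_image_of_mem _ hu), by simp⟩)
  rw [← h1.1, ← h1.2]
  simp [image_image]

theorem wBiconn (φ : Iso G H) {n k : ℕ} (h : G ∈ WBiconn n k s) : H ∈ WBiconn n k s :=
  ⟨φ.n_eq ▸ h.1, φ.cyclomaticNumber h.2.2.connected ▸ h.2.1, φ.biconnected h.2.2⟩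

theorem wTwoEdge (φ : Iso G H) {n k : ℕ} (h : G ∈ WTwoEdge n k s) : H ∈ WTwoEdge n k s :=
  ⟨φ.n_eq ▸ h.1, φ.cyclomaticNumber h.2.2.1 ▸ h.2.1, φ.twoEdgeConnected h.2.2⟩

theorem card_congr_left (φ : Iso G H) : Nat.card (Iso G K) = Nat.card (Iso H K) :=
  Nat.card_congr ⟨φ.symm.trans, φ.trans,
    fun ψ => Iso.ext (fun v => by simp [trans, symm]) (fun v => by simp [trans, symm]),
    fun ψ => Iso.ext (fun v => by simp [trans, symm]) (fun v => by simp [trans, symm])⟩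

theorem card_congr_right (φ : Iso G H) : Nat.card (Iso K G) = Nat.card (Iso K H) :=
  Nat.card_congr ⟨fun ψ => ψ.trans φ, fun ψ => ψ.trans φ.symm,
    fun ψ => Iso.ext (fun v => by simp [trans, symm]) (fun v => by simp [trans, symm]),
    fun ψ => Iso.ext (fun v => by simp [trans, symm]) (fun v => by simp [trans, symm])⟩

end Iso

/-! ### Weighted linear combinations in terms of numbers of isomorphisms -/

/-- The linear functional that counts isomorphisms from `G`. -/
noncomputable def isoCount (G : ExtGraph s) : (ExtGraph s →₀ ℚ) →ₗ[ℚ] ℚ :=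
  Finsupp.linearCombination ℚ fun H => (Nat.card (Iso G H) : ℚ)

theorem isoCount_apply (G : ExtGraph s) (β : ExtGraph s →₀ ℚ) :
    isoCount G β = ∑ H ∈ β.support, β H * Nat.card (Iso G H) := rfl

@[simp]
theorem isoCount_single (G H : ExtGraph s) (c : ℚ) :
    isoCount G (Finsupp.single H c) = c * Nat.card (Iso G H) := by
  simp [isoCount]

theorem autOrder_pos (G : ExtGraph s) : 0 < G.autOrder :=
  have : Nonempty (Iso G G) := ⟨Iso.refl G⟩
  Nat.card_pos

theorem isoCount_eq (G : ExtGraph s) (β : ExtGraph s →₀ ℚ) :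
    isoCount G β
      = (open Classical in ∑ H ∈ β.support with Nonempty (Iso G H), β H) * G.autOrder := by
  rw [isoCount_apply, sum_filter, sum_mul]
  refine sum_congr rfl fun H _ => ?_
  split_ifs with h
  · obtain ⟨φ⟩ := h
    rw [autOrder, φ.card_congr_right]
  · have : IsEmpty (Iso G H) := not_nonempty_iff.1 h
    simp

/-- By `isoCount_eq`, multiplying the class sum by `|Aut G|` gives the number of isomorphisms
weighted by `β`. In this form the condition is linear in `β`. -/
theorem isAutWeighted_iff {W : Set (ExtGraph s)} {β : ExtGraph s →₀ ℚ} :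
    IsAutWeighted W β ↔ (∀ G ∈ β.support, G ∈ W) ∧ (∀ G, 0 ≤ β G) ∧
      ∀ G ∈ W, isoCount G β = 1 := by
  unfold IsAutWeighted
  refine and_congr Iff.rfl (and_congr Iff.rfl (forall₂_congr fun G _ => ?_))
  rw [isoCount_eq, eq_div_iff]
  exact_mod_cast G.autOrder_pos.ne'

theorem isoCount_eq_zero {G : ExtGraph s} {β : ExtGraph s →₀ ℚ}
    (h : ∀ H ∈ β.support, IsEmpty (Iso G H)) : isoCount G β = 0 := by
  rw [isoCount_apply]
  refine sum_eq_zero fun H hH => ?_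
  have := h H hH
  simp

open Classical in
theorem IsAutWeighted.isoCount_eq_ite {W : Set (ExtGraph s)} {β : ExtGraph s →₀ ℚ}
    (h : IsAutWeighted W β) (hW : ∀ G H : ExtGraph s, Iso G H → G ∈ W → H ∈ W) (G : ExtGraph s) :
    isoCount G β = if G ∈ W then 1 else 0 := by
  split_ifs with hG
  · exact (isAutWeighted_iff.1 h).2.2 G hG
  · exact isoCount_eq_zero fun H hH => ⟨fun φ => hG (hW H G φ.symm (h.1 H hH))⟩

/-! ### Existence of weighted linear combinations -/

/-- Being isomorphic, as an equivalence relation. -/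
def isoSetoid (s : ℕ) : Setoid (ExtGraph s) where
  r G H := Nonempty (Iso G H)
  iseqv := ⟨fun G => ⟨Iso.refl G⟩, fun ⟨φ⟩ => ⟨φ.symm⟩, fun ⟨φ⟩ ⟨ψ⟩ => ⟨φ.trans ψ⟩⟩

/-- Put the whole weight of a class on one chosen representative; finiteness of `W` makes this a
finite combination. -/
theorem exists_isAutWeighted {W : Set (ExtGraph s)} (hfin : W.Finite)
    (hW : ∀ G H : ExtGraph s, Iso G H → G ∈ W → H ∈ W) : ∃ β, IsAutWeighted W β := by
  classical
  let rep : ExtGraph s → ExtGraph s := fun G => (Quotient.mk (isoSetoid s) G).out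
  have hrep : ∀ G, Nonempty (Iso (rep G) G) := fun G =>
    (Quotient.exact (Quotient.out_eq (Quotient.mk (isoSetoid s) G)) :)
  have hrep' : ∀ G H, Iso G H → rep G = rep H := fun G H φ =>
    congrArg Quotient.out (Quotient.sound (s := isoSetoid s) ⟨φ⟩)
  have hrepW : ∀ G, rep G ∈ W ↔ G ∈ W := fun G =>
    ⟨hW _ _ (hrep G).some, hW _ _ (hrep G).some.symm⟩
  let β : ExtGraph s →₀ ℚ := Finsupp.onFinset (hfin.toFinset.filter fun G => rep G = G)
    (fun G => if G ∈ W ∧ rep G = G then 1 / (G.autOrder : ℚ) else 0) (by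
      intro G hG
      simp only [ne_eq, ite_eq_right_iff, not_forall] at hG
      simpa using hG.1)
  have hβ : ∀ G, β G = if G ∈ W ∧ rep G = G then 1 / (G.autOrder : ℚ) else 0 := fun _ => rfl
  have hsupp : ∀ G, G ∈ β.support ↔ G ∈ W ∧ rep G = G := by
    intro G
    rw [Finsupp.mem_support_iff, hβ]
    have := G.autOrder_pos.ne'
    simp [this]
  refine ⟨β, isAutWeighted_iff.2 ⟨fun G hG => ((hsupp G).1 hG).1, fun G => ?_, fun G hG => ?_⟩⟩
  · rw [hβ]
    split_ifs <;> positivity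
  · have hrr : rep (rep G) = rep G := hrep' _ _ (hrep G).some
    rw [isoCount_apply, sum_eq_single (rep G)]
    · rw [hβ, if_pos ⟨(hrepW G).2 hG, hrr⟩, ← (hrep G).some.card_congr_left, autOrder,
        one_div, inv_mul_cancel₀]
      exact_mod_cast (rep G).autOrder_pos.ne'
    · intro H hH hne
      have : IsEmpty (Iso G H) := ⟨fun φ => hne (((hsupp H).1 hH).2.symm.trans (hrep' _ _ φ.symm))⟩
      simp
    · intro h
      exact absurd ((hsupp _).2 ⟨(hrepW G).2 hG, hrr⟩) h

theorem finite_setOf_size (n m : ℕ) : {G : ExtGraph s | G.n = n ∧ G.m = m}.Finite := by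
  let F := {p : (Fin m → Sym2 (Fin n)) × (Fin s → Fin n) // 0 < n ∧ ∀ a, ¬ (p.1 a).IsDiag}
  refine (Set.finite_range fun p : F =>
    (⟨n, m, p.2.1, p.1.1, p.2.2, p.1.2⟩ : ExtGraph s)).subset ?_
  rintro ⟨n, m, h1, inc, h2, ext⟩ ⟨rfl, rfl⟩
  exact ⟨⟨(inc, ext), h1, h2⟩, rfl⟩

theorem finite_wBiconn (n k s : ℕ) : (WBiconn n k s).Finite := by
  refine (finite_setOf_size n (k + n - 1)).subset ?_
  rintro G ⟨h1, h2, h3⟩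
  have := h3.connected.cyclomaticNumber_add
  exact ⟨h1, by omega⟩

theorem exists_isAutWeighted_wBiconn (n k s : ℕ) : ∃ β, IsAutWeighted (WBiconn n k s) β :=
  exists_isAutWeighted (finite_wBiconn n k s) fun _ _ φ h => φ.wBiconn h

/-! ### Contractions

A contraction of `G` onto `G''` with fibre `G'` presents `G''` as the graph obtained from `G` by
shrinking a subgraph isomorphic to `G'` to the vertex `i`. Every component of what remains of `G`
when the edges of `G'` are erased is required to contain just one vertex of `G'`; the
function `ρ` in `retr` yields that vertex. -/

/-- A contraction of `G` onto `G''` with fibre `G'`. -/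
structure Contraction (G : ExtGraph s) (G' : ExtGraph 0) (G'' : ExtGraph s) where
  i : Fin G''.n
  j : Fin G'.n → Fin G.n
  q : Fin G.n → Fin G''.n
  e : Fin G''.m ⊕ Fin G'.m ≃ Fin G.m
  j_inj : Function.Injective j
  q_eq_i : ∀ v, q v = i ↔ ∃ l, j l = v
  q_inj : ∀ v w, q v = q w → q v ≠ i → v = w
  q_surj : Function.Surjective q
  inc_inr : ∀ b, G.inc (e (.inr b)) = (G'.inc b).map j
  inc_inl : ∀ a, G''.inc a = (G.inc (e (.inl a))).map q
  ext_q : ∀ x, G''.ext x = q (G.ext x)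
  retr : ∃ ρ : Fin G.n → Fin G'.n, (∀ l, ρ (j l) = l) ∧
    ∀ a x y, G.inc (e (.inl a)) = s(x, y) → ρ x = ρ y

namespace Contraction

variable {G : ExtGraph s} {G' : ExtGraph 0} {G'' : ExtGraph s}

theorem q_j (d : Contraction G G' G'') (l : Fin G'.n) : d.q (d.j l) = d.i :=
  (d.q_eq_i _).2 ⟨l, rfl⟩

theorem ext' {d d' : Contraction G G' G''} (hj : ∀ l, d.j l = d'.j l) (hq : ∀ v, d.q v = d'.q v)
    (he : ∀ a, d.e a = d'.e a) : d = d' := by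
  have hi : d.i = d'.i := by
    rw [← d.q_j ⟨0, G'.pos⟩, ← d'.q_j ⟨0, G'.pos⟩, hj, hq]
  obtain ⟨i, j, q, e, _, _, _, _, _, _, _, _⟩ := d
  obtain ⟨i', j', q', e', _, _, _, _, _, _, _, _⟩ := d'
  have h1 : j = j' := funext hj
  have h2 : q = q' := funext hq
  have h3 : e = e' := Equiv.ext he
  have h4 : i = i' := hi
  subst h1 h2 h3 h4
  rfl

theorem exists_end (d : Contraction G G' G'') {a : Fin G''.m} {x y : Fin G''.n}
    (h : G''.inc a = s(x, y)) :
    ∃ v w, G.inc (d.e (.inl a)) = s(v, w) ∧ d.q v = x ∧ d.q w = y := by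
  obtain ⟨v, w, hi⟩ := G.exists_inc (d.e (.inl a))
  have := d.inc_inl a
  rw [hi, h, Sym2.map_mk, Sym2.eq_iff] at this
  rcases this with ⟨h1, h2⟩ | ⟨h1, h2⟩
  · exact ⟨v, w, hi, h1.symm, h2.symm⟩
  · exact ⟨w, v, hi.trans Sym2.eq_swap, h1.symm, h2.symm⟩

/-- Colourings of the fibre pull back to `G` along the retraction, colourings of the quotient along
`q`. Conversely, a colouring of `G` is constant on a connected fibre and so descends to the
quotient. -/
theorem connOn_iff (d : Contraction G G' G'') (A : Finset (Fin G.m)) :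
    G.ConnOn univ A ↔ G'.ConnOn univ (univ.filter fun b => d.e (.inr b) ∈ A) ∧
      G''.ConnOn univ (univ.filter fun a => d.e (.inl a) ∈ A) := by
  constructor
  · intro h
    constructor
    · obtain ⟨ρ, h1, h2⟩ := d.retr
      refine connOn_of_color fun c hc u _ v _ => ?_
      have := h.color (fun x => c (ρ x)) (by
        intro a ha x _ y _ hi
        obtain ⟨a | b, rfl⟩ := d.e.surjective a
        · rw [h2 a x y hi]
        · obtain ⟨z, w, hzw⟩ := G'.exists_inc b
          have hcc := hc b (by simpa using ha) z (mem_univ _) w (mem_univ _) hzw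
          rw [d.inc_inr, hzw, Sym2.map_mk, Sym2.eq_iff] at hi
          rcases hi with ⟨rfl, rfl⟩ | ⟨rfl, rfl⟩
          · simpa only [h1] using hcc
          · simpa only [h1] using hcc.symm) (d.j u) (mem_univ _) (d.j v) (mem_univ _)
      simpa only [h1] using this
    · refine connOn_of_color fun c hc u _ v _ => ?_
      obtain ⟨u, rfl⟩ := d.q_surj u
      obtain ⟨v, rfl⟩ := d.q_surj v
      refine h.color (fun x => c (d.q x)) ?_ u (mem_univ _) v (mem_univ _)
      intro a ha x _ y _ hi
      obtain ⟨a | b, rfl⟩ := d.e.surjective a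
      · exact hc a (by simpa using ha) _ (mem_univ _) _ (mem_univ _)
          (by rw [d.inc_inl, hi, Sym2.map_mk])
      · obtain ⟨z, w, hzw⟩ := G'.exists_inc b
        rw [d.inc_inr, hzw, Sym2.map_mk, Sym2.eq_iff] at hi
        rcases hi with ⟨rfl, rfl⟩ | ⟨rfl, rfl⟩ <;> simp only [q_j]
  · rintro ⟨h1, h2⟩
    refine connOn_of_color fun c hc u _ v _ => ?_
    have hj : ∀ l l', c (d.j l) = c (d.j l') := by
      intro l l'
      refine h1.color (fun x => c (d.j x)) ?_ l (mem_univ _) l' (mem_univ _)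
      intro b hb x _ y _ hi
      exact hc _ (by simpa using hb) _ (mem_univ _) _ (mem_univ _) (by rw [d.inc_inr, hi]; rfl)
    have hq : ∀ x y, d.q x = d.q y → c x = c y := by
      intro x y hxy
      by_cases hx : d.q x = d.i
      · obtain ⟨l, rfl⟩ := (d.q_eq_i x).1 hx
        obtain ⟨l', rfl⟩ := (d.q_eq_i y).1 (hxy ▸ hx)
        exact hj l l'
      · rw [d.q_inj x y hxy hx]
    have := h2.color (fun x => c (d.q_surj x).choose) (by
      intro a ha x _ y _ hi
      obtain ⟨v, w, hvw, rfl, rfl⟩ := d.exists_end hi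
      have := hc _ (by simpa using ha) _ (mem_univ _) _ (mem_univ _) hvw
      rw [hq _ v (d.q_surj (d.q v)).choose_spec, hq _ w (d.q_surj (d.q w)).choose_spec, this])
      (d.q u) (mem_univ _) (d.q v) (mem_univ _)
    rwa [hq _ u (d.q_surj (d.q u)).choose_spec, hq _ v (d.q_surj (d.q v)).choose_spec] at this

theorem connected_iff (d : Contraction G G' G'') :
    G.Connected ↔ G'.Connected ∧ G''.Connected := by
  unfold Connected
  rw [d.connOn_iff]
  simp

/-- Every edge of `G` belongs either to the fibre or to the quotient, and erasing it changes only
that side in `connOn_iff`. -/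
theorem twoEdgeConnected_iff (d : Contraction G G' G'') :
    G.TwoEdgeConnected ↔ G'.TwoEdgeConnected ∧ G''.TwoEdgeConnected := by
  unfold TwoEdgeConnected
  rw [d.connected_iff]
  have h1 : ∀ a, G.ConnOn univ (univ.erase (d.e (.inl a))) ↔
      G'.Connected ∧ G''.ConnOn univ (univ.erase a) := by
    intro a
    rw [d.connOn_iff, Connected]
    have h2 : (univ.filter fun b => d.e (.inr b) ∈ univ.erase (d.e (.inl a))) = univ := by
      ext; simp
    have h3 : (univ.filter fun b => d.e (.inl b) ∈ univ.erase (d.e (.inl a))) = univ.erase a := by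
      ext; simp
    rw [h2, h3]
  have h1' : ∀ a, G.ConnOn univ (univ.erase (d.e (.inr a))) ↔
      G'.ConnOn univ (univ.erase a) ∧ G''.Connected := by
    intro a
    rw [d.connOn_iff, Connected]
    have h2 : (univ.filter fun b => d.e (.inl b) ∈ univ.erase (d.e (.inr a))) = univ := by
      ext; simp
    have h3 : (univ.filter fun b => d.e (.inr b) ∈ univ.erase (d.e (.inr a))) = univ.erase a := by
      ext; simp
    rw [h2, h3]
  rw [← d.e.forall_congr_right, Sum.forall]
  simp only [h1, h1']
  exact ⟨fun h => ⟨⟨h.1.1, fun b => (h.2.2 b).1⟩, h.1.2, fun a => (h.2.1 a).2⟩,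
    fun h => ⟨⟨h.1.1, h.2.1⟩, fun a => ⟨h.1.1, h.2.2 a⟩, fun b => ⟨h.1.2 b, h.2.1⟩⟩⟩

/-- The vertices of the fibre. -/
def fibreV (d : Contraction G G' G'') : Finset (Fin G.n) := univ.image d.j

/-- The edges of the fibre. -/
def fibreE (d : Contraction G G' G'') : Finset (Fin G.m) := univ.image fun b => d.e (.inr b)

theorem j_mem_fibreV (d : Contraction G G' G'') (l : Fin G'.n) : d.j l ∈ d.fibreV :=
  mem_image_of_mem _ (mem_univ _)

theorem mem_fibreV (d : Contraction G G' G'') {v : Fin G.n} : v ∈ d.fibreV ↔ d.q v = d.i := by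
  rw [d.q_eq_i]; simp [fibreV]

@[simp]
theorem inr_mem_fibreE (d : Contraction G G' G'') (b : Fin G'.m) : d.e (.inr b) ∈ d.fibreE :=
  mem_image_of_mem _ (mem_univ _)

@[simp]
theorem inl_notMem_fibreE (d : Contraction G G' G'') (a : Fin G''.m) : d.e (.inl a) ∉ d.fibreE := by
  simp [fibreE]

/-- The map `j ∘ ρ` is a retraction onto the fibre that is constant along all other edges, which
forces maximality. -/
theorem isBlock (d : Contraction G G' G'') (h : G'.Biconnected) :
    G.IsBlock d.fibreV d.fibreE := by
  obtain ⟨ρ, h1, h2⟩ := d.retr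
  have hb : G.BiconnOn d.fibreV d.fibreE :=
    (biconnOn_image (h := d.j) (e := fun b => d.e (.inr b)) d.j_inj fun b _ => d.inc_inr b).2 h
  refine hb.isBlock_of_retraction (fun v => d.j (ρ v)) (fun v => d.j_mem_fibreV _) ?_ ?_
  · intro v hv
    obtain ⟨l, -, rfl⟩ := mem_image.1 hv
    simp only [h1]
  · intro a ha x y hi
    obtain ⟨a | b, rfl⟩ := d.e.surjective a
    · simp only [h2 a x y hi]
    · exact absurd (d.inr_mem_fibreE b) ha

theorem m_eq (d : Contraction G G' G'') : G.m = G''.m + G'.m := by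
  simpa using (Fintype.card_congr d.e).symm

theorem card_fibreV (d : Contraction G G' G'') : d.fibreV.card = G'.n := by
  rw [fibreV, card_image_of_injective _ d.j_inj, card_univ, Fintype.card_fin]

theorem card_fibreE (d : Contraction G G' G'') : d.fibreE.card = G'.m := by
  refine (card_image_of_injective _ (d.e.injective.comp Sum.inr_injective)).trans ?_
  rw [card_univ, Fintype.card_fin]

/-- Off the fibre, `q` is a bijection onto the vertices other than `i`. -/
theorem n_add_one (d : Contraction G G' G'') : G.n + 1 = G''.n + G'.n := by
  have h1 : (d.fibreVᶜ).card = (univ.erase d.i).card := by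
    refine card_bij (fun v _ => d.q v) ?_ ?_ ?_
    · intro v hv
      rw [mem_compl, d.mem_fibreV] at hv
      simpa using hv
    · intro v hv w _ h
      rw [mem_compl, d.mem_fibreV] at hv
      exact d.q_inj v w h hv
    · intro x hx
      obtain ⟨v, rfl⟩ := d.q_surj x
      refine ⟨v, ?_, rfl⟩
      rw [mem_compl, d.mem_fibreV]
      simpa using hx
  rw [card_compl, card_erase_of_mem (mem_univ _), d.card_fibreV] at h1
  simp only [Fintype.card_fin, card_univ] at h1
  have h2 : G'.n ≤ G.n := by simpa using Fintype.card_le_of_injective _ d.j_inj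
  have := G''.pos
  omega

theorem cyclomaticNumber_add (d : Contraction G G' G'') (h : G.Connected) :
    G.cyclomaticNumber = G''.cyclomaticNumber + G'.cyclomaticNumber := by
  obtain ⟨h1, h2⟩ := d.connected_iff.1 h
  have := h.cyclomaticNumber_add
  have := h1.cyclomaticNumber_add
  have := h2.cyclomaticNumber_add
  have := d.m_eq
  have := d.n_add_one
  omega

/-- The contraction read off in isomorphic copies of the fibre and of the quotient. -/
def trans (d : Contraction G G' G'') {H' : ExtGraph 0} {H'' : ExtGraph s} (α : Iso G' H')
    (β : Iso G'' H'') : Contraction G H' H'' where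
  i := β.onV d.i
  j := fun l => d.j (α.onV.symm l)
  q := fun v => β.onV (d.q v)
  e := (Equiv.sumCongr β.onE.symm α.onE.symm).trans d.e
  j_inj := d.j_inj.comp α.onV.symm.injective
  q_eq_i := fun v => by
    rw [β.onV.injective.eq_iff, d.q_eq_i]
    exact (α.onV.symm.exists_congr_right (q := fun l => d.j l = v)).symm
  q_inj := fun v w h1 h2 => d.q_inj v w (β.onV.injective h1) fun h => h2 (by rw [h])
  q_surj := β.onV.surjective.comp d.q_surj
  inc_inr := fun b => by
    have := α.symm.inc_map b
    simp only [Equiv.trans_apply, Equiv.sumCongr_apply, Sum.map_inr]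
    rw [d.inc_inr]
    erw [this]
    rw [Sym2.map_map]
    rfl
  inc_inl := fun a => by
    have := β.inc_map (β.onE.symm a)
    rw [Equiv.apply_symm_apply] at this
    rw [this, d.inc_inl, Sym2.map_map]
    rfl
  ext_q := fun x => by rw [β.ext_map, d.ext_q]
  retr := by
    obtain ⟨ρ, h1, h2⟩ := d.retr
    exact ⟨fun v => α.onV (ρ v), fun l => by simp only [h1, Equiv.apply_symm_apply],
      fun a x y hi => by simp only [h2 _ x y hi]⟩

end Contraction

/-! ### Contractions with a given block as fibre -/

theorem exists_equiv_of_range_eq {α β γ : Type*} {f : α → γ} {g : β → γ}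
    (hf : Function.Injective f) (hg : Function.Injective g) (h : Set.range f = Set.range g) :
    ∃ φ : α ≃ β, ∀ a, g (φ a) = f a := by
  refine ⟨(Equiv.ofInjective f hf).trans ((Equiv.setCongr h).trans (Equiv.ofInjective g hg).symm),
    fun a => ?_⟩
  simp [Equiv.apply_ofInjective_symm]

theorem exists_equiv_of_ker_eq {α β γ : Type*} {f : γ → α} {g : γ → β}
    (hf : Function.Surjective f) (hg : Function.Surjective g)
    (h : ∀ x y, f x = f y ↔ g x = g y) : ∃ φ : α ≃ β, ∀ c, φ (f c) = g c := by
  choose f' hf' using hf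
  choose g' hg' using hg
  have h1 : ∀ c, g (f' (f c)) = g c := fun c => (h _ _).1 (hf' _)
  have h2 : ∀ c, f (g' (g c)) = f c := fun c => (h _ _).2 (hg' _)
  refine ⟨⟨fun a => g (f' a), fun b => f (g' b), fun a => ?_, fun b => ?_⟩, h1⟩
  · simp only [h2, hf']
  · simp only [h1, hg']

namespace Contraction

variable {G : ExtGraph s} {G' H' : ExtGraph 0} {G'' H'' : ExtGraph s}

/-- The fibre determines the image of `j`, the kernel of `q` and the splitting of the edges, hence
everything up to relabelling. With `trans_injective`, pairs of isomorphisms parametrize the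
contractions with a given fibre. -/
theorem exists_trans_eq (d : Contraction G G' G'') (d' : Contraction G H' H'')
    (hV : d.fibreV = d'.fibreV) (hE : d.fibreE = d'.fibreE) :
    ∃ p : Iso G' H' × Iso G'' H'', d.trans p.1 p.2 = d' := by
  obtain ⟨αV, hαV⟩ := exists_equiv_of_range_eq d.j_inj d'.j_inj (by
    have := congrArg (fun s : Finset (Fin G.n) => (s : Set (Fin G.n))) hV
    simpa [fibreV] using this)
  have hrE : Set.range (fun b => d.e (.inr b)) = Set.range (fun b => d'.e (.inr b)) := by
    have := congrArg (fun s : Finset (Fin G.m) => (s : Set (Fin G.m))) hE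
    simpa [fibreE] using this
  obtain ⟨αE, hαE⟩ := exists_equiv_of_range_eq (d.e.injective.comp Sum.inr_injective)
    (d'.e.injective.comp Sum.inr_injective) hrE
  have hrE' : Set.range (fun b => d.e (.inl b)) = Set.range (fun b => d'.e (.inl b)) := by
    have hc : ∀ {K' : ExtGraph 0} {K'' : ExtGraph s} (d : Contraction G K' K''),
        Set.range (fun b => d.e (.inl b)) = (↑d.fibreE : Set (Fin G.m))ᶜ := by
      intro K' K'' d
      ext a
      obtain ⟨a | b, rfl⟩ := d.e.surjective a <;> simp
    rw [hc d, hc d', hE]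
  obtain ⟨βE, hβE⟩ := exists_equiv_of_range_eq (d.e.injective.comp Sum.inl_injective)
    (d'.e.injective.comp Sum.inl_injective) hrE'
  have hker : ∀ {K' L' : ExtGraph 0} {K'' L'' : ExtGraph s} (d : Contraction G K' K'')
      (d' : Contraction G L' L''), d.fibreV = d'.fibreV → ∀ x y, d.q x = d.q y → d'.q x = d'.q y := by
    intro K' L' K'' L'' d d' h x y hxy
    by_cases hx : d.q x = d.i
    · have h1 := d.mem_fibreV.2 hx
      have h2 := d.mem_fibreV.2 (hxy ▸ hx)
      rw [h] at h1 h2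
      rw [d'.mem_fibreV.1 h1, d'.mem_fibreV.1 h2]
    · rw [d.q_inj x y hxy hx]
  obtain ⟨βV, hβV⟩ := exists_equiv_of_ker_eq d.q_surj d'.q_surj
    fun x y => ⟨hker d d' hV x y, hker d' d hV.symm x y⟩
  simp only [Function.comp_apply] at hαE hβE
  refine ⟨(⟨αV, αE, fun b => ?_, fun x => x.elim0⟩, ⟨βV, βE, fun a => ?_, fun x => ?_⟩),
    ext' (fun l => ?_) hβV fun a => ?_⟩
  · apply Sym2.map.injective d'.j_inj
    rw [← d'.inc_inr, hαE, d.inc_inr, Sym2.map_map]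
    congr 1
    exact (funext hαV).symm
  · rw [d'.inc_inl, hβE, d.inc_inl, Sym2.map_map]
    congr 1
    exact (funext hβV).symm
  · rw [d'.ext_q, d.ext_q, hβV]
  · simp only [trans]
    rw [← hαV, Equiv.apply_symm_apply]
  · rcases a with a | b
    · simp only [trans, Equiv.trans_apply, Equiv.sumCongr_apply, Sum.map_inl]
      rw [← hβE, Equiv.apply_symm_apply]
    · simp only [trans, Equiv.trans_apply, Equiv.sumCongr_apply, Sum.map_inr]
      rw [← hαE, Equiv.apply_symm_apply]

theorem trans_injective (d : Contraction G G' G'') :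
    Function.Injective fun p : Iso G' H' × Iso G'' H'' => d.trans p.1 p.2 := by
  rintro ⟨α, β⟩ ⟨α', β'⟩ h
  have hj : ∀ l, d.j (α.onV.symm l) = d.j (α'.onV.symm l) := fun l =>
    congrFun (congrArg Contraction.j h) l
  have hq : ∀ v, β.onV (d.q v) = β'.onV (d.q v) := fun v => congrFun (congrArg Contraction.q h) v
  have he : ∀ a, (d.trans α β).e a = (d.trans α' β').e a := fun a => by
    have h : d.trans α β = d.trans α' β' := h
    rw [h]
  simp only [trans, Equiv.trans_apply, Equiv.sumCongr_apply, EmbeddingLike.apply_eq_iff_eq,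
    Sum.forall, Sum.map_inl, Sum.map_inr, Sum.inl.injEq, Sum.inr.injEq] at he
  have h1 : α.onV.symm = α'.onV.symm := Equiv.ext fun l => d.j_inj (hj l)
  have h2 : α.onE.symm = α'.onE.symm := Equiv.ext he.2
  have h3 : β.onE.symm = β'.onE.symm := Equiv.ext he.1
  rw [Equiv.symm_bijective.injective.eq_iff] at h1 h2 h3
  simp only [Prod.mk.injEq]
  refine ⟨Iso.ext (fun v => by rw [h1]) fun v => by rw [h2], Iso.ext (fun v => ?_) fun v => by rw [h3]⟩
  obtain ⟨v, rfl⟩ := d.q_surj v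
  exact hq v

end Contraction

/-- Shrink the block to one new vertex, here `none`. The retraction of the block, renumbered as `p`,
serves as the retraction required of a contraction. -/
theorem IsBlock.exists_contraction {G : ExtGraph s} (hG : G.Connected) {U : Finset (Fin G.n)}
    {A : Finset (Fin G.m)} (h : G.IsBlock U A) :
    ∃ (G' : ExtGraph 0) (G'' : ExtGraph s) (d : Contraction G G' G''),
      d.fibreV = U ∧ d.fibreE = A ∧ G'.Biconnected := by
  classical
  obtain ⟨ρ, hρU, hρ, hρA⟩ := h.exists_retraction hG
  let eU : Fin U.card ≃ U := U.equivFin.symm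
  let eA : Fin A.card ≃ A := A.equivFin.symm
  let eC : Fin (Aᶜ).card ≃ {a // a ∈ Aᶜ} := (Aᶜ).equivFin.symm
  let eQ : Option {v // v ∉ U} ≃ Fin (Fintype.card (Option {v // v ∉ U})) := Fintype.equivFin _
  let q₀ : Fin G.n → Option {v // v ∉ U} := fun v => if hv : v ∉ U then some ⟨v, hv⟩ else none
  have hq₀ : ∀ v w, q₀ v = q₀ w ↔ (v ∈ U ∧ w ∈ U) ∨ v = w := by
    intro v w
    simp only [q₀]
    by_cases hv : v ∈ U <;> by_cases hw : w ∈ U <;> simp [hv, hw]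
    · rintro rfl; exact hw hv
    · rintro rfl; exact hv hw
  have hcard : 0 < U.card := Nat.lt_of_lt_of_le Nat.two_pos h.1.2.1
  let p : Fin G.n → Fin U.card := fun v => eU.symm ⟨ρ v, hρU v⟩
  have hp : ∀ v ∈ U, (eU (p v) : Fin G.n) = v := fun v hv => by simp [p, hρ v hv]
  let G' : ExtGraph 0 :=
    { n := U.card
      m := A.card
      pos := hcard
      inc := fun b => (G.inc (eA b).1).map p
      loopless := fun b => by
        obtain ⟨x, y, hi⟩ := G.exists_inc (eA b).1
        rw [hi, Sym2.map_mk, Sym2.mk_isDiag_iff]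
        intro hxy
        have hx := hp x (h.1.left_mem (eA b).2 hi)
        have hy := hp y (h.1.right_mem (eA b).2 hi)
        rw [hxy, hy] at hx
        exact ne_of_inc hi hx.symm
      ext := Fin.elim0 }
  let G'' : ExtGraph s :=
    { n := Fintype.card (Option {v // v ∉ U})
      m := (Aᶜ).card
      pos := Fintype.card_pos
      inc := fun a => (G.inc (eC a).1).map fun v => eQ (q₀ v)
      loopless := fun a => by
        obtain ⟨x, y, hi⟩ := G.exists_inc (eC a).1
        rw [hi, Sym2.map_mk, Sym2.mk_isDiag_iff, eQ.injective.eq_iff, hq₀]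
        -- An edge outside the block with both ends in it would become a loop, but the retraction
        -- fixes both ends and identifies them.
        rintro (⟨hx, hy⟩ | hxy)
        · have := hρA _ (mem_compl.1 (eC a).2) x y hi
          rw [hρ x hx, hρ y hy] at this
          exact ne_of_inc hi this
        · exact ne_of_inc hi hxy
      ext := fun x => eQ (q₀ (G.ext x)) }
  let f : Fin (Aᶜ).card ⊕ Fin A.card → Fin G.m := Sum.elim (fun a => (eC a).1) fun b => (eA b).1
  have hf : Function.Bijective f := by
    constructor
    · rintro (a | a) (b | b) hab
      · simpa [f, Subtype.ext_iff.symm] using hab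
      · have h1 := (eC a).2
        have h2 := (eA b).2
        simp only [f, Sum.elim_inl, Sum.elim_inr] at hab
        rw [hab] at h1
        exact absurd h2 (mem_compl.1 h1)
      · have h1 := (eC b).2
        have h2 := (eA a).2
        simp only [f, Sum.elim_inl, Sum.elim_inr] at hab
        rw [← hab] at h1
        exact absurd h2 (mem_compl.1 h1)
      · simpa [f, Subtype.ext_iff.symm] using hab
    · intro a
      by_cases ha : a ∈ A
      · exact ⟨.inr (eA.symm ⟨a, ha⟩), by simp [f]⟩
      · exact ⟨.inl (eC.symm ⟨a, by simpa using ha⟩), by simp [f]⟩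
  have hnone : ∀ v, q₀ v = none ↔ v ∈ U := fun v => by simp [q₀]
  have hinj : Function.Injective fun l => (eU l).1 := Subtype.val_injective.comp eU.injective
  have hinc : ∀ b, G.inc (eA b).1 = (G'.inc b).map fun l => (eU l).1 := by
    intro b
    obtain ⟨x, y, hi⟩ := G.exists_inc (eA b).1
    simp only [G', hi, Sym2.map_mk]
    rw [hp x (h.1.left_mem (eA b).2 hi), hp y (h.1.right_mem (eA b).2 hi)]
  let d : Contraction G G' G'' :=
    { i := eQ none
      j := fun l => (eU l).1
      q := fun v => eQ (q₀ v)
      e := Equiv.ofBijective f hf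
      j_inj := hinj
      q_eq_i := fun v => by
        rw [eQ.injective.eq_iff, hnone]
        exact ⟨fun hv => ⟨eU.symm ⟨v, hv⟩, by simp⟩, by rintro ⟨l, rfl⟩; exact (eU l).2⟩
      q_inj := fun v w h1 h2 => by
        rw [eQ.injective.eq_iff, hq₀] at h1
        rw [Ne, eQ.injective.eq_iff, hnone] at h2
        exact h1.resolve_left fun h => h2 h.1
      q_surj := fun x => by
        obtain ⟨x, rfl⟩ := eQ.surjective x
        rcases x with _ | ⟨v, hv⟩
        · obtain ⟨u, hu⟩ := card_pos.1 hcard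
          exact ⟨u, by simp only [(hnone u).2 hu]⟩
        · exact ⟨v, by simp [q₀, hv]⟩
      inc_inr := hinc
      inc_inl := fun a => rfl
      ext_q := fun x => rfl
      retr := ⟨p, fun l => by simp [p, hρ _ (eU l).2], fun a x y hi => by
        have := hρA _ (mem_compl.1 (eC a).2) x y hi
        simp [p, this]⟩ }
  have hV : d.fibreV = U := by
    ext v
    rw [d.mem_fibreV, ← hnone]
    exact eQ.injective.eq_iff
  have hE : d.fibreE = A := by
    ext a
    simp only [Contraction.fibreE, mem_image, mem_univ, true_and, d, Equiv.ofBijective_apply, f,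
      Sum.elim_inr]
    exact ⟨by rintro ⟨b, rfl⟩; exact (eA b).2, fun ha => ⟨eA.symm ⟨a, ha⟩, by simp⟩⟩
  refine ⟨G', G'', d, hV, hE, ?_⟩
  have := h.1
  rw [← hV, ← hE] at this
  exact (biconnOn_image (h := d.j) (e := fun b => d.e (.inr b)) d.j_inj
    fun b _ => d.inc_inr b).1 this

/-! ### Gluing is inverse to contracting -/

section Glue

variable {G : ExtGraph s} {G' : ExtGraph 0} {i : Fin G.n}

/-- An edge lies in at most one block, so the choice in `blockTarget` is harmless. -/
theorem blockTarget_eq (f : G.BlocksAt i → Fin G'.n) (B : G.BlocksAt i) {a : Fin G.m}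
    (ha : a ∈ B.1.2) : blockTarget G G' i f a = f B := by
  have h : ∃ B : G.BlocksAt i, a ∈ B.1.2 := ⟨B, ha⟩
  have h2 : h.choose = B := by
    have := h.choose.2.1.eq_of_mem B.2.1 h.choose_spec ha
    exact Subtype.ext (Prod.ext this.1 this.2)
  rw [blockTarget, dif_pos h, h2]

theorem exists_blocksAt {a : Fin G.m} {x : Fin G.n} (h : G.inc a = s(i, x)) :
    ∃ B : G.BlocksAt i, a ∈ B.1.2 := by
  obtain ⟨U, A, hB, ha⟩ := G.exists_isBlock_mem a
  exact ⟨⟨(U, A), hB, hB.1.left_mem ha h⟩, ha⟩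

/-- The vertices `x` and `y` lie in the same component of the graph without the vertex `i`. -/
def JoinedOff (G : ExtGraph s) (i x y : Fin G.n) : Prop :=
  ∀ c : Fin G.n → Prop, (∀ a x y, x ≠ i → y ≠ i → G.inc a = s(x, y) → c x = c y) → c x = c y

/-- Colour `w` by whether `ρ w = i`: this is constant along edges avoiding `i`. It is false at `x`,
and would be true at `y` if `b` were outside the block. -/
theorem IsBlock.mem_of_joinedOff (hG : G.Connected) {U : Finset (Fin G.n)} {A : Finset (Fin G.m)}
    (h : G.IsBlock U A) {a b : Fin G.m} {x y : Fin G.n} (ha : a ∈ A) (hx : G.inc a = s(i, x))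
    (hy : G.inc b = s(i, y)) (hxy : G.JoinedOff i x y) : b ∈ A := by
  obtain ⟨ρ, -, h1, h2⟩ := h.exists_retraction hG
  by_contra hb
  have := hxy (fun w => ρ w = i) (by
    intro e v w hv hw hi
    by_cases he : e ∈ A
    · simp only [h1 v (h.1.left_mem he hi), h1 w (h.1.right_mem he hi), hv, hw]
    · rw [h2 e he v w hi])
  rw [← h2 b hb i y hy, h1 i (h.1.left_mem ha hx), h1 x (h.1.right_mem ha hx)] at this
  exact ne_of_inc hx (this.mpr rfl).symm

theorem blockTarget_eq_of_joinedOff (hG : G.Connected) (f : G.BlocksAt i → Fin G'.n)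
    {a b : Fin G.m} {x y : Fin G.n} (hx : G.inc a = s(i, x)) (hy : G.inc b = s(i, y))
    (hxy : G.JoinedOff i x y) : blockTarget G G' i f a = blockTarget G G' i f b := by
  obtain ⟨B, hB⟩ := exists_blocksAt hx
  rw [blockTarget_eq f B hB, blockTarget_eq f B (B.2.1.mem_of_joinedOff hG hB hx hy hxy)]

theorem Connected.exists_joinedOff (hG : G.Connected) (i : Fin G.n) {x : Fin G.n} (hx : x ≠ i) :
    ∃ b y, G.inc b = s(i, y) ∧ G.JoinedOff i y x := by
  have := hG.color (fun x => x = i ∨ ∃ b y, G.inc b = s(i, y) ∧ G.JoinedOff i y x) (by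
    have key : ∀ a x y, G.inc a = s(x, y) →
        (x = i ∨ ∃ b z, G.inc b = s(i, z) ∧ G.JoinedOff i z x) →
        (y = i ∨ ∃ b z, G.inc b = s(i, z) ∧ G.JoinedOff i z y) := by
      intro a x y hi hx
      by_cases hxi : x = i
      · subst hxi
        exact .inr ⟨a, y, hi, fun _ _ => rfl⟩
      · by_cases hyi : y = i
        · exact .inl hyi
        · obtain ⟨b, z, hb, hz⟩ := hx.resolve_left hxi
          exact .inr ⟨b, z, hb, fun c hc => (hz c hc).trans (hc a x y hxi hyi hi)⟩
    intro a _ x _ y _ hi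
    exact propext ⟨key a x y hi, key a y x (hi.trans Sym2.eq_swap)⟩) i (mem_univ _) x (mem_univ _)
  exact (this.mp (.inl rfl)).resolve_left hx

/-- The edges from `i` into one component of `G` without `i` lie in a single block, so `f` extends
to a function constant on these components. It becomes the retraction of the glued graph onto `G'`.
-/
theorem exists_vertexTarget (hG : G.Connected) (f : G.BlocksAt i → Fin G'.n) :
    ∃ T : Fin G.n → Fin G'.n, (∀ a x, G.inc a = s(i, x) → T x = blockTarget G G' i f a) ∧
      ∀ a x y, x ≠ i → y ≠ i → G.inc a = s(x, y) → T x = T y := by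
  classical
  choose b y h1 h2 using fun x : {x // x ≠ i} => hG.exists_joinedOff i x.2
  refine ⟨fun x => if hx : x ≠ i then blockTarget G G' i f (b ⟨x, hx⟩) else ⟨0, G'.pos⟩, ?_, ?_⟩
  · intro a x ha
    have hx := (ne_of_inc ha).symm
    simp only [hx, ne_eq, not_false_eq_true, dif_pos]
    exact blockTarget_eq_of_joinedOff hG f (h1 ⟨x, hx⟩) ha (h2 ⟨x, hx⟩)
  · intro a x z hx hz ha
    simp only [hx, hz, ne_eq, not_false_eq_true, dif_pos]
    refine blockTarget_eq_of_joinedOff hG f (h1 ⟨x, hx⟩) (h1 ⟨z, hz⟩) fun c hc => ?_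
    exact ((h2 ⟨x, hx⟩ c hc).trans (hc a x z hx hz ha)).trans (h2 ⟨z, hz⟩ c hc).symm

/-- The vertex of `G` that a vertex of the glued graph comes from. -/
def glueQ (G : ExtGraph s) (G' : ExtGraph 0) (i : Fin G.n) (w : Fin (G.n + G'.n - 1)) : Fin G.n :=
  if h : w.val < G.n then ⟨w, h⟩ else i

theorem glueQ_oldV (v : Fin G.n) : glueQ G G' i (oldV G G' v) = v := by
  simp [glueQ, oldV]

theorem glueQ_newV (l : Fin G'.n) : glueQ G G' i (newV G G' i l) = i := by
  unfold newV
  split_ifs with h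
  · exact glueQ_oldV i
  · unfold glueQ
    rw [dif_neg]
    simp only
    omega

theorem glue_cases (i : Fin G.n) (w : Fin (G.n + G'.n - 1)) :
    (∃ l, newV G G' i l = w) ∨ ∃ v, v ≠ i ∧ oldV G G' v = w := by
  by_cases h : w.val < G.n
  · by_cases h2 : (⟨w, h⟩ : Fin G.n) = i
    · exact .inl ⟨⟨0, G'.pos⟩, by simp [newV, oldV, ← h2]⟩
    · exact .inr ⟨⟨w, h⟩, h2, rfl⟩
  -- The shift by one is due to the first vertex of `G'`, which takes the name of `i`.
  · refine .inl ⟨⟨w - G.n + 1, by omega⟩, ?_⟩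
    simp only [newV, Nat.add_eq_zero_iff, one_ne_zero, and_false, dif_neg, not_false_eq_true]
    exact Fin.ext (by simp only; omega)

variable (f : G.BlocksAt i → Fin G'.n) (g : {x // G.ext x = i} → Fin G'.n)

/-- The edges of the glued graph. -/
def glueE : Fin G.m ⊕ Fin G'.m ≃ Fin (glue G G' i f g).m := finSumFinEquiv

open Classical in
theorem glue_inc_inl (a : Fin G.m) : (glue G G' i f g).inc (glueE f g (.inl a))
    = (G.inc a).map fun v =>
      if v = i then newV G G' i (blockTarget G G' i f a) else oldV G G' v := by
  have h : glueE f g (.inl a) = Fin.castAdd G'.m a := finSumFinEquiv_apply_left a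
  rw [h]
  simp only [glue, Fin.addCases_left]

theorem glue_inc_inr (b : Fin G'.m) : (glue G G' i f g).inc (glueE f g (.inr b))
    = (G'.inc b).map (newV G G' i) := by
  have h : glueE f g (.inr b) = Fin.natAdd G.m b := finSumFinEquiv_apply_right b
  rw [h]
  simp only [glue, Fin.addCases_right]

/-- The contraction of the glued graph onto the graph it was obtained from. -/
noncomputable def glueContraction (hG : G.Connected) :
    Contraction (glue G G' i f g) G' G where
  i := i
  j := newV G G' i
  q := glueQ G G' i
  e := glueE f g
  j_inj := newV_injective G G' i
  q_eq_i := fun w => by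
    rcases glue_cases i w with ⟨l, rfl⟩ | ⟨v, hv, rfl⟩
    · exact iff_of_true (glueQ_newV l) ⟨l, rfl⟩
    · refine iff_of_false ?_ ?_
      · rwa [glueQ_oldV]
      · rintro ⟨l, hl⟩
        exact newV_ne_oldV G G' i l v hv hl
  q_inj := fun w w' h1 h2 => by
    rcases glue_cases i w with ⟨l, rfl⟩ | ⟨v, hv, rfl⟩
    · exact absurd (glueQ_newV l) h2
    · rcases glue_cases i w' with ⟨l, rfl⟩ | ⟨v', hv', rfl⟩
      · exact absurd (h1.trans (glueQ_newV l)) h2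
      · rw [glueQ_oldV, glueQ_oldV] at h1
        rw [h1]
  q_surj := fun v => ⟨oldV G G' v, glueQ_oldV v⟩
  inc_inr := glue_inc_inr f g
  inc_inl := fun a => by
    classical
    refine Eq.trans ?_ (congrArg (Sym2.map (glueQ G G' i)) (glue_inc_inl f g a).symm)
    rw [Sym2.map_map]
    refine ((congrFun Sym2.map_id (G.inc a)).symm.trans (congrArg (fun h => Sym2.map h (G.inc a)) ?_))
    funext v
    by_cases h : v = i
    · simp [h, glueQ_newV]
    · simp [h, glueQ_oldV]
  ext_q := fun x => by
    by_cases h : G.ext x = i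
    · simp [glue, h, glueQ_newV]
    · simp [glue, h, glueQ_oldV]
  retr := by
    classical
    obtain ⟨T, h1, h2⟩ := exists_vertexTarget hG f
    -- The retraction sends a vertex of the inserted copy of `G'` to itself and any other vertex to
    -- the target of its component.
    have hex : ∀ w : Fin (G.n + G'.n - 1), ∃ l, (∀ l', newV G G' i l' = w → l' = l) ∧
        ∀ v, v ≠ i → oldV G G' v = w → T v = l := by
      intro w
      rcases glue_cases i w with ⟨l, rfl⟩ | ⟨v, hv, rfl⟩
      · exact ⟨l, fun l' h => newV_injective G G' i h,
          fun v hv h => absurd h.symm (newV_ne_oldV G G' i l v hv)⟩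
      · exact ⟨T v, fun l' h => absurd h (newV_ne_oldV G G' i l' v hv),
          fun v' _ h => by rw [oldV_injective G G' h]⟩
    choose ρ hρ1 hρ2 using hex
    refine ⟨ρ, fun l => (hρ1 _ l rfl).symm, fun a x y hi => ?_⟩
    replace hi := (glue_inc_inl f g a).symm.trans hi
    obtain ⟨z, w, ha⟩ := G.exists_inc a
    have hzw := ne_of_inc ha
    have hval : ∀ v, (v ≠ i → T v = T z) → (v = i → blockTarget G G' i f a = T z) →
        ρ (if v = i then newV G G' i (blockTarget G G' i f a) else oldV G G' v) = T z := by
      intro v h3 h4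
      split_ifs with hv
      · rw [← hρ1 _ _ rfl, h4 hv]
      · rw [← hρ2 _ v hv rfl, h3 hv]
    have hval' : ∀ v, (v ≠ i → T v = T w) → (v = i → blockTarget G G' i f a = T w) →
        ρ (if v = i then newV G G' i (blockTarget G G' i f a) else oldV G G' v) = T w := by
      intro v h3 h4
      split_ifs with hv
      · rw [← hρ1 _ _ rfl, h4 hv]
      · rw [← hρ2 _ v hv rfl, h3 hv]
    have key : ρ (if z = i then newV G G' i (blockTarget G G' i f a) else oldV G G' z)
        = ρ (if w = i then newV G G' i (blockTarget G G' i f a) else oldV G G' w) := by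
      by_cases hz : z = i
      · have hw : w ≠ i := fun h => hzw (hz.trans h.symm)
        subst hz
        rw [hval' z (fun h => absurd rfl h) fun _ => (h1 a w ha).symm,
          hval' w (fun _ => rfl) fun h => absurd h hw]
      · by_cases hw : w = i
        · subst hw
          rw [hval z (fun _ => rfl) fun h => absurd h hz,
            hval w (fun h => absurd rfl h) fun _ => (h1 a z (ha.trans Sym2.eq_swap)).symm]
        · rw [hval z (fun _ => rfl) fun h => absurd h hz,
            hval w (fun _ => (h2 a z w hz hw ha).symm) fun h => absurd h hw]
    rw [ha, Sym2.map_mk] at hi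
    rcases Sym2.eq_iff.1 hi with ⟨rfl, rfl⟩ | ⟨rfl, rfl⟩
    · exact key
    · exact key.symm

end Glue

/-! ### Every contraction arises from a gluing, in exactly one way -/

namespace Contraction

variable {G H : ExtGraph s} {G' : ExtGraph 0} {G'' : ExtGraph s}

/-- The contraction carried over along an isomorphism. -/
def ofIso (d : Contraction H G' G'') (ψ : Iso G H) : Contraction G G' G'' where
  i := d.i
  j := fun l => ψ.onV.symm (d.j l)
  q := fun v => d.q (ψ.onV v)
  e := d.e.trans ψ.onE.symm
  j_inj := ψ.onV.symm.injective.comp d.j_inj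
  q_eq_i := fun v => by
    rw [d.q_eq_i]
    simp only [Equiv.symm_apply_eq]
  q_inj := fun v w h1 h2 => ψ.onV.injective (d.q_inj _ _ h1 h2)
  q_surj := d.q_surj.comp ψ.onV.surjective
  inc_inr := fun b => by
    have := ψ.symm.inc_map (d.e (.inr b))
    rw [d.inc_inr, Sym2.map_map] at this
    exact this
  inc_inl := fun a => by
    have := ψ.inc_map (ψ.onE.symm (d.e (.inl a)))
    rw [Equiv.apply_symm_apply] at this
    rw [d.inc_inl, this, Sym2.map_map]
    rfl
  ext_q := fun x => by rw [d.ext_q, ψ.ext_map]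
  retr := by
    obtain ⟨ρ, h1, h2⟩ := d.retr
    refine ⟨fun v => ρ (ψ.onV v), fun l => by simp only [Equiv.apply_symm_apply, h1],
      fun a x y hi => ?_⟩
    have := ψ.inc_map (ψ.onE.symm (d.e (.inl a)))
    rw [Equiv.apply_symm_apply] at this
    refine h2 a _ _ (this.trans ?_)
    erw [hi]
    rfl

/-- The functions `f` and `g` describe to which vertices of the fibre the biconnected components
and the external edges at the vertex `i` are attached. -/
def Attaches (d : Contraction G G' G'') {i : Fin G''.n} (f : G''.BlocksAt i → Fin G'.n)
    (g : {x // G''.ext x = i} → Fin G'.n) : Prop :=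
  (∀ C : G''.BlocksAt i, ∀ a ∈ C.1.2, ∀ v w, G.inc (d.e (.inl a)) = s(v, w) → d.q v = i →
    d.j (f C) = v) ∧ ∀ x, d.j (g x) = G.ext x.1

/-- A block at `i` stays connected without `i`, so the retraction `ρ` takes one value on it there.
That value is the vertex of the fibre at which the block is attached. -/
theorem exists_attaches (d : Contraction G G' G'') : ∃ (f : G''.BlocksAt d.i → Fin G'.n) (g : {x // G''.ext x = d.i} → Fin G'.n), d.Attaches f g := by
  obtain ⟨ρ, h1, h2⟩ := d.retr
  have hjρ : ∀ v, d.q v = d.i → d.j (ρ v) = v := by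
    intro v hv
    obtain ⟨l, rfl⟩ := (d.q_eq_i v).1 hv
    rw [h1]
  choose σ hσ using d.q_surj
  have hf : ∀ C : G''.BlocksAt d.i, ∃ l, ∀ a ∈ C.1.2, ∀ v w, G.inc (d.e (.inl a)) = s(v, w) →
      d.q v = d.i → ρ v = l := by
    intro C
    obtain ⟨t, ht, hti⟩ := C.2.1.1.exists_ne d.i
    refine ⟨ρ (σ t), fun a ha v w hi hv => ?_⟩
    have hi'' : G''.inc a = s(d.q v, d.q w) := by rw [d.inc_inl, hi]; rfl
    have hw : d.q w ≠ d.i := fun h => ne_of_inc hi'' (hv.trans h.symm)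
    have hσw : ∀ w, d.q w ≠ d.i → σ (d.q w) = w := fun w hw =>
      (d.q_inj w _ (hσ _).symm hw).symm
    have := C.2.1.1.color_erase d.i (fun x => ρ (σ x)) (by
      intro b hb x hx y hy hxi hyi hb'
      obtain ⟨x, y, hxy, rfl, rfl⟩ := d.exists_end hb'
      simp only [hσw x hxi, hσw y hyi, h2 b x y hxy])
      _ (C.2.1.1.right_mem ha hi'') t ht hw hti
    simp only [hσw w hw] at this
    rw [h2 a v w hi, this]
  choose f hf using hf
  refine ⟨f, fun x => ρ (G.ext x.1), fun C a ha v w hi hv => ?_, fun x => hjρ _ ?_⟩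
  · rw [← hf C a ha v w hi hv, hjρ v hv]
  · rw [← d.ext_q, x.2]

/-- Each block at `i` has an edge at `i`, whose end in the fibre determines `f`. -/
theorem Attaches.unique {d : Contraction G G' G''} {i : Fin G''.n} {f f' : G''.BlocksAt i → Fin G'.n}
    {g g' : {x // G''.ext x = i} → Fin G'.n} (h : d.Attaches f g) (h' : d.Attaches f' g') :
    f = f' ∧ g = g' := by
  refine ⟨funext fun C => d.j_inj ?_, funext fun x => d.j_inj ((h.2 x).trans (h'.2 x).symm)⟩
  obtain ⟨a, ha, x, hi⟩ := C.2.1.1.exists_edge C.2.2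
  obtain ⟨v, w, hvw, hv, -⟩ := d.exists_end hi
  exact (h.1 C a ha v w hvw hv).trans (h'.1 C a ha v w hvw hv).symm

theorem glueContraction_attaches (hG : G''.Connected) (i : Fin G''.n)
    (f : G''.BlocksAt i → Fin G'.n) (g : {x // G''.ext x = i} → Fin G'.n) :
    (glueContraction f g hG).Attaches f g := by
  classical
  refine ⟨fun C a ha v w hi hv => ?_, fun x => ?_⟩
  · have h : s(v, w) = (G''.inc a).map fun v =>
        if v = i then newV G'' G' i (blockTarget G'' G' i f a) else oldV G'' G' v :=
      hi.symm.trans (glue_inc_inl f g a)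
    have hmem : v ∈ (G''.inc a).map fun v =>
        if v = i then newV G'' G' i (blockTarget G'' G' i f a) else oldV G'' G' v := by
      rw [← h]; exact Sym2.mem_mk_left v w
    obtain ⟨z, -, hz⟩ := Sym2.mem_map.1 hmem
    by_cases hzi : z = i
    · rw [if_pos hzi, blockTarget_eq f C ha] at hz
      exact hz
    · rw [if_neg hzi] at hz
      have hv : glueQ G'' G' i v = i := hv
      rw [← hz, glueQ_oldV] at hv
      exact absurd hv hzi
  · have : (glue G'' G' i f g).ext x.1 = newV G'' G' i (g x) := by
      have hx : G''.ext x.1 = i := x.2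
      exact dif_pos hx
    exact this.symm

theorem Attaches.ofIso {d : Contraction H G' G''} {i : Fin G''.n} {f : G''.BlocksAt i → Fin G'.n}
    {g : {x // G''.ext x = i} → Fin G'.n} (h : d.Attaches f g) (ψ : Iso G H) :
    (d.ofIso ψ).Attaches f g := by
  refine ⟨fun C a ha v w hi hv => ?_, fun x => ?_⟩
  · have := ψ.inc_map (ψ.onE.symm (d.e (.inl a)))
    rw [Equiv.apply_symm_apply] at this
    erw [hi] at this
    exact (Equiv.symm_apply_eq _).2 (h.1 C a ha _ _ this hv)
  · refine (Equiv.symm_apply_eq _).2 ?_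
    rw [← ψ.ext_map]
    exact h.2 x

/-- Fibre vertices go to the inserted copy of `G'`, the others to their images under `q`; the
attachment data make this respect incidence and external edges. -/
theorem exists_iso_glue (d : Contraction G G' G'') (hG : G''.Connected)
    {f : G''.BlocksAt d.i → Fin G'.n} {g : {x // G''.ext x = d.i} → Fin G'.n}
    (h : d.Attaches f g) :
    ∃ ψ : Iso G (glue G'' G' d.i f g), (glueContraction f g hG).ofIso ψ = d := by
  classical
  have hjex : ∀ v, ∃ l, d.q v = d.i → d.j l = v := fun v => by
    by_cases hv : d.q v = d.i
    · obtain ⟨l, hl⟩ := (d.q_eq_i v).1 hv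
      exact ⟨l, fun _ => hl⟩
    · exact ⟨⟨0, G'.pos⟩, fun h => absurd h hv⟩
  choose p hp using hjex
  have hpj : ∀ l, p (d.j l) = l := fun l => d.j_inj (hp _ (d.q_j l))
  let F : Fin G.n → Fin (G''.n + G'.n - 1) := fun v =>
    if d.q v = d.i then newV G'' G' d.i (p v) else oldV G'' G' (d.q v)
  have hFj : ∀ l, F (d.j l) = newV G'' G' d.i l := fun l => by
    simp only [F, d.q_j, if_true, hpj]
  have hFo : ∀ v, d.q v ≠ d.i → F v = oldV G'' G' (d.q v) := fun v hv => if_neg hv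
  have hF : Function.Bijective F := by
    constructor
    · intro v w hvw
      by_cases hv : d.q v = d.i
      · obtain ⟨l, rfl⟩ := (d.q_eq_i v).1 hv
        by_cases hw : d.q w = d.i
        · obtain ⟨l', rfl⟩ := (d.q_eq_i w).1 hw
          rw [hFj, hFj] at hvw
          rw [newV_injective G'' G' d.i hvw]
        · rw [hFj, hFo w hw] at hvw
          exact absurd hvw (newV_ne_oldV G'' G' d.i l _ hw)
      · by_cases hw : d.q w = d.i
        · obtain ⟨l', rfl⟩ := (d.q_eq_i w).1 hw
          rw [hFj, hFo v hv] at hvw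
          exact absurd hvw.symm (newV_ne_oldV G'' G' d.i l' _ hv)
        · rw [hFo v hv, hFo w hw] at hvw
          exact d.q_inj v w (oldV_injective G'' G' hvw) hv
    · intro w
      rcases glue_cases d.i w with ⟨l, rfl⟩ | ⟨x, hx, rfl⟩
      · exact ⟨d.j l, hFj l⟩
      · obtain ⟨v, rfl⟩ := d.q_surj x
        exact ⟨v, hFo v hx⟩
  let ψ : Iso G (glue G'' G' d.i f g) :=
    { onV := Equiv.ofBijective F hF
      onE := d.e.symm.trans (glueE f g)
      inc_map := fun a => by
        obtain ⟨a | b, rfl⟩ := d.e.surjective a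
        · simp only [Equiv.trans_apply, Equiv.symm_apply_apply, glue_inc_inl]
          rw [d.inc_inl, Sym2.map_map]
          obtain ⟨v, w, hi⟩ := G.exists_inc (d.e (.inl a))
          have key : ∀ v w, G.inc (d.e (.inl a)) = s(v, w) →
              (if d.q v = d.i then newV G'' G' d.i (blockTarget G'' G' d.i f a)
                else oldV G'' G' (d.q v)) = F v := by
            intro v w hi
            by_cases hv : d.q v = d.i
            · have hi'' : G''.inc a = s(d.i, d.q w) := by rw [d.inc_inl, hi, ← hv]; rfl
              obtain ⟨C, hC⟩ := exists_blocksAt hi''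
              rw [if_pos hv, blockTarget_eq f C hC, ← hFj, h.1 C a hC v w hi hv]
            · rw [if_neg hv, hFo v hv]
          rw [hi, Sym2.map_mk, Sym2.map_mk]
          simp only [Function.comp_apply, key v w hi, key w v (hi.trans Sym2.eq_swap)]
          rfl
        · simp only [Equiv.trans_apply, Equiv.symm_apply_apply, glue_inc_inr]
          rw [d.inc_inr, Sym2.map_map]
          congr 1
          exact (funext hFj).symm
      ext_map := fun x => by
        by_cases hx : G''.ext x = d.i
        · have h1 : (glue G'' G' d.i f g).ext x = newV G'' G' d.i (g ⟨x, hx⟩) := by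
            simp [glue, hx]
          rw [h1, ← hFj, h.2 ⟨x, hx⟩]
          rfl
        · have h1 : (glue G'' G' d.i f g).ext x = oldV G'' G' (G''.ext x) := by
            simp [glue, hx]
          rw [d.ext_q] at h1 hx
          rw [h1, ← hFo _ hx]
          rfl }
  refine ⟨ψ, ext' (fun l => ?_) (fun v => ?_) fun a => ?_⟩
  · exact (Equiv.symm_apply_eq _).2 (hFj l).symm
  · change glueQ G'' G' d.i (F v) = d.q v
    by_cases hv : d.q v = d.i
    · obtain ⟨l, rfl⟩ := (d.q_eq_i v).1 hv
      rw [hFj, glueQ_newV, hv]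
    · rw [hFo v hv, glueQ_oldV]
  · change d.e ((glueE f g).symm (glueE f g a)) = d.e a
    rw [Equiv.symm_apply_apply]

/-- On the fibre `ψ` is recovered from `j`, elsewhere from `q`, and on edges from `e`. -/
theorem ofIso_injective (d : Contraction H G' G'') :
    Function.Injective fun ψ : Iso G H => d.ofIso ψ := by
  intro ψ ψ' h
  have h : d.ofIso ψ = d.ofIso ψ' := h
  have hj : ∀ l, ψ.onV.symm (d.j l) = ψ'.onV.symm (d.j l) := fun l =>
    congrFun (congrArg Contraction.j h) l
  have hq : ∀ v, d.q (ψ.onV v) = d.q (ψ'.onV v) := fun v => congrFun (congrArg Contraction.q h) v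
  have he : ∀ a, (d.ofIso ψ).e a = (d.ofIso ψ').e a := fun a => by rw [h]
  refine Iso.ext (fun v => ?_) fun a => ?_
  · by_cases hv : d.q (ψ.onV v) = d.i
    · obtain ⟨l, hl⟩ := (d.q_eq_i _).1 hv
      have := hj l
      rw [hl, Equiv.symm_apply_apply, eq_comm, Equiv.symm_apply_eq] at this
      exact this
    · exact d.q_inj _ _ (hq v) hv
  · have := he (d.e.symm (ψ.onE a))
    simp only [ofIso, Equiv.trans_apply, Equiv.apply_symm_apply, Equiv.symm_apply_apply] at this
    rw [eq_comm, Equiv.symm_apply_eq] at this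
    exact this

/-- The contractions of `G` onto `G''` with fibre `G'` correspond to the isomorphisms from `G` to
the graphs obtained by replacing a vertex of `G''` by `G'`. -/
theorem sum_card_iso_glue (G : ExtGraph s) (G' : ExtGraph 0) (hG : G''.Connected) :
    ∑ i : Fin G''.n, (open Classical in ∑ f : G''.BlocksAt i → Fin G'.n,
      ∑ g : {x // G''.ext x = i} → Fin G'.n, Nat.card (Iso G (glue G'' G' i f g)))
      = Nat.card (Contraction G G' G'') := by
  classical
  let X := Σ i : Fin G''.n, Σ f : G''.BlocksAt i → Fin G'.n,
    Σ g : {x // G''.ext x = i} → Fin G'.n, Iso G (glue G'' G' i f g)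
  have hX : Nat.card X = ∑ i : Fin G''.n, ∑ f : G''.BlocksAt i → Fin G'.n,
      ∑ g : {x // G''.ext x = i} → Fin G'.n, Nat.card (Iso G (glue G'' G' i f g)) := by
    rw [Nat.card_sigma]
    refine sum_congr rfl fun i _ => ?_
    rw [Nat.card_sigma]
    refine sum_congr rfl fun f _ => ?_
    rw [Nat.card_sigma]
  rw [← hX]
  refine Nat.card_eq_of_bijective
    (fun p : X => (glueContraction p.2.1 p.2.2.1 hG).ofIso p.2.2.2) ⟨?_, ?_⟩
  · rintro ⟨i, f, g, ψ⟩ ⟨i', f', g', ψ'⟩ h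
    have h : (glueContraction f g hG).ofIso ψ = (glueContraction f' g' hG).ofIso ψ' := h
    have hi : i = i' := congrArg Contraction.i h
    subst hi
    have h1 := (glueContraction_attaches hG i f g).ofIso ψ
    have h2 := (glueContraction_attaches hG i f' g').ofIso ψ'
    rw [← h] at h2
    obtain ⟨rfl, rfl⟩ := h1.unique h2
    rw [ofIso_injective _ h]
  · intro d
    obtain ⟨f, g, hfg⟩ := d.exists_attaches
    obtain ⟨ψ, hψ⟩ := d.exists_iso_glue hG hfg
    exact ⟨⟨d.i, f, g, ψ⟩, hψ⟩

end Contraction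

/-! ### Counting contractions by their fibres -/

/-- The biconnected components of a graph. -/
abbrev Block (G : ExtGraph s) : Type :=
  {B : Finset (Fin G.n) × Finset (Fin G.m) // G.IsBlock B.1 B.2}

noncomputable instance (G : ExtGraph s) : Fintype G.Block := Fintype.ofFinite _

/-- For every block, a contraction of the graph that has this block as its fibre. -/
structure BlockContractions (G : ExtGraph s) where
  fibre : G.Block → ExtGraph 0
  quot : G.Block → ExtGraph s
  contr : ∀ B, Contraction G (fibre B) (quot B)
  fibreV_eq : ∀ B, (contr B).fibreV = B.1.1
  fibreE_eq : ∀ B, (contr B).fibreE = B.1.2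
  biconnected : ∀ B, (fibre B).Biconnected

theorem Connected.exists_blockContractions {G : ExtGraph s} (hG : G.Connected) :
    Nonempty (BlockContractions G) := by
  choose F Q d h1 h2 h3 using fun B : G.Block => B.2.exists_contraction hG
  exact ⟨⟨F, Q, d, h1, h2, h3⟩⟩

namespace Contraction

variable {G : ExtGraph s} {G' H' : ExtGraph 0} {G'' H'' : ExtGraph s}

theorem fibreV_trans (d : Contraction G G' G'') (α : Iso G' H') (β : Iso G'' H'') :
    (d.trans α β).fibreV = d.fibreV := by
  ext v
  rw [mem_fibreV, mem_fibreV]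
  exact β.onV.injective.eq_iff

theorem fibreE_trans (d : Contraction G G' G'') (α : Iso G' H') (β : Iso G'' H'') :
    (d.trans α β).fibreE = d.fibreE := by
  ext a
  obtain ⟨a | b, rfl⟩ := d.e.surjective a
  · have : d.e (.inl a) = (d.trans α β).e (.inl (β.onE a)) := by simp [trans]
    simp only [inl_notMem_fibreE, iff_false]
    rw [this]
    exact inl_notMem_fibreE _ _
  · have : d.e (.inr b) = (d.trans α β).e (.inr (α.onE b)) := by simp [trans]
    simp only [inr_mem_fibreE, iff_true]
    rw [this]
    exact inr_mem_fibreE _ _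

end Contraction

/-- A contraction with biconnected fibre singles out a block `B`, and arises from the chosen
contraction of `B` by a unique pair of isomorphisms. -/
theorem BlockContractions.card_contraction {G : ExtGraph s} (D : BlockContractions G)
    {G' : ExtGraph 0} (hG' : G'.Biconnected) (G'' : ExtGraph s) :
    Nat.card (Contraction G G' G'')
      = ∑ B, Nat.card (Iso (D.fibre B) G') * Nat.card (Iso (D.quot B) G'') := by
  have hX : Nat.card (Σ B, Iso (D.fibre B) G' × Iso (D.quot B) G'')
      = ∑ B, Nat.card (Iso (D.fibre B) G') * Nat.card (Iso (D.quot B) G'') := by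
    rw [Nat.card_sigma]
    exact sum_congr rfl fun B _ => Nat.card_prod _ _
  rw [← hX]
  refine (Nat.card_eq_of_bijective
    (fun p : Σ B, Iso (D.fibre B) G' × Iso (D.quot B) G'' =>
      (D.contr p.1).trans p.2.1 p.2.2) ⟨?_, ?_⟩).symm
  · rintro ⟨B, p⟩ ⟨B', p'⟩ h
    have h : (D.contr B).trans p.1 p.2 = (D.contr B').trans p'.1 p'.2 := h
    have h1 := congrArg Contraction.fibreV h
    have h2 := congrArg Contraction.fibreE h
    rw [Contraction.fibreV_trans, Contraction.fibreV_trans, D.fibreV_eq, D.fibreV_eq] at h1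
    rw [Contraction.fibreE_trans, Contraction.fibreE_trans, D.fibreE_eq, D.fibreE_eq] at h2
    obtain rfl : B = B' := Subtype.ext (Prod.ext h1 h2)
    rw [Contraction.trans_injective _ h]
  · intro d
    obtain ⟨p, hp⟩ := (D.contr ⟨(d.fibreV, d.fibreE), d.isBlock hG'⟩).exists_trans_eq d
      (D.fibreV_eq _) (D.fibreE_eq _)
    exact ⟨⟨_, p⟩, hp⟩

theorem BlockContractions.sum_m {G : ExtGraph s} (D : BlockContractions G) :
    ∑ B, (D.fibre B).m = G.m := by
  classical
  have h1 : ∀ B, (D.fibre B).m = ∑ a : Fin G.m, if a ∈ B.1.2 then 1 else 0 := by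
    intro B
    rw [← (D.contr B).card_fibreE, D.fibreE_eq, sum_boole]
    simp
  simp only [h1]
  rw [sum_comm]
  have h2 : ∀ a : Fin G.m, (∑ B : G.Block, if a ∈ B.1.2 then 1 else 0) = 1 := by
    intro a
    obtain ⟨U, A, hB, ha⟩ := G.exists_isBlock_mem a
    rw [sum_eq_single ⟨(U, A), hB⟩]
    · simp [ha]
    · intro B _ hne
      rw [if_neg]
      intro h
      have := B.2.eq_of_mem hB h ha
      exact hne (Subtype.ext (Prod.ext this.1 this.2))
    · simp
  simp [h2]

/-! ### Counting isomorphisms to the graphs in `r_i` -/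

theorem r_apply (i : ℕ) (ϑ : ExtGraph 0 →₀ ℚ) (β : ExtGraph s →₀ ℚ) :
    r i ϑ β = ∑ G' ∈ ϑ.support, ϑ G' • ∑ G'' ∈ β.support, β G'' • rGraph i G' G'' := by
  unfold r Finsupp.sum
  rw [LinearMap.sum_apply]
  rfl

theorem sum_isoCount_rGraph (G : ExtGraph s) (G' : ExtGraph 0) {G'' : ExtGraph s}
    (h : G''.Connected) :
    ∑ i ∈ range G''.n, isoCount G (rGraph i G' G'') = Nat.card (Contraction G G' G'') := by
  classical
  rw [← Contraction.sum_card_iso_glue G G' h, sum_range]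
  push_cast
  refine sum_congr rfl fun i _ => ?_
  rw [rGraph, dif_pos i.2]
  simp only [map_sum, isoCount_single, one_mul]

/-- The heart of the double count: extend `card_contraction` bilinearly. All graphs in `β` have `n`
vertices, so the sum over `i` meets every vertex of each of them. -/
theorem BlockContractions.sum_isoCount_r {G : ExtGraph s} (D : BlockContractions G) {n : ℕ}
    {ϑ : ExtGraph 0 →₀ ℚ} {β : ExtGraph s →₀ ℚ} (hϑ : ∀ G' ∈ ϑ.support, G'.Biconnected)
    (hβ : ∀ G'' ∈ β.support, G''.n = n ∧ G''.Connected) :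
    ∑ i ∈ range n, isoCount G (r i ϑ β)
      = ∑ B, isoCount (D.fibre B) ϑ * isoCount (D.quot B) β := by
  simp only [r_apply, map_sum, map_smul, smul_eq_mul, isoCount_apply (D.fibre _),
    isoCount_apply (D.quot _), sum_mul_sum]
  rw [sum_comm, sum_comm (s := univ)]
  refine sum_congr rfl fun G' hG' => ?_
  rw [← mul_sum, sum_comm, sum_comm (s := univ), mul_sum]
  refine sum_congr rfl fun G'' hG'' => ?_
  obtain ⟨rfl, hc⟩ := hβ G'' hG''
  rw [← mul_sum, sum_isoCount_rGraph G G' hc, D.card_contraction (hϑ G' hG')]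
  push_cast
  rw [mul_sum, mul_sum]
  exact sum_congr rfl fun B _ => by ring

/-! ### Support and signs -/

theorem r_mem_supported {i : ℕ} {ϑ : ExtGraph 0 →₀ ℚ} {β : ExtGraph s →₀ ℚ}
    {W : Set (ExtGraph s)}
    (h : ∀ G' ∈ ϑ.support, ∀ G'' ∈ β.support, ∀ i f g, glue G'' G' i f g ∈ W) :
    r i ϑ β ∈ Finsupp.supported ℚ ℚ W := by
  classical
  rw [r_apply]
  refine Submodule.sum_mem _ fun G' hG' => Submodule.smul_mem _ _ (Submodule.sum_mem _
    fun G'' hG'' => Submodule.smul_mem _ _ ?_)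
  rw [rGraph]
  split_ifs
  · exact Submodule.sum_mem _ fun f _ => Submodule.sum_mem _ fun g _ =>
      Finsupp.single_mem_supported ℚ _ (h G' hG' G'' hG'' _ f g)
  · exact Submodule.zero_mem _

theorem r_nonneg {i : ℕ} {ϑ : ExtGraph 0 →₀ ℚ} {β : ExtGraph s →₀ ℚ} (hϑ : ∀ G, 0 ≤ ϑ G)
    (hβ : ∀ G, 0 ≤ β G) (G : ExtGraph s) : 0 ≤ r i ϑ β G := by
  classical
  rw [r_apply, Finsupp.finsetSum_apply]
  refine sum_nonneg fun G' _ => ?_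
  rw [Finsupp.smul_apply, Finsupp.finsetSum_apply]
  refine mul_nonneg (hϑ _) (sum_nonneg fun G'' _ => mul_nonneg (hβ _) ?_)
  rw [rGraph]
  split_ifs
  · rw [Finsupp.finsetSum_apply]
    refine sum_nonneg fun f _ => ?_
    rw [Finsupp.finsetSum_apply]
    refine sum_nonneg fun g _ => ?_
    rw [Finsupp.single_apply]
    split_ifs <;> norm_num
  · exact le_rfl

/-! ### The recursion -/

theorem isAutWeighted_single_point {W : Set (ExtGraph s)} (hp : point s ∈ W)
    (hW : ∀ G ∈ W, G.n = 1) : IsAutWeighted W (Finsupp.single (point s) 1) := by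
  classical
  refine isAutWeighted_iff.2 ⟨fun G hG => ?_, fun G => ?_, fun G hG => ?_⟩
  · rw [Finsupp.support_single _ one_ne_zero, mem_singleton] at hG
    rwa [hG]
  · rw [Finsupp.single_apply]
    split_ifs <;> norm_num
  · rw [isoCount_single, one_mul]
    have hn := hW G hG
    have hm := m_eq_zero_of_n_eq_one hn
    have hs : Subsingleton (Iso G (point s)) := by
      refine ⟨fun φ ψ => Iso.ext (fun v => Fin.ext ?_) fun a => (hm ▸ a).elim0⟩
      have h1 := (φ.onV v).2
      have h2 := (ψ.onV v).2
      simp only [point] at h1 h2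
      omega
    have hne : Nonempty (Iso G (point s)) :=
      ⟨{ onV := finCongr hn
         onE := finCongr hm
         inc_map := fun a => (hm ▸ a).elim0
         ext_map := fun x => Fin.ext (by
          have h1 := (finCongr hn (G.ext x)).2
          have h2 := ((point s).ext x).2
          simp only [point] at h1 h2 ⊢
          omega) }⟩
    exact_mod_cast Nat.card_unique

theorem isAutWeighted_zero {W : Set (ExtGraph s)} (hW : ∀ G, G ∉ W) :
    IsAutWeighted W (0 : ExtGraph s →₀ ℚ) :=
  isAutWeighted_iff.2 ⟨fun G hG => by simp at hG, fun G => le_rfl, fun G hG => absurd hG (hW G)⟩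

/-- The quotient is a single vertex without edges, so the fibre is all of `G`. -/
theorem Contraction.biconnected_of_n_eq {G : ExtGraph s} {G' : ExtGraph 0} {G'' : ExtGraph s}
    (d : Contraction G G' G'') (hG' : G'.Biconnected) (hn : G'.n = G.n) : G.Biconnected := by
  have h1 := d.n_add_one
  have h2 := m_eq_zero_of_n_eq_one (G := G'') (by omega)
  have h3 := d.m_eq
  have h4 : d.fibreV = univ := by
    rw [← card_eq_iff_eq_univ, d.card_fibreV, hn, Fintype.card_fin]
  have h5 : d.fibreE = univ := by
    rw [← card_eq_iff_eq_univ, d.card_fibreE, Fintype.card_fin]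
    omega
  have := (d.isBlock hG').1
  rwa [h4, h5] at this

section Recursion

variable {b : (t : ℕ) → ℕ → ℕ → (ExtGraph t →₀ ℚ)} {P₀ : ExtGraph 0 → Prop} {P : ExtGraph s → Prop}

/-- The step of the recursion, for the graphs with a property `P` that can be read off in the
fibre and the quotient of every contraction of a block. -/
theorem isAutWeighted_betaEdge_step {n k : ℕ} (hn : 2 ≤ n) (hk : 1 ≤ k)
    (hP₀iso : ∀ G H : ExtGraph 0, Iso G H → P₀ G → P₀ H)
    (hPiso : ∀ G H : ExtGraph s, Iso G H → P G → P H)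
    (hP : ∀ (G : ExtGraph s) (G' : ExtGraph 0) (G'' : ExtGraph s), Contraction G G' G'' →
      G.Connected → G'.Biconnected → (P G ↔ P₀ G' ∧ P G''))
    (h0 : ∀ n k, 2 ≤ n → 1 ≤ k → IsAutWeighted {G | G ∈ WBiconn n k 0 ∧ P₀ G} (b 0 n k))
    (hs : IsAutWeighted {G | G ∈ WBiconn n k s ∧ P G} (b s n k))
    (ih : ∀ n' < n, ∀ k, 1 ≤ n' →
      IsAutWeighted {G | G ∈ WTwoEdge n' k s ∧ P G} (betaEdge b s n' k)) :
    IsAutWeighted {G | G ∈ WTwoEdge n k s ∧ P G} (betaEdge b s n k) := by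
  classical
  have hpos : (0 : ℚ) < (k : ℚ) + n - 1 := by
    have : (2 : ℚ) ≤ n := by exact_mod_cast hn
    have : (1 : ℚ) ≤ k := by exact_mod_cast hk
    linarith
  rw [betaEdge_eq b s n k hn hk]
  refine isAutWeighted_iff.2 ⟨?_, fun G => ?_, fun G hG => ?_⟩
  · refine fun G hG => (Finsupp.mem_supported (M := ℚ) ℚ _).1
      (?_ : _ ∈ Finsupp.supported ℚ ℚ {G | G ∈ WTwoEdge n k s ∧ P G}) hG
    clear hG G
    refine Submodule.add_mem _ ?_ (Submodule.smul_mem _ _ (Submodule.sum_mem _ fun k' hk' =>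
      Submodule.sum_mem _ fun n' hn' => Submodule.sum_mem _ fun i _ =>
      Submodule.smul_mem _ _ (r_mem_supported ?_)))
    · rw [Finsupp.mem_supported]
      intro G hG
      obtain ⟨⟨h1, h2, h3⟩, h4⟩ := hs.1 G hG
      exact ⟨⟨h1, h2, h3.twoEdgeConnected (by omega)⟩, h4⟩
    · intro G' hG' G'' hG'' i f g
      rw [mem_Icc] at hk' hn'
      obtain ⟨⟨h1, h2, h3⟩, h4⟩ := (h0 n' k' hn'.1 hk'.1).1 G' hG'
      obtain ⟨⟨h5, h6, h7⟩, h8⟩ := (ih (n - n' + 1) (by omega) (k - k') (by omega)).1 G'' hG''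
      let d := glueContraction f g h7.1
      have hc : (glue G'' G' i f g).TwoEdgeConnected :=
        d.twoEdgeConnected_iff.2 ⟨h3.twoEdgeConnected (by omega), h7⟩
      refine ⟨⟨?_, ?_, hc⟩, (hP _ _ _ d hc.1 h3).2 ⟨h4, h8⟩⟩
      · have := d.n_add_one
        omega
      · rw [d.cyclomaticNumber_add hc.1]
        omega
  · rw [Finsupp.add_apply, Finsupp.smul_apply, Finsupp.finsetSum_apply]
    refine add_nonneg (hs.2.1 G) (mul_nonneg (by positivity) (sum_nonneg fun k' hk' => ?_))
    rw [Finsupp.finsetSum_apply]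
    refine sum_nonneg fun n' hn' => ?_
    rw [Finsupp.finsetSum_apply]
    refine sum_nonneg fun i _ => ?_
    rw [mem_Icc] at hk' hn'
    have h2 : (2 : ℚ) ≤ n' := by exact_mod_cast hn'.1
    have h3 : (0 : ℚ) ≤ k' := by positivity
    exact mul_nonneg (by linarith) (r_nonneg (h0 n' k' hn'.1 hk'.1).2.1
      (ih (n - n' + 1) (by omega) (k - k') (by omega)).2.1 G)
  · obtain ⟨⟨hGn, hGk, hG2⟩, hGP⟩ := hG
    obtain ⟨D⟩ := hG2.1.exists_blockContractions
    -- Each block is seen only at its own parameters, with weight `k' + n' - 1`, its number of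
    -- edges; the parameters of its quotient then match automatically.
    have hterm : ∀ k' ∈ Icc 1 (k - 1), ∀ n' ∈ Icc 2 (n - 1),
        ∑ i ∈ range (n - n' + 1), isoCount G (((k' : ℚ) + n' - 1) •
          r i (b 0 n' k') (betaEdge b s (n - n' + 1) (k - k')))
        = ∑ B, if (D.fibre B).cyclomaticNumber = k' then
            (if (D.fibre B).n = n' then ((D.fibre B).m : ℚ) else 0) else 0 := by
      intro k' hk' n' hn'
      rw [mem_Icc] at hk' hn'
      have w0 := h0 n' k' hn'.1 hk'.1
      have w1 := ih (n - n' + 1) (by omega) (k - k') (by omega)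
      simp only [map_smul, smul_eq_mul]
      rw [← mul_sum, D.sum_isoCount_r (fun G' h => (w0.1 G' h).1.2.2)
        (fun G'' h => ⟨(w1.1 G'' h).1.1, (w1.1 G'' h).1.2.2.1⟩), mul_sum]
      refine sum_congr rfl fun B _ => ?_
      rw [w0.isoCount_eq_ite (fun _ _ φ h => ⟨φ.wBiconn h.1, hP₀iso _ _ φ h.2⟩),
        w1.isoCount_eq_ite (fun _ _ φ h => ⟨φ.wTwoEdge h.1, hPiso _ _ φ h.2⟩)]
      have hb := D.biconnected B
      have hp := (hP _ _ _ (D.contr B) hG2.1 hb).1 hGP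
      have ht := (D.contr B).twoEdgeConnected_iff.1 hG2
      have e1 := (D.contr B).n_add_one
      have e2 := (D.contr B).cyclomaticNumber_add hG2.1
      have e3 := hb.connected.cyclomaticNumber_add
      have i1 : D.fibre B ∈ {G | G ∈ WBiconn n' k' 0 ∧ P₀ G} ↔
          (D.fibre B).cyclomaticNumber = k' ∧ (D.fibre B).n = n' :=
        ⟨fun h => ⟨h.1.2.1, h.1.1⟩, fun h => ⟨⟨h.2, h.1, hb⟩, hp.1⟩⟩
      by_cases hk2 : (D.fibre B).cyclomaticNumber = k'
      · by_cases hn2 : (D.fibre B).n = n'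
        · rw [if_pos (i1.2 ⟨hk2, hn2⟩), if_pos ⟨⟨by omega, by omega, ht.2⟩, hp.2⟩, if_pos hk2,
            if_pos hn2, ← hk2, ← hn2, mul_one, mul_one]
          have : (((D.fibre B).cyclomaticNumber + (D.fibre B).n : ℕ) : ℚ)
              = ((D.fibre B).m + 1 : ℕ) := by rw [e3]
          push_cast at this
          linarith
        · rw [if_neg fun h => hn2 (i1.1 h).2, if_pos hk2, if_neg hn2, zero_mul, mul_zero]
      · rw [if_neg fun h => hk2 (i1.1 h).1, if_neg hk2, zero_mul, mul_zero]
    simp only [map_add, map_smul, map_sum, smul_eq_mul]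
    simp only [map_smul, smul_eq_mul] at hterm
    rw [sum_congr rfl fun k' hk' => sum_congr rfl (hterm k' hk'),
      sum_congr rfl (fun k' _ => sum_comm), sum_comm,
      hs.isoCount_eq_ite (fun _ _ φ h => ⟨φ.wBiconn h.1, hPiso _ _ φ h.2⟩)]
    have hm : (k : ℚ) + n - 1 = G.m := by
      have := hG2.1.cyclomaticNumber_add
      rw [hGk, hGn] at this
      have : ((k + n : ℕ) : ℚ) = (G.m + 1 : ℕ) := by rw [this]
      push_cast at this
      linarith
    by_cases hbi : G.Biconnected
    -- The only block of a biconnected `G` has `n` vertices, one more than the sum allows.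
    · rw [if_pos ⟨⟨hGn, hGk, hbi⟩, hGP⟩, sum_eq_zero, mul_zero, add_zero]
      intro B _
      refine sum_eq_zero fun k' _ => sum_eq_zero fun n' hn' => ?_
      rw [mem_Icc] at hn'
      have h1 := (B.2.2 _ _ hbi (subset_univ _) (subset_univ _)).1
      have h2 := (D.contr B).card_fibreV
      rw [D.fibreV_eq, ← h1, card_univ, Fintype.card_fin] at h2
      have h3 : ¬ (D.fibre B).n = n' := by omega
      rw [if_neg h3, ite_self]
    · rw [if_neg fun h => hbi h.1.2.2, zero_add]
      have hsum : ∀ B ∈ (univ : Finset G.Block), (∑ k' ∈ Icc 1 (k - 1), ∑ n' ∈ Icc 2 (n - 1),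
          if (D.fibre B).cyclomaticNumber = k' then
            (if (D.fibre B).n = n' then ((D.fibre B).m : ℚ) else 0) else 0)
          = ((D.fibre B).m : ℚ) := by
        intro B _
        have hb := D.biconnected B
        have ht := (D.contr B).twoEdgeConnected_iff.1 hG2
        have e1 := (D.contr B).n_add_one
        have e2 := (D.contr B).cyclomaticNumber_add hG2.1
        -- Hence the quotient has at least two vertices and, being 2-edge-connected, positive
        -- cyclomatic number. This puts the parameters of the block within the range of summation.
        have e4 : (D.fibre B).n ≠ G.n := fun h => hbi ((D.contr B).biconnected_of_n_eq hb h)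
        have e5 := hb.two_le
        have e6 := (D.quot B).pos
        have e7 := ht.1.one_le_cyclomaticNumber e5
        have e8 := ht.2.one_le_cyclomaticNumber (by omega)
        rw [sum_eq_single (D.fibre B).cyclomaticNumber, sum_eq_single (D.fibre B).n]
        · simp
        · intro n' _ h
          simp [h.symm]
        · intro h
          exact absurd (mem_Icc.2 ⟨e5, by omega⟩) h
        · intro k' _ h
          simp [h.symm]
        · intro h
          exact absurd (mem_Icc.2 ⟨e7, by omega⟩) h
      rw [sum_congr rfl hsum, ← Nat.cast_sum, D.sum_m, ← hm]
      field_simp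

theorem isAutWeighted_betaEdge_of
    (hP₀iso : ∀ G H : ExtGraph 0, Iso G H → P₀ G → P₀ H)
    (hPiso : ∀ G H : ExtGraph s, Iso G H → P G → P H)
    (hP : ∀ (G : ExtGraph s) (G' : ExtGraph 0) (G'' : ExtGraph s), Contraction G G' G'' →
      G.Connected → G'.Biconnected → (P G ↔ P₀ G' ∧ P G''))
    (hP1 : P (point s))
    (h0 : ∀ n k, 2 ≤ n → 1 ≤ k → IsAutWeighted {G | G ∈ WBiconn n k 0 ∧ P₀ G} (b 0 n k))
    (hs : ∀ n k, 2 ≤ n → 1 ≤ k → IsAutWeighted {G | G ∈ WBiconn n k s ∧ P G} (b s n k)) :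
    ∀ n k, 1 ≤ n → IsAutWeighted {G | G ∈ WTwoEdge n k s ∧ P G} (betaEdge b s n k) := by
  intro n
  induction n using Nat.strong_induction_on with
  | _ n ih =>
  intro k hn
  rcases Nat.lt_or_ge n 2 with h2 | h2
  · obtain rfl : n = 1 := by omega
    have hW : ∀ G ∈ WTwoEdge 1 k s, k = 0 := by
      rintro G ⟨h1, h2, h3⟩
      have := h3.1.cyclomaticNumber_add
      rw [m_eq_zero_of_n_eq_one h1] at this
      omega
    rcases k with _ | k
    · rw [betaEdge]
      have hc : (point s).Connected := connected_of_n_eq_one rfl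
      refine isAutWeighted_single_point ⟨⟨rfl, ?_, hc, fun a => a.elim0⟩, hP1⟩ fun G h => h.1.1
      have := hc.cyclomaticNumber_add
      simp only [point] at this ⊢
      omega
    · rw [betaEdge]
      exact isAutWeighted_zero fun G h => absurd (hW G h.1) (by omega)
  · rcases k with _ | k
    · obtain ⟨n, rfl⟩ := Nat.exists_eq_add_of_le' h2
      rw [betaEdge]
      refine isAutWeighted_zero fun G h => ?_
      have := h.1.2.2.one_le_cyclomaticNumber (by rw [h.1.1]; exact h2)
      rw [h.1.2.1] at this
      omega
    · exact isAutWeighted_betaEdge_step h2 (by omega) hP₀iso hPiso hP h0 (hs n _ h2 (by omega)) ih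

end Recursion

theorem isAutWeighted_betaEdge {b : (t : ℕ) → ℕ → ℕ → (ExtGraph t →₀ ℚ)}
    (h : ∀ t n k : ℕ, 2 ≤ n → 1 ≤ k → IsAutWeighted (WBiconn n k t) (b t n k)) (s n k : ℕ)
    (hn : 1 ≤ n) : IsAutWeighted (WTwoEdge n k s) (betaEdge b s n k) := by
  have := isAutWeighted_betaEdge_of (s := s) (b := b) (P₀ := fun _ => True) (P := fun _ => True)
    (fun _ _ _ h => h) (fun _ _ _ h => h) (fun _ _ _ _ _ _ => by simp) trivial
    (by simpa using h 0) (by simpa using h s) n k hn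
  simpa using this

/-! ### Graphs all of whose blocks are cycles -/

/-- Every biconnected component is a cycle. -/
def AllBlocksCycles (G : ExtGraph s) : Prop := ∀ U A, G.IsBlock U A → G.IsCycleOn U A

theorem Iso.allBlocksCycles {G H : ExtGraph s} (φ : Iso G H) (h : G.AllBlocksCycles) :
    H.AllBlocksCycles := fun _ _ hB =>
  (isCycleOn_image φ.symm.onV.injective φ.symm.onE.injective fun a _ => φ.symm.inc_map a).1
    (h _ _ (φ.symm.isBlock hB))

theorem Biconnected.eq_univ_of_isBlock {G : ExtGraph s} (hG : G.Biconnected)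
    {U : Finset (Fin G.n)} {A : Finset (Fin G.m)} (h : G.IsBlock U A) : U = univ ∧ A = univ := by
  have := h.2 _ _ hG (subset_univ _) (subset_univ _)
  exact ⟨this.1.symm, this.2.symm⟩

theorem Biconnected.isBlock_univ {G : ExtGraph s} (hG : G.Biconnected) : G.IsBlock univ univ :=
  ⟨hG, fun _ _ _ h1 h2 => ⟨univ_subset_iff.1 h1, univ_subset_iff.1 h2⟩⟩

namespace Contraction

variable {G : ExtGraph s} {G' : ExtGraph 0} {G'' : ExtGraph s}

/-- The blocks of the quotient are blocks of the graph. -/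
theorem exists_lift (d : Contraction G G' G'') (hG : G''.Connected) {U : Finset (Fin G''.n)}
    {A : Finset (Fin G''.m)} (hB : G''.IsBlock U A) :
    ∃ h : Fin G''.n → Fin G.n, Function.Injective h ∧
      (∀ a ∈ A, G.inc (d.e (.inl a)) = (G''.inc a).map h) ∧
      G.IsBlock (U.image h) (A.image fun a => d.e (.inl a)) := by
  classical
  have hp : ∃ p, d.q p = d.i ∧
      ∀ a ∈ A, ∀ v w, G.inc (d.e (.inl a)) = s(v, w) → d.q v = d.i → v = p := by
    by_cases hi : d.i ∈ U
    · obtain ⟨f, g, hfg⟩ := d.exists_attaches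
      exact ⟨d.j (f ⟨(U, A), hB, hi⟩), d.q_j _,
        -- Lifting `i` to the vertex at which the block is attached makes the section `h` below
        -- respect the edges of the block.
        fun a ha v w h hv => (hfg.1 ⟨(U, A), hB, hi⟩ a ha v w h hv).symm⟩
    · refine ⟨d.j ⟨0, G'.pos⟩, d.q_j _, fun a ha v w h hv => absurd ?_ hi⟩
      have h'' : G''.inc a = s(d.q v, d.q w) := by rw [d.inc_inl, h]; rfl
      rw [← hv]
      exact hB.1.left_mem ha h''
  obtain ⟨p, hpi, hp⟩ := hp
  choose σ hσ using d.q_surj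
  let h : Fin G''.n → Fin G.n := fun x => if x = d.i then p else σ x
  have hq : ∀ x, d.q (h x) = x := by
    intro x
    by_cases hx : x = d.i
    · simp only [h, hx, if_true, hpi]
    · simp only [h, hx, if_false, hσ]
  have hinj : Function.Injective h := Function.LeftInverse.injective hq
  have hinc : ∀ a ∈ A, G.inc (d.e (.inl a)) = (G''.inc a).map h := by
    intro a ha
    have key : ∀ v w, G.inc (d.e (.inl a)) = s(v, w) → h (d.q v) = v := by
      intro v w hi
      by_cases hv : d.q v = d.i
      · simp only [h, hv, if_true]
        exact (hp a ha v w hi hv).symm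
      · simp only [h, hv, if_false]
        exact (d.q_inj v _ (hσ _).symm hv).symm
    obtain ⟨v, w, hi⟩ := G.exists_inc (d.e (.inl a))
    rw [d.inc_inl, hi, Sym2.map_mk, Sym2.map_mk, key v w hi, key w v (hi.trans Sym2.eq_swap)]
  refine ⟨h, hinj, hinc, ?_⟩
  obtain ⟨ρ, h1, h2, h3⟩ := hB.exists_retraction hG
  -- The retraction in the quotient, composed with `q` and the section, is constant along fibre
  -- edges because `q` collapses them.
  refine BiconnOn.isBlock_of_retraction ((biconnOn_image hinj hinc).2 hB.1)
    (fun v => h (ρ (d.q v))) (fun v => mem_image_of_mem _ (h1 _)) ?_ ?_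
  · intro v hv
    obtain ⟨x, hx, rfl⟩ := mem_image.1 hv
    simp only [hq, h2 x hx]
  · intro a ha x y hi
    obtain ⟨a | b, rfl⟩ := d.e.surjective a
    · have haA : a ∉ A := fun h => ha (mem_image_of_mem _ h)
      have h'' : G''.inc a = s(d.q x, d.q y) := by rw [d.inc_inl, hi]; rfl
      simp only [h3 a haA _ _ h'']
    · rw [d.inc_inr] at hi
      obtain ⟨z, w, hzw⟩ := G'.exists_inc b
      rw [hzw, Sym2.map_mk, Sym2.eq_iff] at hi
      rcases hi with ⟨rfl, rfl⟩ | ⟨rfl, rfl⟩ <;> simp only [q_j]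

/-- The blocks of `G` are the fibre and the lifts of the blocks of the quotient: any block is
identified through one of its edges. -/
theorem allBlocksCycles_iff (d : Contraction G G' G'') (hG : G.Connected) (hG' : G'.Biconnected) :
    G.AllBlocksCycles ↔ G'.AllBlocksCycles ∧ G''.AllBlocksCycles := by
  have hG'' := (d.connected_iff.1 hG).2
  have hinl : Function.Injective fun a => d.e (.inl a) := d.e.injective.comp Sum.inl_injective
  have hinr : Function.Injective fun a => d.e (.inr a) := d.e.injective.comp Sum.inr_injective
  have hfib : G.IsCycleOn d.fibreV d.fibreE ↔ G'.IsCycleOn univ univ :=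
    isCycleOn_image d.j_inj hinr fun b _ => d.inc_inr b
  constructor
  · intro h
    refine ⟨fun U A hB => ?_, fun U A hB => ?_⟩
    · obtain ⟨rfl, rfl⟩ := hG'.eq_univ_of_isBlock hB
      exact hfib.1 (h _ _ (d.isBlock hG'))
    · obtain ⟨f, hf, hinc, hB'⟩ := d.exists_lift hG'' hB
      exact (isCycleOn_image hf hinl hinc).1 (h _ _ hB')
  · rintro ⟨h1, h2⟩ U A hB
    obtain ⟨v, hv⟩ := card_pos.1 (Nat.lt_of_lt_of_le Nat.two_pos hB.1.2.1)
    obtain ⟨a, ha, -⟩ := hB.1.exists_edge hv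
    obtain ⟨a | b, rfl⟩ := d.e.surjective a
    · obtain ⟨U', A', hB', ha'⟩ := G''.exists_isBlock_mem a
      obtain ⟨f, hf, hinc, hB''⟩ := d.exists_lift hG'' hB'
      obtain ⟨rfl, rfl⟩ := hB.eq_of_mem hB'' ha (mem_image_of_mem _ ha')
      exact (isCycleOn_image hf hinl hinc).2 (h2 _ _ hB')
    · obtain ⟨rfl, rfl⟩ := hB.eq_of_mem (d.isBlock hG') ha (d.inr_mem_fibreE b)
      exact hfib.2 (h1 _ _ hG'.isBlock_univ)

end Contraction

/-! ### Degrees -/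

theorem sum_degrees (G : ExtGraph s) :
    ∑ v, (univ.filter fun a => v ∈ G.inc a).card = 2 * G.m := by
  simp only [card_filter]
  rw [sum_comm]
  have : ∀ a, (∑ v, if v ∈ G.inc a then 1 else 0) = 2 := fun a => by
    obtain ⟨x, y, hi⟩ := G.exists_inc a
    rw [sum_ends hi fun _ => 1]
  simp [this, mul_comm]

/-- Otherwise `v` is isolated already or after its only edge is erased. -/
theorem TwoEdgeConnected.two_le_degree {G : ExtGraph s} (h : G.TwoEdgeConnected) (hn : 2 ≤ G.n)
    (v : Fin G.n) : 2 ≤ (univ.filter fun a => v ∈ G.inc a).card := by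
  have : Nontrivial (Fin G.n) := Fin.nontrivial_iff_two_le.2 hn
  obtain ⟨t, ht⟩ := exists_ne v
  by_contra hlt
  have hle : ∀ a b, v ∈ G.inc a → v ∈ G.inc b → a = b := by
    have := card_le_one.1 (Nat.le_of_lt_succ (not_le.1 hlt))
    intro a b ha hb
    exact this a (by simpa using ha) b (by simpa using hb)
  have key : ∀ A : Finset (Fin G.m), (∀ a ∈ A, v ∉ G.inc a) → ¬ G.ConnOn univ A := by
    intro A hA hc
    have := hc.color (fun w => w = v) (by
      intro a ha x _ y _ hi
      have h1 : x ≠ v := by rintro rfl; exact hA a ha (by rw [hi]; exact Sym2.mem_mk_left _ _)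
      have h2 : y ≠ v := by rintro rfl; exact hA a ha (by rw [hi]; exact Sym2.mem_mk_right _ _)
      simp [h1, h2]) v (mem_univ _) t (mem_univ _)
    exact ht (this.mp rfl)
  by_cases hex : ∃ a, v ∈ G.inc a
  · obtain ⟨a, ha⟩ := hex
    refine key (univ.erase a) (fun b hb hv => ?_) (h.2 a)
    exact (mem_erase.1 hb).1 (hle b a hv ha)
  · exact key univ (fun a _ ha => hex ⟨a, ha⟩) h.1

/-- Cyclomatic number one means as many edges as vertices, so the degrees have average two; none is
smaller. -/
theorem Biconnected.degree_eq_two {G : ExtGraph s} (h : G.Biconnected)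
    (hk : G.cyclomaticNumber = 1) (v : Fin G.n) :
    (univ.filter fun a => v ∈ G.inc a).card = 2 := by
  have h2 := h.twoEdgeConnected hk.ge
  have hm := h.connected.cyclomaticNumber_add
  have hsum := G.sum_degrees
  have := (sum_eq_sum_iff_of_le (f := fun _ => 2)
    (fun v (_ : v ∈ univ) => h2.two_le_degree h.two_le v)).1 (by
      rw [hsum, sum_const, card_univ, Fintype.card_fin, smul_eq_mul]
      omega) v (mem_univ v)
  exact this.symm

theorem Biconnected.allBlocksCycles_iff {G : ExtGraph s} (h : G.Biconnected) :
    G.AllBlocksCycles ↔ G.cyclomaticNumber = 1 := by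
  have hm := h.connected.cyclomaticNumber_add
  constructor
  · intro hc
    have hs := G.sum_degrees
    have := (hc _ _ h.isBlock_univ).2.2.2
    rw [sum_congr rfl this, sum_const, card_univ, Fintype.card_fin, smul_eq_mul] at hs
    omega
  · intro hk U A hB
    obtain ⟨rfl, rfl⟩ := h.eq_univ_of_isBlock hB
    exact ⟨fun _ _ _ _ => mem_univ _, ⟨⟨0, G.pos⟩, mem_univ _⟩, h.connected,
      fun v _ => h.degree_eq_two hk v⟩

/-! ### Cycles -/

theorem cycleGraph_biconnected (n : ℕ) (hn : 2 ≤ n) : (cycleGraph n hn).Biconnected := by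
  have hn0 : 0 < n := by omega
  refine ⟨fun _ _ _ _ => mem_univ _, by rw [card_univ, Fintype.card_fin]; exact hn,
    connOn_of_color fun c hc => ?_, fun z _ => connOn_of_color fun c hc => ?_⟩
  · have h : ∀ j (hj : j < n), c (⟨j, hj⟩ : Fin n) = c (⟨0, hn0⟩ : Fin n) := by
      intro j
      induction j with
      | zero => intro _; rfl
      | succ j ih =>
        intro hj
        rw [← ih (by omega)]
        refine (hc (⟨j, by omega⟩ : Fin n) (mem_univ _) (⟨j, by omega⟩ : Fin n) (mem_univ _)
          (⟨j + 1, hj⟩ : Fin n) (mem_univ _) ?_).symm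
        simp only [cycleGraph, Nat.mod_eq_of_lt hj]
    intro u _ v _
    exact (h u.1 u.2).trans (h v.1 v.2).symm
  · have hz : z.1 < n := z.2
    have hlt : ∀ j, j % n < n := fun j => Nat.mod_lt _ hn0
    -- Without `z` the cycle is the path `z + 1, …, z + n - 1` modulo `n`; the bound on `t` stops
    -- before returning to `z`.
    have h : ∀ t, t + 1 < n → c (⟨(z.1 + 1 + t) % n, hlt _⟩ : Fin n)
        = c (⟨(z.1 + 1) % n, hlt _⟩ : Fin n) := by
      intro t
      induction t with
      | zero => intro _; rfl
      | succ t ih =>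
        intro ht
        rw [← ih (by omega)]
        have hne : ∀ t, t + 1 < n → (⟨(z.1 + 1 + t) % n, hlt _⟩ : Fin n) ≠ z := by
          intro t ht h
          have h := congrArg Fin.val h
          simp only at h
          rcases Nat.lt_or_ge (z.1 + 1 + t) n with h1 | h1
          · rw [Nat.mod_eq_of_lt h1] at h
            omega
          · rw [Nat.mod_eq_sub_mod h1, Nat.mod_eq_of_lt (by omega)] at h
            omega
        refine (hc (⟨(z.1 + 1 + t) % n, hlt _⟩ : Fin n) (mem_univ _) _
          (mem_erase.2 ⟨hne t (by omega), mem_univ _⟩) _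
          (mem_erase.2 ⟨hne (t + 1) ht, mem_univ _⟩) ?_).symm
        simp only [cycleGraph, Nat.mod_add_mod]
        rfl
    have h' : ∀ u ∈ univ.erase z, c u = c (⟨(z.1 + 1) % n, hlt _⟩ : Fin n) := by
      intro u hu
      have hu' : u.1 ≠ z.1 := fun h => (mem_erase.1 hu).1 (Fin.ext h)
      have hun : u.1 < n := u.2
      rcases Nat.lt_or_ge z.1 u.1 with h1 | h1
      · rw [← h (u.1 - z.1 - 1) (by omega)]
        congr 1
        refine Fin.ext ?_
        simp only
        rw [(by omega : z.1 + 1 + (u.1 - z.1 - 1) = u.1), Nat.mod_eq_of_lt hun]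
      · rw [← h (u.1 + n - z.1 - 1) (by omega)]
        congr 1
        refine Fin.ext ?_
        simp only
        rw [(by omega : z.1 + 1 + (u.1 + n - z.1 - 1) = u.1 + n), Nat.add_mod_right,
          Nat.mod_eq_of_lt hun]
    intro u hu v hv
    rw [h' u hu, h' v hv]

theorem cycleGraph_mem_wBiconn (n : ℕ) (hn : 2 ≤ n) : cycleGraph n hn ∈ WBiconn n 1 0 := by
  have h := cycleGraph_biconnected n hn
  have := h.connected.cyclomaticNumber_add
  refine ⟨rfl, ?_, h⟩
  simp only [cycleGraph] at this ⊢
  omega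

/-! ### The isomorphisms from a cycle -/

/-- A map with fibres of order two has a fixed-point free involution that exchanges the two points
of every fibre. -/
theorem exists_fibre_involution {F B : Type*} {π : F → B}
    (h : ∀ x, ∃ y, y ≠ x ∧ π y = π x ∧ ∀ z, π z = π x → z = x ∨ z = y) :
    ∃ R : Equiv.Perm F, (∀ x, π (R x) = π x) ∧ (∀ x, R x ≠ x) ∧ (∀ x, R (R x) = x) ∧
      ∀ x z, π z = π x → z = x ∨ z = R x := by
  choose R h1 h2 h3 using h
  have hRR : ∀ x, R (R x) = x := fun x =>
    (h3 x _ ((h2 _).trans (h2 x))).resolve_right (h1 (R x))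
  exact ⟨⟨R, R, hRR, hRR⟩, h2, h1, hRR, h3⟩

/-- In the dihedral group generated by two fixed-point free involutions, no rotation agrees with a
reflection at any point. -/
theorem pow_apply_ne_of_involutions {F : Type*} {R S : Equiv.Perm F} (hR : ∀ x, R x ≠ x)
    (hS : ∀ x, S x ≠ x) (hRR : ∀ x, R (R x) = x) (hSS : ∀ x, S (S x) = x) (k : ℕ) (x : F) :
    ((R * S) ^ k) x ≠ R x := by
  intro h
  have hsemi : SemiconjBy R (R * S) (R * S)⁻¹ := by
    have h1 : R * R = 1 := Equiv.ext hRR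
    have h2 : S * S = 1 := Equiv.ext hSS
    unfold SemiconjBy
    rw [eq_inv_mul_iff_mul_eq]
    calc R * S * (R * (R * S)) = R * S * ((R * R) * S) := by group
      _ = R * (S * S) := by rw [h1, one_mul, mul_assoc]
      _ = R := by rw [h2, mul_one]
  have hpow : ∀ c : ℕ, R (((R * S) ^ c) x) = (((R * S)⁻¹) ^ c) (R x) := fun c =>
    congrArg (fun σ : Equiv.Perm F => σ x) (hsemi.pow_right c)
  have hcancel : ∀ c : ℕ, ∀ y, (((R * S)⁻¹) ^ c) (((R * S) ^ c) y) = y := fun c y => by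
    rw [← Equiv.Perm.mul_apply, inv_pow, inv_mul_cancel]
    rfl
  -- If `(R * S) ^ k` agrees with `R` at `x`, then `(R * S) ^ c` moves `x` to a fixed point of `R`
  -- when `k = 2c`, and of `S` when `k = 2c + 1`.
  obtain ⟨c, rfl | rfl⟩ := Nat.even_or_odd' k
  · apply hR (((R * S) ^ c) x)
    rw [hpow, ← h, two_mul, pow_add, Equiv.Perm.mul_apply, hcancel]
  · apply hS (((R * S) ^ c) x)
    apply R.injective
    have : 2 * c + 1 = c + (1 + c) := by omega
    rw [hpow, ← h, this, pow_add, Equiv.Perm.mul_apply, hcancel, pow_add, pow_one]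
    rfl

/-- A vertex with an edge attached to it. -/
abbrev Flag (G : ExtGraph s) : Type := {p : Fin G.n × Fin G.m // p.1 ∈ G.inc p.2}

theorem card_flag {G : ExtGraph s} (hdeg : ∀ v, (univ.filter fun a => v ∈ G.inc a).card = 2) :
    Nat.card G.Flag = 2 * G.n := by
  have : Nat.card G.Flag = Nat.card (Σ v, {a // v ∈ G.inc a}) :=
    Nat.card_congr ⟨fun p => ⟨p.1.1, p.1.2, p.2⟩, fun p => ⟨(p.1, p.2.1), p.2.2⟩,
      fun _ => rfl, fun _ => rfl⟩
  rw [this, Nat.card_sigma]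
  have h : ∀ v, Nat.card {a // v ∈ G.inc a} = 2 := fun v => by
    rw [Nat.card_eq_fintype_card, Fintype.card_subtype, hdeg v]
  rw [sum_congr rfl fun v _ => h v, sum_const, card_univ, Fintype.card_fin, smul_eq_mul, mul_comm]

theorem exists_edge_involution {G : ExtGraph s}
    (hdeg : ∀ v, (univ.filter fun a => v ∈ G.inc a).card = 2) :
    ∃ R : Equiv.Perm G.Flag, (∀ x, (R x).1.1 = x.1.1) ∧ (∀ x, R x ≠ x) ∧ (∀ x, R (R x) = x) ∧
      ∀ x z : G.Flag, z.1.1 = x.1.1 → z = x ∨ z = R x := by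
  refine exists_fibre_involution (π := fun x : G.Flag => x.1.1) ?_
  rintro ⟨⟨v, a⟩, hv⟩
  have hmem : a ∈ univ.filter fun a => v ∈ G.inc a := by simpa using hv
  obtain ⟨b, hb, hba⟩ := exists_mem_ne (hdeg v).ge a
  have hb' : v ∈ G.inc b := by simpa using hb
  refine ⟨⟨(v, b), hb'⟩, by simpa using hba, rfl, ?_⟩
  rintro ⟨⟨w, c⟩, hc⟩ (rfl : w = v)
  have hpair : univ.filter (fun a => w ∈ G.inc a) = {a, b} :=
    (eq_of_subset_of_card_le (by
      intro x hx
      rcases mem_insert.1 hx with rfl | hx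
      · exact hmem
      · rw [mem_singleton.1 hx]; exact hb) (by rw [hdeg w, card_pair hba.symm])).symm
  have hcm : c ∈ univ.filter fun a => w ∈ G.inc a := by simpa using hc
  rw [hpair, mem_insert, mem_singleton] at hcm
  rcases hcm with rfl | rfl
  · exact .inl rfl
  · exact .inr rfl

theorem exists_end_involution (G : ExtGraph s) :
    ∃ S : Equiv.Perm G.Flag, (∀ x, (S x).1.2 = x.1.2) ∧ (∀ x, S x ≠ x) ∧ (∀ x, S (S x) = x) ∧
      ∀ x z : G.Flag, z.1.2 = x.1.2 → z = x ∨ z = S x := by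
  refine exists_fibre_involution (π := fun x : G.Flag => x.1.2) ?_
  rintro ⟨⟨v, a⟩, hv⟩
  obtain ⟨w, hw⟩ := Sym2.mem_iff_exists.1 hv
  have hw : G.inc a = s(v, w) := hw
  have hvw := ne_of_inc hw
  refine ⟨⟨(w, a), by rw [hw]; exact Sym2.mem_mk_right _ _⟩, by simpa using hvw.symm, rfl, ?_⟩
  rintro ⟨⟨u, c⟩, hc⟩ (rfl : c = a)
  have hc : u ∈ G.inc c := hc
  rw [hw, Sym2.mem_iff] at hc
  rcases hc with rfl | rfl
  · exact .inl rfl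
  · exact .inr rfl

theorem Iso.inc_onE_cycleGraph {G : ExtGraph 0} {n : ℕ} {hn : 2 ≤ n}
    (φ : Iso (cycleGraph n hn) G) (a : Fin n) : G.inc (φ.onE a)
    = s(φ.onV a, φ.onV (⟨(a.val + 1) % n, Nat.mod_lt _ (by omega)⟩ : Fin n)) :=
  φ.inc_map a

/-- Walk around the graph from the flag `x₀`: `S` crosses the edge, `R` passes to the other edge at
the vertex reached. The orbit of `R * S` traces out the cycle, also when `n = 2`, since flags
distinguish parallel edges. -/
theorem exists_iso_cycleGraph {G : ExtGraph 0} (hG : G.Connected)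
    (hdeg : ∀ v, (univ.filter fun a => v ∈ G.inc a).card = 2) (hn : 2 ≤ G.n) (x₀ : G.Flag) :
    ∃ φ : Iso (cycleGraph G.n hn) G, φ.onV (⟨0, G.pos⟩ : Fin G.n) = x₀.1.1 ∧
      φ.onE (⟨0, G.pos⟩ : Fin G.n) = x₀.1.2 := by
  obtain ⟨R, hR1, hR2, hR3, hR4⟩ := exists_edge_involution hdeg
  obtain ⟨S, hS1, hS2, hS3, hS4⟩ := G.exists_end_involution
  let x : ℕ → G.Flag := fun j => ((R * S) ^ j) x₀
  have hxadd : ∀ j k, x (j + k) = ((R * S) ^ k) (x j) := fun j k => by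
    simp only [x]
    rw [← Equiv.Perm.mul_apply, ← pow_add, add_comm]
  have hsucc : ∀ j, x (j + 1) = R (S (x j)) := fun j => by rw [hxadd, pow_one]; rfl
  have hRx : ∀ j, S (x j) = R (x (j + 1)) := fun j => by rw [hsucc, hR3]
  have hv1 : ∀ j, (S (x j)).1.1 = (x (j + 1)).1.1 := fun j => by rw [hsucc, hR1]
  have hinc : ∀ j, G.inc (x j).1.2 = s((x j).1.1, (x (j + 1)).1.1) := by
    intro j
    have h1 := (S (x j)).2
    rw [hS1] at h1
    have h2 : (x j).1.1 ≠ (S (x j)).1.1 := fun h => hS2 (x j)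
      (Subtype.ext (Prod.ext h.symm (hS1 _)))
    rw [← hv1]
    exact (Sym2.mem_and_mem_iff h2).1 ⟨(x j).2, h1⟩
  -- The walk never traverses an edge backwards, so each vertex and each edge determines the flag at
  -- which it is visited.
  have hne : ∀ j k, x k ≠ R (x j) := by
    have key : ∀ j k, x (j + k) ≠ R (x j) := fun j k => by
      rw [hxadd]
      exact pow_apply_ne_of_involutions hR2 hS2 hR3 hS3 k (x j)
    intro j k h
    rcases Nat.le_total j k with hjk | hjk
    · obtain ⟨t, rfl⟩ := Nat.exists_eq_add_of_le hjk
      exact key j t h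
    · obtain ⟨t, rfl⟩ := Nat.exists_eq_add_of_le hjk
      exact key k t (by rw [h, hR3])
  have hxV : ∀ j k, (x j).1.1 = (x k).1.1 → x j = x k := fun j k h =>
    (hR4 (x k) (x j) h).resolve_right (hne k j)
  have hxE : ∀ j k, (x j).1.2 = (x k).1.2 → x j = x k := fun j k h =>
    (hS4 (x k) (x j) h).resolve_right fun h => hne (k + 1) j (by rw [h, hRx])
  let p := Function.minimalPeriod (R * S) x₀
  have hxit : ∀ j, x j = (R * S)^[j] x₀ := fun j => by rw [Equiv.Perm.iterate_eq_pow]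
  have hp : 0 < p := Function.minimalPeriod_pos_of_mem_periodicPts
    (Function.Injective.mem_periodicPts (R * S).injective x₀)
  have hmod : ∀ j, x (j % p) = x j := fun j => by
    rw [hxit, hxit, Function.iterate_mod_minimalPeriod_eq]
  have hinjp : ∀ j < p, ∀ k < p, x j = x k → j = k := fun j hj k hk h => by
    rw [hxit, hxit] at h
    exact Function.iterate_injOn_Iio_minimalPeriod (Set.mem_Iio.2 hj) (Set.mem_Iio.2 hk) h
  have hsurj : ∀ v, ∃ j, (x j).1.1 = v := by
    have key : ∀ a v w, G.inc a = s(v, w) → (∃ j, (x j).1.1 = v) → ∃ j, (x j).1.1 = w := by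
      rintro a v w hi ⟨j, hj⟩
      have hva : v ∈ G.inc a := by rw [hi]; exact Sym2.mem_mk_left _ _
      have other : ∀ u, G.inc a = s(v, u) → u = w := fun u hu => by
        rw [hi] at hu
        exact (Sym2.congr_right.1 hu).symm
      rcases hR4 (x j) ⟨(v, a), hva⟩ hj.symm with h | h
      · refine ⟨j + 1, other _ ?_⟩
        rw [← hj, ← hinc j, ← h]
      -- Here `a` is the edge by which the walk arrived, so its other end is the preceding vertex;
      -- adding the period `p` keeps the index a natural number.
      · have h1 : x (j + p - 1 + 1) = x j := by
          rw [← hmod, (by omega : j + p - 1 + 1 = j + p), Nat.add_mod_right, hmod]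
        have h2 : (x (j + p - 1)).1.2 = a := by
          rw [← hS1, hRx, h1, ← h]
        refine ⟨j + p - 1, other _ ?_⟩
        rw [← h2, hinc, h1, hj, Sym2.eq_swap]
    intro v
    have := hG.color (fun v => ∃ j, (x j).1.1 = v) (fun a _ u _ w _ hi =>
      propext ⟨key a u w hi, key a w u (hi.trans Sym2.eq_swap)⟩)
      (x 0).1.1 (mem_univ _) v (mem_univ _)
    exact this.mp ⟨0, rfl⟩
  have hbij : Function.Bijective fun j : Fin p => (x j).1.1 := by
    refine ⟨fun j k h => Fin.ext (hinjp j j.2 k k.2 (hxV _ _ h)), fun v => ?_⟩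
    obtain ⟨j, hj⟩ := hsurj v
    exact ⟨⟨j % p, Nat.mod_lt _ hp⟩, by simpa only [hmod] using hj⟩
  have hpn : p = G.n := by simpa using Fintype.card_of_bijective hbij
  have hm : G.m = G.n := by
    have h := G.sum_degrees
    rw [sum_congr rfl fun v _ => hdeg v, sum_const, card_univ, Fintype.card_fin,
      smul_eq_mul] at h
    omega
  have hbijV : Function.Bijective fun j : Fin G.n => (x j).1.1 := by
    refine (Fintype.bijective_iff_injective_and_card _).2 ⟨fun j k h => ?_, rfl⟩
    exact Fin.ext (hinjp j (by omega) k (by omega) (hxV _ _ h))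
  have hbijE : Function.Bijective fun j : Fin G.n => (x j).1.2 := by
    refine (Fintype.bijective_iff_injective_and_card _).2 ⟨fun j k h => ?_, by simp [hm]⟩
    exact Fin.ext (hinjp j (by omega) k (by omega) (hxE _ _ h))
  refine ⟨⟨Equiv.ofBijective _ hbijV, Equiv.ofBijective _ hbijE, fun a => ?_,
    fun y => y.elim0⟩, rfl, rfl⟩
  have h1 := hmod (a.1 + 1)
  rw [hpn] at h1
  refine (hinc a.1).trans ?_
  rw [← h1]
  rfl

/-- The image of a flag forces the next one: the far end of the edge, then the only other edge
there, since distinct edges have distinct images. -/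
theorem iso_cycleGraph_ext {G : ExtGraph 0}
    (hdeg : ∀ v, (univ.filter fun a => v ∈ G.inc a).card = 2) {n : ℕ} (hn : 2 ≤ n)
    {φ ψ : Iso (cycleGraph n hn) G}
    (hV : φ.onV (⟨0, by omega⟩ : Fin n) = ψ.onV (⟨0, by omega⟩ : Fin n))
    (hE : φ.onE (⟨0, by omega⟩ : Fin n) = ψ.onE (⟨0, by omega⟩ : Fin n)) : φ = ψ := by
  obtain ⟨R, hR1, hR2, hR3, hR4⟩ := exists_edge_involution hdeg
  have hinc : ∀ (χ : Iso (cycleGraph n hn) G) j (hj : j + 1 < n),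
      G.inc (χ.onE (⟨j, by omega⟩ : Fin n))
        = s(χ.onV (⟨j, by omega⟩ : Fin n), χ.onV (⟨j + 1, hj⟩ : Fin n)) := by
    intro χ j hj
    refine (χ.inc_onE_cycleGraph _).trans ?_
    simp only [Nat.mod_eq_of_lt hj]
  have hmem : ∀ (χ : Iso (cycleGraph n hn) G) (a : Fin n), χ.onV a ∈ G.inc (χ.onE a) := by
    intro χ a
    exact (χ.inc_onE_cycleGraph a).symm ▸ Sym2.mem_mk_left _ _
  have key : ∀ j (hj : j < n), φ.onV (⟨j, hj⟩ : Fin n) = ψ.onV (⟨j, hj⟩ : Fin n) ∧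
      φ.onE (⟨j, hj⟩ : Fin n) = ψ.onE (⟨j, hj⟩ : Fin n) := by
    intro j
    induction j with
    | zero => exact fun _ => ⟨hV, hE⟩
    | succ j ih =>
      intro hj
      obtain ⟨h1, h2⟩ := ih (by omega)
      have h3 : φ.onV (⟨j + 1, hj⟩ : Fin n) = ψ.onV (⟨j + 1, hj⟩ : Fin n) := by
        have e1 := hinc φ j hj
        rw [h2, h1, hinc ψ j hj] at e1
        exact (Sym2.congr_right.1 e1).symm
      refine ⟨h3, ?_⟩
      let x : G.Flag := ⟨(φ.onV (⟨j + 1, hj⟩ : Fin n), φ.onE (⟨j, by omega⟩ : Fin n)), by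
        rw [hinc φ j hj]; exact Sym2.mem_mk_right _ _⟩
      let y : G.Flag := ⟨(_, _), hmem φ (⟨j + 1, hj⟩ : Fin n)⟩
      let z : G.Flag := ⟨(_, _), hmem ψ (⟨j + 1, hj⟩ : Fin n)⟩
      have hjj : (⟨j + 1, hj⟩ : Fin n) ≠ (⟨j, by omega⟩ : Fin n) := by
        intro h
        have := congrArg Fin.val h
        simp at this
      have hy : y = R x := (hR4 x y rfl).resolve_left fun h =>
        hjj (φ.onE.injective (congrArg (fun f : G.Flag => f.1.2) h))
      have hz : z = R x := (hR4 x z h3.symm).resolve_left fun h =>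
        hjj (ψ.onE.injective ((congrArg (fun f : G.Flag => f.1.2) h).trans h2))
      exact congrArg (fun f : G.Flag => f.1.2) (hy.trans hz.symm)
  exact Iso.ext (fun v => (key v.1 v.2).1) fun a => (key a.1 a.2).2

/-- Isomorphisms from `C_n` correspond to flags, through the image of the flag at vertex 0. This
gives at once the automorphism group order and the fact that `C_n` is the only class. -/
theorem card_iso_cycleGraph {G : ExtGraph 0} {n : ℕ} (hn : 2 ≤ n) (hG : G ∈ WBiconn n 1 0) :
    Nat.card (Iso G (cycleGraph n hn)) = 2 * n := by
  obtain ⟨rfl, hk, hb⟩ := hG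
  have hdeg := hb.degree_eq_two hk
  have h1 : Nat.card (Iso G (cycleGraph G.n hn)) = Nat.card (Iso (cycleGraph G.n hn) G) :=
    Nat.card_congr ⟨Iso.symm, Iso.symm, fun _ => rfl, fun _ => rfl⟩
  rw [h1, ← card_flag hdeg]
  refine Nat.card_eq_of_bijective (fun φ : Iso (cycleGraph G.n hn) G =>
    (⟨(φ.onV (⟨0, G.pos⟩ : Fin G.n), φ.onE (⟨0, G.pos⟩ : Fin G.n)), by
      exact (φ.inc_onE_cycleGraph _).symm ▸ Sym2.mem_mk_left _ _⟩ : G.Flag)) ⟨fun φ ψ h => ?_, fun x => ?_⟩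
  · have h := congrArg Subtype.val h
    simp only [Prod.mk.injEq] at h
    exact iso_cycleGraph_ext hdeg hn h.1 h.2
  · obtain ⟨φ, h1, h2⟩ := exists_iso_cycleGraph hb.connected hdeg hn x
    exact ⟨φ, Subtype.ext (Prod.ext h1 h2)⟩

theorem cycleGraph_autOrder (n : ℕ) (hn : 2 ≤ n) : (cycleGraph n hn).autOrder = 2 * n :=
  card_iso_cycleGraph hn (cycleGraph_mem_wBiconn n hn)

theorem isAutWeighted_cycleVec (n : ℕ) (hn : 2 ≤ n) :
    IsAutWeighted (WBiconn n 1 0) ((1 / (2 * n : ℚ)) • cycleVec n) := by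
  classical
  have hpos : (0 : ℚ) < 2 * n := by positivity
  rw [cycleVec, dif_pos hn, Finsupp.smul_single, smul_eq_mul, mul_one]
  refine isAutWeighted_iff.2 ⟨fun G hG => ?_, fun G => ?_, fun G hG => ?_⟩
  · rw [mem_singleton.1 (Finsupp.support_single_subset hG)]
    exact cycleGraph_mem_wBiconn n hn
  · rw [Finsupp.single_apply]
    split_ifs <;> positivity
  · rw [isoCount_single, card_iso_cycleGraph hn hG]
    push_cast
    field_simp

/-! ### The specialized recursion -/

theorem cycleFamily_one (n : ℕ) : cycleFamily 0 n 1 = (1 / (2 * n : ℚ)) • cycleVec n := rfl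

theorem cycleFamily_of_ne_one (n : ℕ) {k : ℕ} (hk : k ≠ 1) : cycleFamily 0 n k = 0 := by
  rcases k with _ | _ | k
  · rfl
  · exact absurd rfl hk
  · rfl

theorem isAutWeighted_cycleFamily (n k : ℕ) (hn : 2 ≤ n) :
    IsAutWeighted {G | G ∈ WBiconn n k 0 ∧ G.AllBlocksCycles} (cycleFamily 0 n k) := by
  by_cases hk : k = 1
  · subst hk
    have : {G | G ∈ WBiconn n 1 0 ∧ G.AllBlocksCycles} = WBiconn n 1 0 :=
      Set.ext fun G => ⟨fun h => h.1, fun h => ⟨h, h.2.2.allBlocksCycles_iff.2 h.2.1⟩⟩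
    rw [this, cycleFamily_one]
    exact isAutWeighted_cycleVec n hn
  · rw [cycleFamily_of_ne_one n hk]
    exact isAutWeighted_zero fun G h => hk (h.1.2.1.symm.trans (h.1.2.2.allBlocksCycles_iff.1 h.2))

theorem r_smul (i : ℕ) (c : ℚ) (ϑ : ExtGraph 0 →₀ ℚ) (β : ExtGraph s →₀ ℚ) :
    r i (c • ϑ) β = c • r i ϑ β := by
  have h := Finsupp.sum_smul_index (g := ϑ) (b := c)
    (h := fun G' c => c • Finsupp.linearCombination ℚ (rGraph (s := s) i G'))
    (fun _ => zero_smul _ _)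
  unfold r
  rw [h, Finsupp.sum, Finsupp.sum, LinearMap.sum_apply, LinearMap.sum_apply, smul_sum]
  refine sum_congr rfl fun G' _ => ?_
  rw [LinearMap.smul_apply, LinearMap.smul_apply, mul_smul]

theorem r_zero_left (i : ℕ) (β : ExtGraph s →₀ ℚ) : r i 0 β = 0 := by
  unfold r
  rw [Finsupp.sum_zero_index, LinearMap.zero_apply]

theorem betaCycle_eq_betaEdge (n k : ℕ) (hn : 1 ≤ n) :
    betaCycle n k = betaEdge cycleFamily 0 n k := by
  induction n using Nat.strong_induction_on generalizing k with
  | _ n ih =>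
  rcases Nat.lt_or_ge n 2 with h2 | h2
  · obtain rfl : n = 1 := by omega
    rcases k with _ | k <;> rw [betaCycle, betaEdge]
  · rcases k with _ | k
    · obtain ⟨n, rfl⟩ := Nat.exists_eq_add_of_le' h2
      rw [betaCycle, betaEdge]
    · rw [betaCycle_eq n _ h2 (by omega), betaEdge_eq _ _ n _ h2 (by omega)]
      have h0 : (if k + 1 = 1 then (1 / (2 * n : ℚ)) • cycleVec n else 0)
          = cycleFamily 0 n (k + 1) := by
        split_ifs with h
        · rw [h, cycleFamily_one]
        · rw [cycleFamily_of_ne_one n h]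
      rw [h0]
      congr 1
      rcases k with _ | k
      -- At cyclomatic number one the general sum over `k'` is empty, while the specialized sum
      -- involves only graphs with at least two vertices and cyclomatic number zero, whose
      -- combination vanishes.
      · rw [zero_add, sum_eq_zero fun n' hn' => ?_, smul_zero, Nat.sub_self,
          Icc_eq_empty (by omega), sum_empty, smul_zero]
        refine sum_eq_zero fun i _ => ?_
        rw [mem_Icc] at hn'
        obtain ⟨t, ht⟩ := Nat.exists_eq_add_of_le' (by omega : 2 ≤ n - n' + 1)
        rw [ht, betaCycle, map_zero]
      -- Only `k' = 1` contributes; there the weight `n'` times the coefficient `1 / (2n')` of the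
      -- cycle is the factor `1 / 2`.
      · refine Eq.trans ?_ (congrArg (fun x => (_ : ℚ) • x) (sum_eq_single 1 ?_ ?_).symm)
        · rw [smul_sum, smul_sum]
          refine sum_congr rfl fun n' hn' => ?_
          rw [smul_sum, smul_sum]
          refine sum_congr rfl fun i _ => ?_
          rw [mem_Icc] at hn'
          rw [cycleFamily_one, r_smul, ih (n - n' + 1) (by omega) _ (by omega), smul_smul,
            smul_smul]
          congr 1
          have h1 : (n' : ℚ) ≠ 0 := by
            have : n' ≠ 0 := by omega
            exact_mod_cast this
          have h2 : (0 : ℚ) < ((k + 1 + 1 : ℕ) : ℚ) + n - 1 := by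
            push_cast
            have : (2 : ℚ) ≤ n := by exact_mod_cast h2
            have : (0 : ℚ) ≤ k := by positivity
            linarith
          have h3 := h2.ne'
          push_cast at h3 ⊢
          field_simp
          ring
        · intro k' _ hk'
          refine sum_eq_zero fun n' _ => sum_eq_zero fun i _ => ?_
          rw [cycleFamily_of_ne_one n' hk', r_zero_left, smul_zero]
        · intro h
          exact absurd (mem_Icc.2 ⟨le_rfl, by omega⟩) h

theorem isAutWeighted_betaCycle (n k : ℕ) (hn : 1 ≤ n) :
    IsAutWeighted (WCycle n k) (betaCycle n k) := by
  rw [betaCycle_eq_betaEdge n k hn]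
  refine isAutWeighted_betaEdge_of (P₀ := AllBlocksCycles) (P := AllBlocksCycles)
    (fun _ _ φ => φ.allBlocksCycles) (fun _ _ φ => φ.allBlocksCycles)
    (fun _ _ _ d => d.allBlocksCycles_iff) ?_ (fun n k hn _ => isAutWeighted_cycleFamily n k hn)
    (fun n k hn _ => isAutWeighted_cycleFamily n k hn) n k hn
  -- The point has no blocks at all, since a block has at least two vertices.
  intro U A hB
  have := hB.1.2.1.trans (card_le_univ U)
  rw [Fintype.card_fin] at this
  exact absurd this (by simp [point])

end ExtGraph

/-! ### The main theorem -/

theorem mainTheorem3 :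
    -- admissible biconnected inputs exist
    (∃ b : (t : ℕ) → ℕ → ℕ → (ExtGraph t →₀ ℚ),
      ∀ t n k : ℕ, 2 ≤ n → 1 ≤ k →
        ExtGraph.IsAutWeighted (ExtGraph.WBiconn n k t) (b t n k)) ∧
    -- the recursion, for every admissible biconnected input
    (∀ b : (t : ℕ) → ℕ → ℕ → (ExtGraph t →₀ ℚ),
      (∀ t n k : ℕ, 2 ≤ n → 1 ≤ k →
        ExtGraph.IsAutWeighted (ExtGraph.WBiconn n k t) (b t n k)) →
      ∀ s n k : ℕ, 1 ≤ n →
        ExtGraph.IsAutWeighted (ExtGraph.WTwoEdge n k s) (ExtGraph.betaEdge b s n k)) ∧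
    -- the biconnected graphs of cyclomatic number one: cycles, with coefficient `1 / (2n)`
    (∀ n : ℕ, ∀ hn : 2 ≤ n, (ExtGraph.cycleGraph n hn).autOrder = 2 * n ∧
      ExtGraph.IsAutWeighted (ExtGraph.WBiconn n 1 0)
        ((1 / (2 * n : ℚ)) • ExtGraph.cycleVec n)) ∧
    -- the specialized recursion is the recursion whose biconnected input consists of the cycles,
    -- and it generates the graphs every biconnected component of which is a cycle
    (∀ n k : ℕ, 1 ≤ n →
      ExtGraph.betaCycle n k = ExtGraph.betaEdge ExtGraph.cycleFamily 0 n k) ∧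
    (∀ n k : ℕ, 1 ≤ n →
      ExtGraph.IsAutWeighted (ExtGraph.WCycle n k) (ExtGraph.betaCycle n k)) := by
  choose b hb using fun t n k => ExtGraph.exists_isAutWeighted_wBiconn n k t
  exact ⟨⟨b, fun t n k _ _ => hb t n k⟩,
    fun b hb s n k hn => ExtGraph.isAutWeighted_betaEdge hb s n k hn,
    fun n hn => ⟨ExtGraph.cycleGraph_autOrder n hn, ExtGraph.isAutWeighted_cycleVec n hn⟩,
    ExtGraph.betaCycle_eq_betaEdge, ExtGraph.isAutWeighted_betaCycle⟩
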